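/- Let $\Gamma=\mathbb{Z}/2\mathbb{Z}$. For a (small) groupoid $G$ with a strict $\Gamma$-action (i.e. $\Gamma$ acts on objects and on morphisms compatibly with the structure maps; the action of the non-trivial element is written $x\mapsto\bar x$, $\alpha\mapsto\bar\alpha$), let $G^{h\Gamma}$ be the groupoid whose objects are the pairs $(x,\phi)$ with $\phi\colon x\to\bar x$ and $\bar\phi=\phi^{-1}$, and whose arrows $(x,\phi)\to(x_1,\phi_1)$ are the $\alpha\colon x\to x_1$ with $\phi_1\alpha=\bar\alpha\phi$. An equivariant map $f$ induces $f^{h\Gamma}\colon (x,\phi)\mapsto (f(x),f(\phi))$, $\alpha\mapsto f(\alpha)$. Let $\mathcal{C}$ be a small site with enough points. A presheaf of groupoids on $\mathcal{C}$ is a strict functor $\mathcal{C}^{op}\to\mathrm{Grpd}$; if $\Gamma$ acts on the sections $X(U)$ compatibly with restriction, put $X^{h\Gamma}(U)=X(U)^{h\Gamma}$. A morphism of presheaves of groupoids is a local weak equivalence if it induces equivalences of groupoids on the stalks at all points of $\mathcal{C}$. A stack is a sheaf of groupoids all of whose descent data, for all coverings, are effective. A morphism $\eta\colon X\to Y$ of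 presheaves of groupoids exhibits $Y$ as the stack completion $[X]$ of $X$ if $Y$ is a stack and, for each stack $Z$, restriction along $\eta$ is an equivalence of categories $\mathrm{Hom}(Y,Z)\to\mathrm{Hom}(X,Z)$, where $\mathrm{Hom}$ denotes the category of pseudonatural transformations and modifications. Let $X$ be a presheaf of groupoids on $\mathcal{C}$ with $\Gamma$-action. Then $X$ has a stack completion $\eta\colon X\to[X]$ such that $\Gamma$ acts on $[X]$ and $\eta$ is $\Gamma$-equivariant; and for every such $\Gamma$-equivariant stack completion $\eta\colon X\to [X]$ the induced morphism $$\eta^{h\Gamma}\colon X^{h\Gamma}\longrightarrow [X]^{h\Gamma}$$ is a local weak equivalence. -/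

import Mathlib

open CategoryTheory Opposite

universe u

/-- The group `ℤ/2ℤ`, written multiplicatively. -/
abbrev Gam : Type := Multiplicative (ZMod 2)

/-- The groupoid of homotopy fixed points of a groupoid `G` with an action of `ℤ/2ℤ`, the
non-trivial element acting by the functor `σ`, written `x ↦ x̄`, `α ↦ ᾱ`, with `σ ⋙ σ = 𝟭 G`.
Its objects are the pairs `(x, φ)` with `φ : x ⟶ x̄` and `φ̄ = φ⁻¹`. As `φ̄` is a morphism from `x̄`
to the object `σ (σ x) = x`, the last condition is expressed as `φ ≫ φ̄ = 𝟙 x`, up to the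
identification of the target with `x`. -/
@[ext]
structure HFix {G : Type u} [Groupoid.{u} G] (σ : G ⥤ G) (hσ : σ ⋙ σ = 𝟭 G) : Type u where
  pt : G
  iso : pt ⟶ σ.obj pt
  iso_comp_bar : iso ≫ σ.map iso = eqToHom (Functor.congr_obj hσ pt).symm

namespace HFix

section

variable {G : Type u} [Groupoid.{u} G] {σ : G ⥤ G} {hσ : σ ⋙ σ = 𝟭 G}

/-- Arrows `(x, φ) ⟶ (x₁, φ₁)` are the `α : x ⟶ x₁` with `φ₁ ∘ α = ᾱ ∘ φ`. -/
@[ext]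
structure Hom (p q : HFix σ hσ) : Type u where
  hom : p.pt ⟶ q.pt
  comm : hom ≫ q.iso = p.iso ≫ σ.map hom

instance : Groupoid (HFix σ hσ) where
  Hom := Hom
  id p := ⟨𝟙 _, by simp⟩
  comp f g := ⟨f.hom ≫ g.hom, by
    rw [Category.assoc, g.comm, ← Category.assoc, f.comm, Category.assoc, Functor.map_comp]⟩
  id_comp f := Hom.ext (Category.id_comp _)
  comp_id f := Hom.ext (Category.comp_id _)
  assoc f g h := Hom.ext (Category.assoc _ _ _)
  inv f := ⟨Groupoid.inv f.hom, by
    have h := f.comm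
    rw [Groupoid.inv_eq_inv, Functor.map_inv, IsIso.inv_comp_eq, ← Category.assoc, h,
      Category.assoc, IsIso.hom_inv_id, Category.comp_id]⟩
  inv_comp f := Hom.ext (Groupoid.inv_comp _)
  comp_inv f := Hom.ext (Groupoid.comp_inv _)

@[simp] lemma id_hom (p : HFix σ hσ) : Hom.hom (𝟙 p) = 𝟙 p.pt := rfl

@[simp] lemma comp_hom {p q r : HFix σ hσ} (f : p ⟶ q) (g : q ⟶ r) :
    Hom.hom (f ≫ g) = Hom.hom f ≫ Hom.hom g := rfl

variable {G' : Type u} [Groupoid.{u} G'] {σ' : G' ⥤ G'} {hσ' : σ' ⋙ σ' = 𝟭 G'}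

/-- The map `(x, φ) ↦ (F x, F φ)` on objects induced by an equivariant map `F`. -/
@[simps]
def mapObj (F : G ⥤ G') (hF : σ ⋙ F = F ⋙ σ') (p : HFix σ hσ) : HFix σ' hσ' where
  pt := F.obj p.pt
  iso := F.map p.iso ≫ eqToHom (Functor.congr_obj hF p.pt)
  iso_comp_bar := by
    have h : σ'.map (F.map p.iso) = _ := Functor.congr_hom hF.symm p.iso
    rw [Functor.map_comp, h, eqToHom_map]
    simp only [Category.assoc, eqToHom_trans_assoc, eqToHom_refl, Category.id_comp,
      Functor.comp_map]
    rw [← Functor.map_comp_assoc, p.iso_comp_bar, eqToHom_map]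
    simp

/-- The map `(x, φ) ↦ (F x, F φ)`, `α ↦ F α` induced by an equivariant map `F`. -/
def map (F : G ⥤ G') (hF : σ ⋙ F = F ⋙ σ') : HFix σ hσ ⥤ HFix σ' hσ' where
  obj p := mapObj F hF p
  map {p q} α := ⟨F.map (Hom.hom α), by
    have h : σ'.map (F.map (Hom.hom α)) = _ := Functor.congr_hom hF.symm (Hom.hom α)
    have h' := congrArg F.map (Hom.comm α)
    simp only [Functor.map_comp] at h'
    change F.map (Hom.hom α) ≫ F.map q.iso ≫ eqToHom _ =
      (F.map p.iso ≫ eqToHom _) ≫ σ'.map (F.map (Hom.hom α))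
    rw [h]
    simp [reassoc_of% h']⟩
  map_id p := Hom.ext (F.map_id _)
  map_comp α β := Hom.ext (F.map_comp _ _)

lemma mapObj_comp_iso {G'' : Type u} [Groupoid.{u} G''] {σ'' : G'' ⥤ G''}
    (F : G ⥤ G') (hF : σ ⋙ F = F ⋙ σ') (F' : G' ⥤ G'') (hF' : σ' ⋙ F' = F' ⋙ σ'')
    {x : G} (φ : x ⟶ σ.obj x) (h : F'.obj (F.obj (σ.obj x)) = σ''.obj (F'.obj (F.obj x))) :
    F'.map (F.map φ) ≫ eqToHom h =
      F'.map (F.map φ ≫ eqToHom (Functor.congr_obj hF x)) ≫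
        eqToHom (Functor.congr_obj hF' (F.obj x)) := by
  simp [eqToHom_map]

lemma functor_ext {D : Type u} [Category.{u} D] (P Q : D ⥤ HFix σ hσ)
    (h₁ : ∀ d, (P.obj d).pt = (Q.obj d).pt)
    (h₂ : ∀ d, (P.obj d).iso ≍ (Q.obj d).iso)
    (h₃ : ∀ {d e} (f : d ⟶ e), (P.map f).hom ≍ (Q.map f).hom) : P = Q := by
  have hobj : ∀ d, P.obj d = Q.obj d := fun d ↦ HFix.ext (h₁ d) (h₂ d)
  refine Functor.hext hobj fun d e f ↦ ?_
  have key : ∀ {a a' b b' : HFix σ hσ} (_ : a = a') (_ : b = b') (u : a ⟶ b) (v : a' ⟶ b'),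
      Hom.hom u ≍ Hom.hom v → u ≍ v := by
    rintro a _ b _ rfl rfl u v h
    exact heq_of_eq (Hom.ext (eq_of_heq h))
  exact key (hobj d) (hobj e) _ _ (h₃ f)

end

/-- The action `x ↦ x̄`, `α ↦ ᾱ` of the non-trivial element of `ℤ/2ℤ` on a groupoid with
`ℤ/2ℤ`-action. Actions are strict: the group acts by functors, and the action laws are equalities
of functors. -/
def bar (A : Action Grpd.{u, u} Gam) : A.V ⥤ A.V := A.ρ (Multiplicative.ofAdd 1)

lemma bar_comp_bar (A : Action Grpd.{u, u} Gam) : bar A ⋙ bar A = 𝟭 A.V := by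
  have h : A.ρ (Multiplicative.ofAdd 1) * A.ρ (Multiplicative.ofAdd 1) = 1 := by
    rw [← map_mul, ← map_one A.ρ]
    exact congrArg A.ρ (by decide)
  exact h

end HFix

/-- Homotopy fixed points `A ↦ A^{hΓ}`, as a functor from groupoids with `Γ`-action (and
equivariant maps) to groupoids. -/
def hFix : Action Grpd.{u, u} Gam ⥤ Grpd.{u, u} where
  obj A := Grpd.of (HFix (HFix.bar A) (HFix.bar_comp_bar A))
  map f := HFix.map f.hom (f.comm _)
  map_id _ := HFix.functor_ext _ _ (fun _ ↦ rfl)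
    (fun _ ↦ heq_of_eq (Category.comp_id _)) (fun _ ↦ HEq.rfl)
  map_comp f g := HFix.functor_ext _ _ (fun _ ↦ rfl)
    (fun p ↦ heq_of_eq
      (HFix.mapObj_comp_iso (σ'' := HFix.bar _) f.hom (f.comm _) g.hom (g.comm _) p.iso _))
    (fun _ ↦ HEq.rfl)

section Presheaves

variable {C : Type u} [SmallCategory C]

/-- A presheaf of groupoids, with `Γ`-actions on its sections compatible with restriction. -/
abbrev PreGrpdAct (C : Type u) [SmallCategory C] := Cᵒᵖ ⥤ Action Grpd.{u, u} Gam

/-- The underlying presheaf of groupoids. -/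
abbrev PreGrpdAct.toPreGrpd (X : PreGrpdAct C) : Cᵒᵖ ⥤ Grpd.{u, u} :=
  X ⋙ Action.forget _ _

/-- The underlying morphism of presheaves of groupoids of an equivariant morphism. -/
abbrev PreGrpdAct.forgetMap {X Y : PreGrpdAct C} (f : X ⟶ Y) : X.toPreGrpd ⟶ Y.toPreGrpd :=
  Functor.whiskerRight f (Action.forget _ _)

/-- The presheaf of groupoids `X^{hΓ}`, given by `X^{hΓ}(U) = X(U)^{hΓ}`. -/
abbrev PreGrpdAct.hFixed (X : PreGrpdAct C) : Cᵒᵖ ⥤ Grpd.{u, u} := X ⋙ hFix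

/-- The morphism `f^{hΓ}`, given on sections over `U` by `f(U)^{hΓ}`. -/
abbrev PreGrpdAct.hFixedMap {X Y : PreGrpdAct C} (f : X ⟶ Y) : X.hFixed ⟶ Y.hFixed :=
  Functor.whiskerRight f hFix

/-- A morphism of presheaves of groupoids is a local weak equivalence if it induces an
equivalence on the stalks at all points of the site. The stalk `X_t` is the colimit of `X(U)` over
the (cofiltered) category of neighbourhoods of `t`; it is taken in the category of categories, into
which the inclusion of groupoids preserves all colimits. -/
def IsLocalWeakEquiv (J : GrothendieckTopology C) {X Y : Cᵒᵖ ⥤ Grpd.{u, u}} (f : X ⟶ Y) : Prop :=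
  ∀ t : GrothendieckTopology.Point.{u} J,
    (t.presheafFiber.map (Functor.whiskerRight f Grpd.forgetToCat)).toFunctor.IsEquivalence

/-- A presheaf of groupoids (a strict functor), regarded as a pseudofunctor. -/
abbrev toPseudo (X : Cᵒᵖ ⥤ Grpd.{u, u}) : Pseudofunctor (LocallyDiscrete Cᵒᵖ) Cat.{u, u} :=
  (X ⋙ Grpd.forgetToCat).toPseudofunctor'

/-- A stack is a sheaf of groupoids for which all descent data are effective. -/
structure IsStackGrpd (J : GrothendieckTopology C) (X : Cᵒᵖ ⥤ Grpd.{u, u}) : Prop where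
  isSheaf : Presheaf.IsSheaf J X
  isStack : (toPseudo X).IsStack J

open Bicategory Pseudofunctor.StrongTrans

section

variable {I : Type*} [Category* I] {B : Type*} [Bicategory B] [Strict B]

lemma strict_naturality_two {a b a' b' : B} {p : a ⟶ b} {q : a' ⟶ b'} (φ : a ⟶ a')
    (φ' : b ⟶ b') (e : p ≫ φ' ⟶ φ ≫ q) : 𝟙 p ▷ φ' ≫ e = e ≫ φ ◁ 𝟙 q := by
  simp

lemma strict_naturality_id {a b : B} {p : a ⟶ a} {q : b ⟶ b} (φ : a ⟶ b) (hp : p = 𝟙 a)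
    (hq : q = 𝟙 b) (h : p ≫ φ = φ ≫ q) :
    (eqToIso h).hom ≫ φ ◁ (eqToIso hq).hom =
      (eqToIso hp).hom ▷ φ ≫ (λ_ φ).hom ≫ (ρ_ φ).inv := by
  subst hp hq
  simp [Strict.leftUnitor_eqToIso, Strict.rightUnitor_eqToIso]

lemma strict_naturality_comp {a b c a' b' c' : B} {f : a ⟶ b} {g : b ⟶ c} {fg : a ⟶ c}
    {f' : a' ⟶ b'} {g' : b' ⟶ c'} {fg' : a' ⟶ c'} (φa : a ⟶ a') (φb : b ⟶ b') (φc : c ⟶ c')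
    (h : fg = f ≫ g) (h' : fg' = f' ≫ g')
    (nf : f ≫ φb = φa ≫ f') (ng : g ≫ φc = φb ≫ g') (nfg : fg ≫ φc = φa ≫ fg') :
    (eqToIso nfg).hom ≫ φa ◁ (eqToIso h').hom =
      (eqToIso h).hom ▷ φc ≫ (α_ _ _ _).hom ≫ f ◁ (eqToIso ng).hom ≫
        (α_ _ _ _).inv ≫ (eqToIso nf).hom ▷ g' ≫ (α_ _ _ _).hom := by
  subst h h'
  simp [Strict.associator_eqToIso, whiskerLeft_eqToHom, eqToHom_whiskerRight]

/-- A (strict) natural transformation of functors to a strict bicategory, regarded as a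
pseudonatural transformation. -/
def strongTransOfNatTrans {F G : I ⥤ B} (f : F ⟶ G) :
    F.toPseudofunctor' ⟶ G.toPseudofunctor' where
  app U := f.app U.as
  naturality g := eqToIso (f.naturality g.as)
  naturality_naturality η := by
    obtain rfl := LocallyDiscrete.eq_of_hom η
    obtain rfl := Subsingleton.elim η (𝟙 _)
    rw [PrelaxFunctor.map₂_id, PrelaxFunctor.map₂_id]
    exact strict_naturality_two _ _ _
  naturality_id U := strict_naturality_id (f.app U.as) (F.map_id _) (G.map_id _) _
  naturality_comp g h := strict_naturality_comp _ _ _ (F.map_comp g.as h.as)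
    (G.map_comp g.as h.as) (f.naturality g.as) (f.naturality h.as) _

end

/-- A morphism of presheaves of groupoids (a strict natural transformation), regarded as a
pseudonatural transformation. -/
abbrev toPseudoMap {X Y : Cᵒᵖ ⥤ Grpd.{u, u}} (f : X ⟶ Y) : toPseudo X ⟶ toPseudo Y :=
  strongTransOfNatTrans (Functor.whiskerRight f Grpd.forgetToCat)

/-- `η : X ⟶ Y` exhibits `Y` as the stack completion of `X`: it is the unit at `X` of the
left adjoint to the forgetful functor from stacks to presheaves of groupoids. The adjunction is one
of 2-categories: `Y` is a stack, and for each stack `Z` restriction along `η` is an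
equivalence from the category of (pseudonatural) morphisms `Y ⟶ Z` to that of morphisms
`X ⟶ Z`. -/
structure IsStackCompletion (J : GrothendieckTopology C) {X Y : Cᵒᵖ ⥤ Grpd.{u, u}}
    (η : X ⟶ Y) : Prop where
  isStack : IsStackGrpd J Y
  isEquivalence : ∀ Z : Cᵒᵖ ⥤ Grpd.{u, u}, IsStackGrpd J Z →
    (precomp (toPseudo Z) (toPseudoMap η)).IsEquivalence

end Presheaves

/-! Call a morphism a local equivalence if it is locally faithful, locally full and locally
essentially surjective (`IsLocEquiv`). The second assertion combines three facts: a stack completion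
is a local equivalence (`IsStackCompletion.isLocEquiv`), homotopy fixed points preserve local
equivalences (`IsLocEquiv.hFixedMap`), and local equivalences induce equivalences on stalks
(`IsLocEquiv.isLocalWeakEquiv`). For the middle one, let (y, ψ) be a homotopy fixed point of the
target. Locally y is isomorphic to the image of some x, and on a finer covering ψ lifts to φ : x ⟶
x̄. The relation φ̄φ = 1 holds after applying η, hence in X after one more covering, by local
faithfulness. Arrows are treated in the same way.

For existence, let Z be the product of the skyscrapers of the stalks of X at a small set of points
that detects coverings. It is a stack and a strict sheaf, and γ : X ⟶ Z is locally faithful because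
there are enough points. The completion consists of pairs (z, P), where z is a section of Z and P is
an X-torsor realized in z: a set of arrows γ x ⟶ z, of local nature, locally non-empty, any two of
which differ locally by an arrow of X. Abstract torsors would restrict only pseudofunctorially; as
sets of arrows of Z they restrict and glue strictly, so they form a sheaf as well as a stack. The
map x ↦ (γ x, trivial torsor) is a local equivalence (`isLocEquiv_torsUnit`). The construction is
strictly functorial in X, so Γ acts on it and the unit is equivariant.

A local equivalence η has the universal property for maps to stacks
(`FunOver.isEquivalence_precomp`): a functor on X extends to the full image of η by gluing arrows,
and then to any y by descent along a covering of y by images. Conversely, an arbitrary stack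
completion η : X ⟶ Y is compared with the torsor completion θ : X ⟶ W. The universal properties give
F and G with Fη ≅ θ, Gθ ≅ η and GF ≅ 1, so η inherits the local properties of θ
(`FunOver.IsLocEquiv.of_isEquivalence_precomp`).

The arguments take place in the total category of a presheaf of groupoids. There pseudonatural
transformations become functors over the site (`pFunctor`), the stack condition becomes gluing of
arrows and of objects (`isStack_iff_totStack`), and the coherence isomorphisms are absorbed by
cartesian arrows. -/

/-- The groupoid of sections of a presheaf of groupoids over `U`. -/
def Sec {C : Type u} [SmallCategory C] (X : Cᵒᵖ ⥤ Grpd.{u, u}) (U : C) : Type u := X.obj (op U)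

instance {C : Type u} [SmallCategory C] (X : Cᵒᵖ ⥤ Grpd.{u, u}) (U : C) : Groupoid (Sec X U) :=
  inferInstanceAs (Groupoid (X.obj (op U)))

/-- The restriction functor `X(U) ⥤ X(V)` of a presheaf of groupoids. -/
def res {C : Type u} [SmallCategory C] (X : Cᵒᵖ ⥤ Grpd.{u, u}) {V U : C} (f : V ⟶ U) :
    Sec X U ⥤ Sec X V := X.map f.op

/-! ### Restriction functors and their strict functoriality. -/

section Restriction

variable {C : Type u} [SmallCategory C] (X : Cᵒᵖ ⥤ Grpd.{u, u})

lemma res_id (U : C) : res X (𝟙 U) = 𝟭 _ := X.map_id _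

lemma res_comp {W V U : C} (g : W ⟶ V) (f : V ⟶ U) : res X (g ≫ f) = res X f ⋙ res X g :=
  X.map_comp _ _

lemma res_id_obj {U : C} (x : Sec X U) : (res X (𝟙 U)).obj x = x :=
  Functor.congr_obj (res_id X U) x

lemma res_comp_obj {W V U : C} (g : W ⟶ V) (f : V ⟶ U) (x : Sec X U) :
    (res X (g ≫ f)).obj x = (res X g).obj ((res X f).obj x) :=
  Functor.congr_obj (res_comp X g f) x

lemma res_obj_congr {V U : C} {f f' : V ⟶ U} (h : f = f') (x : Sec X U) :
    (res X f).obj x = (res X f').obj x := by rw [h]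

lemma res_id_map {U : C} {x y : Sec X U} (m : x ⟶ y) :
    (res X (𝟙 U)).map m = eqToHom (res_id_obj X x) ≫ m ≫ eqToHom (res_id_obj X y).symm :=
  Functor.congr_hom (res_id X U) m

lemma res_comp_map {W V U : C} (g : W ⟶ V) (f : V ⟶ U) {x y : Sec X U} (m : x ⟶ y) :
    (res X (g ≫ f)).map m = eqToHom (res_comp_obj X g f x) ≫
      (res X g).map ((res X f).map m) ≫ eqToHom (res_comp_obj X g f y).symm :=
  Functor.congr_hom (res_comp X g f) m

variable {X} {Y : Cᵒᵖ ⥤ Grpd.{u, u}} (φ : X ⟶ Y)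

/-- The functor `X(U) ⥤ Y(U)` underlying a morphism of presheaves of groupoids. -/
def sec (U : C) : Sec X U ⥤ Sec Y U := φ.app (op U)

lemma res_sec {V U : C} (f : V ⟶ U) : res X f ⋙ sec φ V = sec φ U ⋙ res Y f :=
  φ.naturality f.op

lemma res_sec_obj {V U : C} (f : V ⟶ U) (x : Sec X U) :
    (sec φ V).obj ((res X f).obj x) = (res Y f).obj ((sec φ U).obj x) :=
  Functor.congr_obj (res_sec φ f) x

lemma res_sec_map {V U : C} (f : V ⟶ U) {x y : Sec X U} (m : x ⟶ y) :
    (sec φ V).map ((res X f).map m) = eqToHom (res_sec_obj φ f x) ≫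
      (res Y f).map ((sec φ U).map m) ≫ eqToHom (res_sec_obj φ f y).symm :=
  Functor.congr_hom (res_sec φ f) m

end Restriction

/-! ### The total category, fibred in groupoids. -/

/-- The total category of a presheaf of groupoids `X`: its objects are the pairs `(U, x)` with
`x ∈ X(U)`, and its arrows `(V, x) ⟶ (U, y)` are the pairs of an `f : V ⟶ U` and an arrow from `x`
to the restriction of `y` along `f`. -/
structure Tot {C : Type u} [SmallCategory C] (X : Cᵒᵖ ⥤ Grpd.{u, u}) : Type u where
  base : C
  pt : Sec X base

namespace Tot

variable {C : Type u} [SmallCategory C] {X : Cᵒᵖ ⥤ Grpd.{u, u}}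

/-- Arrows in the total category. -/
structure Hom (a b : Tot X) : Type u where
  base : a.base ⟶ b.base
  hom : a.pt ⟶ (res X base).obj b.pt

/-- The vertical part of an arrow over `f`. -/
def Hom.at {a b : Tot X} (φ : Hom a b) (f : a.base ⟶ b.base) (h : φ.base = f) :
    a.pt ⟶ (res X f).obj b.pt := φ.hom ≫ eqToHom (res_obj_congr X h b.pt)

/-- Parallel arrows may lie over base arrows that are equal only propositionally. Transporting both
vertical parts to a common `f` places them in one hom-set and avoids heterogeneous equality. -/
lemma Hom.ext_at {a b : Tot X} {φ ψ : Hom a b} (f : a.base ⟶ b.base) (h : φ.base = f)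
    (h' : ψ.base = f) (e : φ.at f h = ψ.at f h') : φ = ψ := by
  obtain ⟨f, m⟩ := φ
  obtain ⟨g, n⟩ := ψ
  obtain rfl : f = _ := h
  obtain rfl : g = f := h'
  obtain rfl : m = n := by simpa [Hom.at] using e
  rfl

instance : Category (Tot X) where
  Hom := Hom
  id a := ⟨𝟙 _, eqToHom (res_id_obj X a.pt).symm⟩
  comp {a b c} φ ψ := ⟨φ.base ≫ ψ.base, φ.hom ≫ (res X φ.base).map ψ.hom ≫
    eqToHom (res_comp_obj X φ.base ψ.base c.pt).symm⟩
  id_comp φ := Hom.ext_at φ.base (Category.id_comp _) rfl (by simp [Hom.at, res_id_map])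
  comp_id φ := Hom.ext_at φ.base (Category.comp_id _) rfl (by simp [Hom.at, eqToHom_map])
  assoc φ ψ χ := Hom.ext_at _ (Category.assoc _ _ _) rfl
    (by simp [Hom.at, res_comp_map, eqToHom_map])

/-- The image in `C` of an arrow of the total category. -/
def bs {a b : Tot X} (φ : a ⟶ b) : a.base ⟶ b.base := Hom.base φ

/-- The vertical part of an arrow over `f` of the total category. -/
def vat {a b : Tot X} (φ : a ⟶ b) (f : a.base ⟶ b.base) (h : bs φ = f) :
    a.pt ⟶ (res X f).obj b.pt := Hom.at φ f h

lemma hom_ext {a b : Tot X} {φ ψ : a ⟶ b} (f : a.base ⟶ b.base) (h : bs φ = f) (h' : bs ψ = f)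
    (e : vat φ f h = vat ψ f h') : φ = ψ := Hom.ext_at f h h' e

@[simp] lemma id_bs (a : Tot X) : bs (𝟙 a) = 𝟙 _ := rfl

@[simp] lemma comp_bs {a b c : Tot X} (φ : a ⟶ b) (ψ : b ⟶ c) : bs (φ ≫ ψ) = bs φ ≫ bs ψ := rfl

/-- The arrow of the total category with the given components. -/
def mkHom {a b : Tot X} (f : a.base ⟶ b.base) (m : a.pt ⟶ (res X f).obj b.pt) : a ⟶ b :=
  ⟨f, m⟩

@[simp] lemma mkHom_bs {a b : Tot X} (f : a.base ⟶ b.base) (m : a.pt ⟶ (res X f).obj b.pt) :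
    bs (mkHom f m) = f := rfl

lemma id_vat (a : Tot X) (f : a.base ⟶ a.base) (h : bs (𝟙 a) = f) :
    vat (𝟙 a) f h = eqToHom (by rw [← h]; exact (res_id_obj X a.pt).symm) := by
  obtain rfl : 𝟙 _ = f := h
  simp [vat, Hom.at, CategoryStruct.id]

lemma comp_vat {a b c : Tot X} (φ : a ⟶ b) (ψ : b ⟶ c) (k : a.base ⟶ c.base)
    (h : bs (φ ≫ ψ) = k) {f : a.base ⟶ b.base} (hf : bs φ = f) {g : b.base ⟶ c.base}
    (hg : bs ψ = g) :
    vat (φ ≫ ψ) k h = vat φ f hf ≫ (res X f).map (vat ψ g hg) ≫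
      eqToHom (by rw [← h, comp_bs, hf, hg, res_comp_obj]) := by
  subst hf hg
  obtain rfl : bs φ ≫ bs ψ = k := h
  simp [vat, Hom.at, CategoryStruct.comp, bs]

lemma mkHom_vat {a b : Tot X} (f : a.base ⟶ b.base) (m : a.pt ⟶ (res X f).obj b.pt)
    {g : a.base ⟶ b.base} (h : bs (mkHom f m) = g) :
    vat (mkHom f m) g h = m ≫ eqToHom (res_obj_congr X (show f = g from h) b.pt) := rfl

@[simp] lemma mkHom_vat_self {a b : Tot X} (f : a.base ⟶ b.base)
    (m : a.pt ⟶ (res X f).obj b.pt) (h : bs (mkHom f m) = f) :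
    vat (mkHom f m) f h = m := by simp [mkHom_vat]

lemma vat_congr {a b : Tot X} {φ ψ : a ⟶ b} (e : φ = ψ) {f : a.base ⟶ b.base} (h : bs φ = f)
    {g : a.base ⟶ b.base} (h' : bs ψ = g) :
    vat φ f h = vat ψ g h' ≫ eqToHom (by rw [← h, ← h', e]) := by
  subst e h h'
  simp

@[simp] lemma mkHom_vat_bs {a b : Tot X} (φ : a ⟶ b) {f : a.base ⟶ b.base} (h : bs φ = f) :
    mkHom f (vat φ f h) = φ := hom_ext f (mkHom_bs _ _) h (by simp)

/-- The cartesian arrow `(V, x|_V) ⟶ (U, x)`. -/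
def cart (x : Tot X) {V : C} (f : V ⟶ x.base) : (⟨V, (res X f).obj x.pt⟩ : Tot X) ⟶ x :=
  mkHom f (𝟙 _)

@[simp] lemma cart_bs (x : Tot X) {V : C} (f : V ⟶ x.base) : bs (cart x f) = f := rfl

@[simp] lemma cart_vat_self (x : Tot X) {V : C} (f : V ⟶ x.base) (h : bs (cart x f) = f) :
    vat (cart x f) f h = 𝟙 _ := mkHom_vat_self _ _ _

/-- An arrow of `X(U)` as an arrow of the total category. -/
def vert {U : C} {x y : Sec X U} (m : x ⟶ y) : (⟨U, x⟩ : Tot X) ⟶ ⟨U, y⟩ :=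
  mkHom (𝟙 U) (m ≫ eqToHom (res_id_obj X y).symm)

@[simp] lemma vert_bs {U : C} {x y : Sec X U} (m : x ⟶ y) : bs (vert m) = 𝟙 U := rfl

@[simp] lemma vert_vat_self {U : C} {x y : Sec X U} (m : x ⟶ y) (h : bs (vert m) = 𝟙 U) :
    vat (vert m) (𝟙 U) h = m ≫ eqToHom (res_id_obj X y).symm :=
  mkHom_vat_self (a := ⟨U, x⟩) (b := ⟨U, y⟩) _ _ _

@[simp] lemma vert_id {U : C} (x : Sec X U) : vert (𝟙 x) = 𝟙 (⟨U, x⟩ : Tot X) :=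
  hom_ext (𝟙 U) (vert_bs _) (id_bs _) (by rw [vert_vat_self, Category.id_comp, id_vat])

lemma vert_comp {U : C} {x y z : Sec X U} (m : x ⟶ y) (n : y ⟶ z) :
    vert (m ≫ n) = vert m ≫ vert n :=
  hom_ext (𝟙 U) (vert_bs _) (by simp) (by
    rw [comp_vat (vert m) (vert n) (𝟙 U) (by simp) (vert_bs m) (vert_bs n), vert_vat_self,
      vert_vat_self, vert_vat_self, res_id_map]
    simp)

lemma vert_comp_assoc {U : C} {x y z : Sec X U} (m : x ⟶ y) (n : y ⟶ z) {a : Tot X}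
    (h : (⟨U, z⟩ : Tot X) ⟶ a) : vert (m ≫ n) ≫ h = vert m ≫ vert n ≫ h := by
  rw [vert_comp, Category.assoc]

lemma vert_eqToHom {U : C} {x y : Sec X U} (h : x = y) :
    vert (eqToHom h) = eqToHom (congrArg (Tot.mk U) h) := by
  subst h
  exact vert_id _

lemma vert_injective {U : C} {x y : Sec X U} {m n : x ⟶ y} (h : vert m = vert n) :
    m = n := by
  have h' := vat_congr h (vert_bs m) (vert_bs n)
  simp only [vert_vat_self] at h'
  simpa [cancel_mono] using h'

/-- An arrow over an identity comes from an arrow of `X(U)`. -/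
lemma exists_vert {U : C} {x y : Sec X U} (φ : (⟨U, x⟩ : Tot X) ⟶ ⟨U, y⟩)
    (h : bs φ = 𝟙 U) : ∃ m : x ⟶ y, vert m = φ :=
  ⟨vat φ (𝟙 U) h ≫ eqToHom (res_id_obj X y), hom_ext (𝟙 U) (vert_bs _) h (by simp)⟩

lemma mkHom_eq {a b : Tot X} (f : a.base ⟶ b.base) (m : a.pt ⟶ (res X f).obj b.pt) :
    mkHom f m = (vert m : a ⟶ _) ≫ cart b f :=
  hom_ext f (mkHom_bs _ _) (by simp) (by
    rw [comp_vat (vert m) (cart b f) f (by simp) (vert_bs m) (cart_bs b f), cart_vat_self,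
      vert_vat_self]
    simp)

lemma vert_cart {a b : Tot X} (φ : a ⟶ b) {f : a.base ⟶ b.base} (h : bs φ = f) :
    (vert (vat φ f h) : a ⟶ _) ≫ cart b f = φ := by
  rw [← mkHom_eq, mkHom_vat_bs]

lemma cart_vert {V U : C} (f : V ⟶ U) {x y : Sec X U} (m : x ⟶ y) :
    cart ⟨U, x⟩ f ≫ vert m = vert ((res X f).map m) ≫ cart ⟨U, y⟩ f := by
  rw [← mkHom_eq (a := ⟨V, (res X f).obj x⟩) (b := ⟨U, y⟩)]
  refine hom_ext f (by simp) (mkHom_bs _ _) ?_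
  rw [comp_vat (cart ⟨U, x⟩ f) (vert m) f (by simp) (cart_bs ⟨U, x⟩ f) (vert_bs m),
    cart_vat_self, vert_vat_self, mkHom_vat_self]
  simp [eqToHom_map]

lemma cart_vert_assoc {V U : C} (f : V ⟶ U) {x y : Sec X U} (m : x ⟶ y) {a : Tot X}
    (h : (⟨U, y⟩ : Tot X) ⟶ a) :
    cart ⟨U, x⟩ f ≫ vert m ≫ h = vert ((res X f).map m) ≫ cart ⟨U, y⟩ f ≫ h := by
  rw [← Category.assoc, cart_vert, Category.assoc]

lemma cart_comp_cart (x : Tot X) {W V : C} (f : V ⟶ x.base) (g : W ⟶ V) :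
    cart (⟨V, (res X f).obj x.pt⟩ : Tot X) g ≫ cart x f =
      vert (eqToHom (res_comp_obj X g f x.pt).symm) ≫ cart x (g ≫ f) := by
  rw [← mkHom_eq (a := ⟨W, _⟩)]
  refine hom_ext (g ≫ f) (by simp) (mkHom_bs _ _) ?_
  rw [comp_vat (cart (⟨V, (res X f).obj x.pt⟩ : Tot X) g) (cart x f) _ (by simp)
    (cart_bs (⟨V, (res X f).obj x.pt⟩ : Tot X) g) (cart_bs x f)]
  simp

lemma cart_id (x : Tot X) : cart x (𝟙 _) = vert (eqToHom (res_id_obj X x.pt)) :=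
  hom_ext (𝟙 _) (cart_bs _ _) (vert_bs _) (by simp)

/-- The total category is fibered in groupoids over `C`. -/
lemma exists_lift {a b c : Tot X} (φ : a ⟶ c) (ψ : b ⟶ c) (g : a.base ⟶ b.base)
    (h : g ≫ bs ψ = bs φ) : ∃ χ : a ⟶ b, bs χ = g ∧ χ ≫ ψ = φ := by
  refine ⟨mkHom g (vat φ _ h.symm ≫ eqToHom (res_comp_obj X g (bs ψ) c.pt) ≫
    (res X g).map (inv (vat ψ _ rfl))), rfl,
    hom_ext (g ≫ bs ψ) (by rw [comp_bs, mkHom_bs]) h.symm ?_⟩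
  rw [comp_vat _ ψ _ (by rw [comp_bs, mkHom_bs]) (mkHom_bs _ _) (rfl : bs ψ = _), mkHom_vat_self]
  simp

/-- The lift of an arrow. -/
noncomputable def lift {a b c : Tot X} (φ : a ⟶ c) (ψ : b ⟶ c) (g : a.base ⟶ b.base)
    (h : g ≫ bs ψ = bs φ) : a ⟶ b := (exists_lift φ ψ g h).choose

@[simp] lemma lift_bs {a b c : Tot X} (φ : a ⟶ c) (ψ : b ⟶ c) (g : a.base ⟶ b.base)
    (h : g ≫ bs ψ = bs φ) : bs (lift φ ψ g h) = g := (exists_lift φ ψ g h).choose_spec.1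

lemma lift_comp {a b c : Tot X} (φ : a ⟶ c) (ψ : b ⟶ c)
    (g : a.base ⟶ b.base) (h : g ≫ bs ψ = bs φ) : lift φ ψ g h ≫ ψ = φ :=
  (exists_lift φ ψ g h).choose_spec.2

/-- The vertical part of `ψ` is invertible because the fibres are groupoids, so every arrow is
cartesian and a lift is determined by its base. Most later identities between arrows are proved by
composing with a suitable arrow and cancelling it. -/
lemma cancel {a b c : Tot X} {φ φ' : a ⟶ b} (ψ : b ⟶ c) (hb : bs φ = bs φ')
    (h : φ ≫ ψ = φ' ≫ ψ) : φ = φ' := by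
  refine hom_ext (bs φ') hb rfl ?_
  have h2 := vat_congr h (f := bs φ' ≫ bs ψ) (by simp [hb]) (g := bs φ' ≫ bs ψ) (comp_bs _ _)
  rw [comp_vat φ ψ _ _ hb (rfl : bs ψ = _), comp_vat φ' ψ _ _ (rfl : bs φ' = _) (rfl : bs ψ = _)] at h2
  simpa [← Category.assoc, cancel_mono] using h2

lemma isIso_of_isIso_bs {a b : Tot X} (φ : a ⟶ b) [IsIso (bs φ)] : IsIso φ := by
  obtain ⟨ψ, h, h'⟩ := exists_lift (𝟙 b) φ (inv (bs φ)) (by simp)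
  exact ⟨ψ, cancel φ (by simp [h]) (by simp [h']), h'⟩

end Tot

/-! ### Properties that hold on a covering sieve. -/

/-- `P` holds for all arrows to `U` in a covering sieve. -/
def Loc {C : Type u} [SmallCategory C] (J : GrothendieckTopology C) (U : C)
    (P : ∀ ⦃V : C⦄, (V ⟶ U) → Prop) : Prop :=
  ∃ S ∈ J U, ∀ ⦃V : C⦄ (f : V ⟶ U), S f → P f

namespace Loc

variable {C : Type u} [SmallCategory C] {J : GrothendieckTopology C} {U : C}
  {P Q : ∀ ⦃V : C⦄, (V ⟶ U) → Prop}

lemma of_forall (h : ∀ ⦃V : C⦄ (f : V ⟶ U), P f) : Loc J U P :=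
  ⟨⊤, J.top_mem U, fun _ f _ ↦ h f⟩

lemma mono (hP : Loc J U P) (h : ∀ ⦃V : C⦄ (f : V ⟶ U), P f → Q f) : Loc J U Q := by
  obtain ⟨S, hS, hP⟩ := hP
  exact ⟨S, hS, fun V f hf ↦ h f (hP f hf)⟩

lemma and (hP : Loc J U P) (hQ : Loc J U Q) : Loc J U (fun _ f ↦ P f ∧ Q f) := by
  obtain ⟨S, hS, hP⟩ := hP
  obtain ⟨T, hT, hQ⟩ := hQ
  exact ⟨S ⊓ T, J.intersection_covering hS hT, fun V f hf ↦ ⟨hP f hf.1, hQ f hf.2⟩⟩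

lemma pullback (hP : Loc J U P) {V : C} (g : V ⟶ U) : Loc J V (fun _ f ↦ P (f ≫ g)) := by
  obtain ⟨S, hS, hP⟩ := hP
  exact ⟨S.pullback g, J.pullback_stable g hS, fun W f hf ↦ hP _ hf⟩

lemma bind (hP : Loc J U P)
    (h : ∀ ⦃V : C⦄ (f : V ⟶ U), P f → Loc J V (fun _ g ↦ Q (g ≫ f))) : Loc J U Q := by
  obtain ⟨S, hS, hP⟩ := hP
  choose T hT hQ using fun (V : C) (f : V ⟶ U) (hf : S f) ↦ h f (hP f hf)
  refine ⟨Sieve.bind S T, J.bind_covering hS hT, ?_⟩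
  rintro V _ ⟨W, g, f, hf, hg, rfl⟩
  exact hQ _ f hf g hg

lemma of_sieve {S : Sieve U} (hS : S ∈ J U) (h : ∀ ⦃V : C⦄ (f : V ⟶ U), S f → P f) :
    Loc J U P := ⟨S, hS, h⟩

lemma mem {S : Sieve U} (h : Loc J U (fun _ f ↦ S f)) : S ∈ J U := by
  obtain ⟨T, hT, h⟩ := h
  exact J.superset_covering h hT

end Loc

/-! ### Functors over the site and their transformations. -/

/-- A functor over `C` between the total categories of presheaves of groupoids. -/
structure FunOver {C : Type u} [SmallCategory C] (X Z : Cᵒᵖ ⥤ Grpd.{u, u}) : Type u where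
  obj {U : C} : Sec X U → Sec Z U
  map {a b : Tot X} : (a ⟶ b) → ((⟨a.base, obj a.pt⟩ : Tot Z) ⟶ ⟨b.base, obj b.pt⟩)
  map_bs {a b : Tot X} (φ : a ⟶ b) : Tot.bs (map φ) = Tot.bs φ
  map_id (a : Tot X) : map (𝟙 a) = 𝟙 _
  map_comp {a b c : Tot X} (φ : a ⟶ b) (ψ : b ⟶ c) : map (φ ≫ ψ) = map φ ≫ map ψ

namespace FunOver

variable {C : Type u} [SmallCategory C] {X Y Z W : Cᵒᵖ ⥤ Grpd.{u, u}}

attribute [simp] map_bs map_id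

/-- The image of an object. -/
abbrev o (F : FunOver X Z) (a : Tot X) : Tot Z := ⟨a.base, F.obj a.pt⟩

lemma map_comp_assoc (F : FunOver X Z) {a b c : Tot X} (φ : a ⟶ b) (ψ : b ⟶ c) {z : Tot Z}
    (h : F.o c ⟶ z) : F.map (φ ≫ ψ) ≫ h = F.map φ ≫ F.map ψ ≫ h := by
  rw [F.map_comp, Category.assoc]

/-- The identity functor. -/
@[simps] protected def id (X : Cᵒᵖ ⥤ Grpd.{u, u}) : FunOver X X where
  obj x := x
  map φ := φ
  map_bs _ := rfl
  map_id _ := rfl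
  map_comp _ _ := rfl

/-- Composition of functors over `C`. -/
@[simps] protected def comp (F : FunOver X Y) (G : FunOver Y Z) : FunOver X Z where
  obj x := G.obj (F.obj x)
  map φ := G.map (F.map φ)
  map_bs _ := (G.map_bs _).trans (F.map_bs _)
  map_id a := (congrArg G.map (F.map_id a)).trans (G.map_id (F.o a))
  map_comp φ ψ := (congrArg G.map (F.map_comp φ ψ)).trans (G.map_comp _ _)

/-- A natural transformation over `C`. -/
@[ext]
structure Hom (F G : FunOver X Z) : Type u where
  app {U : C} (x : Sec X U) : F.obj x ⟶ G.obj x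
  naturality {a b : Tot X} (φ : a ⟶ b) :
    F.map φ ≫ Tot.vert (app b.pt) = Tot.vert (app a.pt) ≫ G.map φ

instance : Category (FunOver X Z) where
  Hom := Hom
  id F := ⟨fun _ ↦ 𝟙 _, fun _ ↦ by simp⟩
  comp {F G H} α β := ⟨fun x ↦ α.app x ≫ β.app x, fun φ ↦ by
    rw [Tot.vert_comp, Tot.vert_comp, reassoc_of% α.naturality φ, β.naturality, Category.assoc]⟩
  id_comp α := by ext; exact Category.id_comp _
  comp_id α := by ext; exact Category.comp_id _
  assoc α β γ := by ext; exact Category.assoc _ _ _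

/-- The components of a natural transformation over `C`, as arrows of the total category. -/
def tapp {F G : FunOver X Z} (α : F ⟶ G) (a : Tot X) : F.o a ⟶ G.o a :=
  Tot.vert (Hom.app α a.pt)

@[simp] lemma tapp_bs {F G : FunOver X Z} (α : F ⟶ G) (a : Tot X) : Tot.bs (tapp α a) = 𝟙 _ := rfl

lemma tapp_naturality {F G : FunOver X Z} (α : F ⟶ G) {a b : Tot X} (φ : a ⟶ b) :
    F.map φ ≫ tapp α b = tapp α a ≫ G.map φ := Hom.naturality α φ

lemma hom_ext {F G : FunOver X Z} {α β : F ⟶ G} (h : ∀ a, tapp α a = tapp β a) : α = β :=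
  Hom.ext (by funext U x; exact Tot.vert_injective (h ⟨U, x⟩))

/-- A natural transformation over `C` is determined by arrows of the total category. -/
lemma exists_hom {F G : FunOver X Z} (t : ∀ a, F.o a ⟶ G.o a) (ht : ∀ a, Tot.bs (t a) = 𝟙 _)
    (nat : ∀ {a b : Tot X} (φ : a ⟶ b), F.map φ ≫ t b = t a ≫ G.map φ) :
    ∃ α : F ⟶ G, ∀ a, tapp α a = t a := by
  choose m hm using fun (a : Tot X) ↦ Tot.exists_vert (t a) (ht a)
  exact ⟨⟨fun {U} x ↦ m ⟨U, x⟩, fun φ ↦ by simp only [hm]; exact nat φ⟩, hm⟩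

instance {F G : FunOver X Z} (α : F ⟶ G) (a : Tot X) : IsIso (tapp α a) :=
  have : IsIso (Tot.bs (tapp α a)) := by rw [tapp_bs]; infer_instance
  Tot.isIso_of_isIso_bs _

instance {F G : FunOver X Z} (α : F ⟶ G) : IsIso α := by
  refine ⟨⟨⟨fun {U} x ↦ inv (Hom.app α x), fun {a b} φ ↦ ?_⟩, Hom.ext ?_, Hom.ext ?_⟩⟩
  · rw [← cancel_mono (tapp α b), ← cancel_epi (tapp α a), Category.assoc, Category.assoc,
      tapp_naturality]
    simp only [tapp]
    rw [← Tot.vert_comp, ← Tot.vert_comp_assoc]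
    simp
  · funext U x; exact IsIso.hom_inv_id _
  · funext U x; exact IsIso.inv_hom_id _

/-- Precomposition. -/
@[simps]
def precomp (η : FunOver X Y) (Z : Cᵒᵖ ⥤ Grpd.{u, u}) : FunOver Y Z ⥤ FunOver X Z where
  obj G := η.comp G
  map α := ⟨fun x ↦ Hom.app α (η.obj x), fun φ ↦ Hom.naturality α (η.map φ)⟩
  map_id _ := rfl
  map_comp _ _ := rfl

lemma precomp_tapp (η : FunOver X Y) {G G' : FunOver Y Z} (α : G ⟶ G') (a : Tot X) :
    tapp ((precomp η Z).map α) a = tapp α (η.o a) := rfl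

/-- The image of the cartesian arrow over the base of `s` is again cartesian, so `s` factors through
it by a vertical arrow. This turns compatibility over arbitrary objects of `Z` into a question about
arrows of `X`. -/
lemma exists_factor (F : FunOver X Z) {w : Tot Z} {x : Tot X} (s : w ⟶ F.o x) :
    ∃ (x₁ : Sec X w.base) (c : (⟨w.base, x₁⟩ : Tot X) ⟶ x) (s₀ : w ⟶ F.o ⟨w.base, x₁⟩),
      Tot.bs s₀ = 𝟙 _ ∧ Tot.bs c = Tot.bs (b := F.o x) s ∧ s₀ ≫ F.map c = s := by
  obtain ⟨s₀, h, h'⟩ := Tot.exists_lift s (F.map (Tot.cart x (Tot.bs (b := F.o x) s))) (𝟙 _)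
    (by rw [map_bs]; exact Category.id_comp _)
  exact ⟨_, Tot.cart x (Tot.bs (b := F.o x) s), s₀, h, rfl, h'⟩

end FunOver

/-! ### The stack condition in the total category. -/

/-- The stack condition, formulated in the total category: arrows glue, and descent data are
effective. -/
structure TotStack {C : Type u} [SmallCategory C] (J : GrothendieckTopology C)
    (Z : Cᵒᵖ ⥤ Grpd.{u, u}) : Prop where
  sep (z z' : Tot Z) (h h' : z ⟶ z') (hb : Tot.bs h = Tot.bs h')
    (loc : Loc J z.base (fun _ f ↦ Tot.cart z f ≫ h = Tot.cart z f ≫ h')) : h = h'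
  glue (z z' : Tot Z) (g : z.base ⟶ z'.base) (S : Sieve z.base) (hS : S ∈ J z.base)
    (β : ∀ (v : Tot Z) (r : v ⟶ z), S (Tot.bs r) → (v ⟶ z'))
    (hβ : ∀ v r hr, Tot.bs (β v r hr) = Tot.bs r ≫ g)
    (compat : ∀ (w v : Tot Z) (s : w ⟶ v) (r : v ⟶ z) (hr : S (Tot.bs r))
      (hsr : S (Tot.bs (s ≫ r))), β w (s ≫ r) hsr = s ≫ β v r hr) :
    ∃ h : z ⟶ z', Tot.bs h = g ∧ ∀ v r hr, r ≫ h = β v r hr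
  desc (U : C) (S : Sieve U) (hS : S ∈ J U) (z : ∀ ⦃V : C⦄ (f : V ⟶ U), S f → Sec Z V)
    (t : ∀ ⦃W V : C⦄ (f' : W ⟶ U) (hf' : S f') (f : V ⟶ U) (hf : S f) (h : W ⟶ V),
      h ≫ f = f' → ((⟨W, z f' hf'⟩ : Tot Z) ⟶ ⟨V, z f hf⟩))
    (ht : ∀ ⦃W V : C⦄ (f' : W ⟶ U) (hf' : S f') (f : V ⟶ U) (hf : S f) (h : W ⟶ V)
      (e : h ≫ f = f'), Tot.bs (t f' hf' f hf h e) = h)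
    (comp : ∀ ⦃W' W V : C⦄ (f'' : W' ⟶ U) (hf'' : S f'') (f' : W ⟶ U) (hf' : S f') (f : V ⟶ U)
      (hf : S f) (h' : W' ⟶ W) (h : W ⟶ V) (e' : h' ≫ f' = f'') (e : h ≫ f = f'),
      t f'' hf'' f' hf' h' e' ≫ t f' hf' f hf h e =
        t f'' hf'' f hf (h' ≫ h) (by rw [Category.assoc, e, e'])) :
    ∃ (z₀ : Sec Z U) (κ : ∀ ⦃V : C⦄ (f : V ⟶ U) (hf : S f), (⟨V, z f hf⟩ : Tot Z) ⟶ ⟨U, z₀⟩),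
      (∀ ⦃V : C⦄ (f : V ⟶ U) (hf : S f), Tot.bs (κ f hf) = f) ∧
      ∀ ⦃W V : C⦄ (f' : W ⟶ U) (hf' : S f') (f : V ⟶ U) (hf : S f) (h : W ⟶ V) (e : h ≫ f = f'),
        t f' hf' f hf h e ≫ κ f hf = κ f' hf'

namespace TotStack

variable {C : Type u} [SmallCategory C] {J : GrothendieckTopology C} {Z : Cᵒᵖ ⥤ Grpd.{u, u}}

lemma sep_family (hZ : TotStack J Z) {ι : Sort*} {z z' : Tot Z} {h h' : z ⟶ z'}
    (hb : Tot.bs h = Tot.bs h') (v : ι → Tot Z) (r : ∀ i, v i ⟶ z)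
    (cov : Loc J z.base (fun V f ↦ ∃ i, ∃ e : V ⟶ (v i).base, e ≫ Tot.bs (r i) = f))
    (hr : ∀ i, r i ≫ h = r i ≫ h') : h = h' := by
  refine hZ.sep z z' h h' hb (cov.mono ?_)
  rintro V f ⟨i, e, he⟩
  obtain ⟨s, -, hs⟩ := Tot.exists_lift (Tot.cart z f) (r i) e he
  rw [← hs, Category.assoc, Category.assoc, hr]

/-- Every arrow over the sieve generated by the family factors through some `r i`. A factorization
is chosen for each of them, and `compat` makes the composite with `k i` independent of the choice.
-/
lemma glue_family (hZ : TotStack J Z) {ι : Sort*} {z z' : Tot Z} (g : z.base ⟶ z'.base)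
    (v : ι → Tot Z) (r : ∀ i, v i ⟶ z) (k : ∀ i, v i ⟶ z')
    (hk : ∀ i, Tot.bs (k i) = Tot.bs (r i) ≫ g)
    (cov : Loc J z.base (fun V f ↦ ∃ i, ∃ e : V ⟶ (v i).base, e ≫ Tot.bs (r i) = f))
    (compat : ∀ i i' (w : Tot Z) (s : w ⟶ v i) (s' : w ⟶ v i'),
      s ≫ r i = s' ≫ r i' → s ≫ k i = s' ≫ k i') :
    ∃ h : z ⟶ z', Tot.bs h = g ∧ ∀ i, r i ≫ h = k i := by
  let S : Sieve z.base :=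
    { arrows := fun V f ↦ ∃ i, ∃ e : V ⟶ (v i).base, e ≫ Tot.bs (r i) = f
      downward_closed := by
        rintro V W f ⟨i, e, rfl⟩ g
        exact ⟨i, g ≫ e, Category.assoc _ _ _⟩ }
  have key : ∀ (w : Tot Z) (q : w ⟶ z) (_ : S (Tot.bs q)),
      ∃ i, ∃ s : w ⟶ v i, s ≫ r i = q := by
    rintro w q ⟨i, e, he⟩
    obtain ⟨s, -, hs⟩ := Tot.exists_lift q (r i) e he
    exact ⟨i, s, hs⟩
  choose i s hs using key
  obtain ⟨h, hb, hh⟩ := hZ.glue z z' g S cov.mem (fun w q hq ↦ s w q hq ≫ k (i w q hq))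
    (fun w q hq ↦ by rw [Tot.comp_bs, hk, ← Category.assoc, ← Tot.comp_bs, hs])
    (fun w w' p q hq hq' ↦ by
      rw [← Category.assoc]
      exact compat _ _ _ _ _ (by rw [hs, Category.assoc, hs]))
  refine ⟨h, hb, fun j ↦ ?_⟩
  have hj : S (Tot.bs (r j)) := ⟨j, 𝟙 _, Category.id_comp _⟩
  rw [hh _ (r j) hj, ← Category.id_comp (k j)]
  exact compat _ _ _ _ _ (by rw [hs, Category.id_comp])

end TotStack

/-! ### Extension of functors along a local equivalence. -/

/-- A functor over `C` is a local equivalence if it is locally essentially surjective, locally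
full and locally faithful. -/
structure FunOver.IsLocEquiv {C : Type u} [SmallCategory C] (J : GrothendieckTopology C)
    {X Y : Cᵒᵖ ⥤ Grpd.{u, u}} (η : FunOver X Y) : Prop where
  essSurj (y : Tot Y) : Loc J y.base (fun V f ↦ ∃ (x : Sec X V) (i : η.o ⟨V, x⟩ ⟶ y), Tot.bs i = f)
  full {x x' : Tot X} (m : η.o x ⟶ η.o x') : Loc J x.base (fun V f ↦ ∃ (x₁ : Sec X V)
    (r : (⟨V, x₁⟩ : Tot X) ⟶ x) (n : (⟨V, x₁⟩ : Tot X) ⟶ x'), Tot.bs r = f ∧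
      η.map n = η.map r ≫ m)
  faithful {x x' : Tot X} (n n' : x ⟶ x') (h : η.map n = η.map n') :
    Loc J x.base (fun _ f ↦ Tot.cart x f ≫ n = Tot.cart x f ≫ n')

namespace FunOver

variable {C : Type u} [SmallCategory C] {J : GrothendieckTopology C} {X Y Z : Cᵒᵖ ⥤ Grpd.{u, u}}

/-- A functor over `C` to `Z` on the full image of `η`. -/
structure Ext (η : FunOver X Y) (Z : Cᵒᵖ ⥤ Grpd.{u, u}) : Type u where
  obj {U : C} : Sec X U → Sec Z U
  map {a b : Tot X} : (η.o a ⟶ η.o b) → ((⟨a.base, obj a.pt⟩ : Tot Z) ⟶ ⟨b.base, obj b.pt⟩)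
  map_bs {a b : Tot X} (φ : η.o a ⟶ η.o b) : Tot.bs (map φ) = Tot.bs φ
  map_comp {a b c : Tot X} (φ : η.o a ⟶ η.o b) (ψ : η.o b ⟶ η.o c) :
    map (φ ≫ ψ) = map φ ≫ map ψ

namespace Ext

attribute [simp] map_bs

/-- The image of an object. -/
abbrev o {η : FunOver X Y} (E : Ext η Z) (a : Tot X) : Tot Z := ⟨a.base, E.obj a.pt⟩

lemma map_comp_assoc {η : FunOver X Y} (E : Ext η Z) {a b c : Tot X} (φ : η.o a ⟶ η.o b)
    (ψ : η.o b ⟶ η.o c) {z : Tot Z} (h : E.o c ⟶ z) :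
    E.map (φ ≫ ψ) ≫ h = E.map φ ≫ E.map ψ ≫ h := by
  rw [E.map_comp, Category.assoc]

/-- The restriction to the full image. -/
@[simps] def ofFun (η : FunOver X Y) (G : FunOver Y Z) : Ext η Z where
  obj x := G.obj (η.obj x)
  map φ := G.map φ
  map_bs _ := G.map_bs _
  map_comp _ _ := G.map_comp _ _

/-- A cocone under `E` on the objects over `y`, with vertex `z`, lying over `g`. -/
structure Cocone {η : FunOver X Y} (E : Ext η Z) (y : Tot Y) (z : Tot Z)
    (g : y.base ⟶ z.base) : Type u where
  ι {x : Tot X} (i : η.o x ⟶ y) : E.o x ⟶ z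
  ι_bs {x : Tot X} (i : η.o x ⟶ y) : Tot.bs (ι i) = Tot.bs i ≫ g
  w {x x' : Tot X} (j : η.o x' ⟶ η.o x) (i : η.o x ⟶ y) : ι (j ≫ i) = E.map j ≫ ι i

variable {η : FunOver X Y}

lemma Cocone.ι_bs' {E : Ext η Z} {y : Tot Y} {z : Sec Z y.base}
    (α : E.Cocone y ⟨y.base, z⟩ (𝟙 _)) {x : Tot X} (i : η.o x ⟶ y) :
    Tot.bs (α.ι i) = Tot.bs i := (α.ι_bs i).trans (Category.comp_id _)

lemma cov (hη : η.IsLocEquiv J) {E : Ext η Z} {y : Tot Y} {z : Sec Z y.base}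
    (α : E.Cocone y ⟨y.base, z⟩ (𝟙 _)) :
    Loc J y.base (fun V f ↦ ∃ q : Σ x : Tot X, η.o x ⟶ y, ∃ e : V ⟶ (E.o q.1).base,
      e ≫ Tot.bs (α.ι q.2) = f) := by
  refine (hη.essSurj y).mono ?_
  rintro V f ⟨x, i, rfl⟩
  exact ⟨⟨_, i⟩, 𝟙 _, by rw [α.ι_bs', Category.id_comp]⟩

lemma exists_factor (E : Ext η Z) {w : Tot Z} {x : Tot X} (s : w ⟶ E.o x) :
    ∃ (x₁ : Sec X w.base) (c : η.o ⟨w.base, x₁⟩ ⟶ η.o x) (s₀ : w ⟶ E.o ⟨w.base, x₁⟩),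
      Tot.bs s₀ = 𝟙 _ ∧ Tot.bs c = Tot.bs (b := E.o x) s ∧ s₀ ≫ E.map c = s := by
  have hc : Tot.bs (η.map (Tot.cart x (Tot.bs (b := E.o x) s))) = Tot.bs (b := E.o x) s :=
    η.map_bs _
  obtain ⟨s₀, h, h'⟩ := Tot.exists_lift s (E.map (η.map (Tot.cart x (Tot.bs (b := E.o x) s))))
    (𝟙 _) (by rw [map_bs, hc]; exact Category.id_comp _)
  exact ⟨_, _, s₀, h, hc, h'⟩

/-- A cocone is determined by its vertex. -/
lemma Cocone.hom_ext (hη : η.IsLocEquiv J) (hZ : TotStack J Z) {E : Ext η Z} {y : Tot Y}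
    {z : Sec Z y.base} (α : E.Cocone y ⟨y.base, z⟩ (𝟙 _)) {z' : Tot Z}
    {h h' : (⟨y.base, z⟩ : Tot Z) ⟶ z'} (hb : Tot.bs h = Tot.bs h')
    (H : ∀ {x : Tot X} (i : η.o x ⟶ y), α.ι i ≫ h = α.ι i ≫ h') : h = h' :=
  hZ.sep_family hb _ (fun q : Σ x : Tot X, η.o x ⟶ y ↦ α.ι q.2) (cov hη α) (fun q ↦ H q.2)

/-- Every cocone is universal. -/
lemma Cocone.exists_desc (hη : η.IsLocEquiv J) (hZ : TotStack J Z) {E : Ext η Z} {y : Tot Y}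
    {z : Sec Z y.base} (α : E.Cocone y ⟨y.base, z⟩ (𝟙 _)) {z' : Tot Z} {g : y.base ⟶ z'.base}
    (β : E.Cocone y z' g) :
    ∃ h : (⟨y.base, z⟩ : Tot Z) ⟶ z', Tot.bs h = g ∧
      ∀ {x : Tot X} (i : η.o x ⟶ y), α.ι i ≫ h = β.ι i := by
  refine Exists.elim (hZ.glue_family (z := ⟨y.base, z⟩) g _
    (fun q : Σ x : Tot X, η.o x ⟶ y ↦ α.ι q.2) (fun q ↦ β.ι q.2)
    (fun q ↦ by rw [β.ι_bs, α.ι_bs']) (cov hη α) ?_)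
    fun h hh ↦ ⟨h, hh.1, fun i ↦ hh.2 ⟨_, i⟩⟩
  rintro ⟨x, i⟩ ⟨x', i'⟩ w s s' hs
  dsimp only at s s' hs ⊢
  obtain ⟨x₁, c, a, ha, hc, has⟩ := E.exists_factor s
  have hb := congrArg Tot.bs hs
  rw [Tot.comp_bs, Tot.comp_bs, α.ι_bs', α.ι_bs'] at hb
  -- In `Y`, `c ≫ i` factors through `i'` by an arrow `j` of the full image, and `a ≫ E.map j = s'`.
  -- Both sides of the goal then become `a ≫ β.ι (c ≫ i)`.
  obtain ⟨j, hj, hji⟩ := Tot.exists_lift (c ≫ i) i' (Tot.bs (b := E.o x') s')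
    (by rw [Tot.comp_bs, hc]; exact hb.symm)
  have e : a ≫ E.map j = s' := by
    refine Tot.cancel (α.ι i') (by rw [Tot.comp_bs, ha, E.map_bs, hj]; exact Category.id_comp _) ?_
    rw [Category.assoc, ← α.w, hji, α.w, reassoc_of% has, hs]
  rw [← has, ← e, Category.assoc, Category.assoc, ← β.w, ← β.w, hji]

end Ext

open Ext

section

variable {η : FunOver X Y} (hη : η.IsLocEquiv J) (hZ : TotStack J Z)

include hη hZ

/-- Local faithfulness makes `n` and `n'` agree on a covering sieve, hence also their images under
`F`; arrows in a stack are determined locally. -/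
lemma map_eq_of_map_eq (F : FunOver X Z) {x x' : Tot X} {n n' : x ⟶ x'}
    (h : η.map n = η.map n') : F.map n = F.map n' := by
  have hb : Tot.bs n = Tot.bs n' := by rw [← η.map_bs, h, η.map_bs]
  obtain ⟨S, hS, H⟩ := hη.faithful n n' h
  refine hZ.sep_family (ι := Σ V : C, {f : V ⟶ x.base // S f}) (by simpa using hb) _
    (fun q ↦ F.map (Tot.cart x q.2.1)) ⟨S, hS, fun V f hf ↦ ⟨⟨V, f, hf⟩, 𝟙 _, by simp⟩⟩ ?_
  rintro ⟨V, f, hf⟩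
  simp only
  rw [← F.map_comp, ← F.map_comp, H f hf]

omit hZ in
lemma full_cov (F : FunOver X Z) {x x' : Tot X} (m : η.o x ⟶ η.o x') :
    Loc J x.base (fun V f ↦ ∃ q : {q : Σ x₁ : Tot X, (x₁ ⟶ x) × (x₁ ⟶ x') //
      η.map q.2.2 = η.map q.2.1 ≫ m}, ∃ e : V ⟶ (F.o q.1.1).base,
        e ≫ Tot.bs (F.map q.1.2.1) = f) := by
  refine (hη.full m).mono ?_
  rintro V f ⟨x₁, r, n, rfl, h⟩
  exact ⟨⟨⟨_, r, n⟩, h⟩, 𝟙 _, by simp⟩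

/-- This is the value of `F` on an arrow `m` of the full image of `η`. The spans `(r, n)` with
`η.map n = η.map r ≫ m` cover `x` by local fullness, and the composite of `F.map r` with the value
has to be `F.map n`. The prescriptions agree because `F` identifies whatever `η` identifies. -/
lemma exists_ext_map (F : FunOver X Z) {x x' : Tot X} (m : η.o x ⟶ η.o x') :
    ∃ k : F.o x ⟶ F.o x', Tot.bs k = Tot.bs m ∧ ∀ {x₁ : Tot X} (r : x₁ ⟶ x) (n : x₁ ⟶ x'),
      η.map n = η.map r ≫ m → F.map r ≫ k = F.map n := by
  refine Exists.elim (hZ.glue_family (z := F.o x) (z' := F.o x') (Tot.bs (a := η.o x) (b := η.o x') m) _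
    (fun q : {q : Σ x₁ : Tot X, (x₁ ⟶ x) × (x₁ ⟶ x') // η.map q.2.2 = η.map q.2.1 ≫ m} ↦
      F.map q.1.2.1) (fun q ↦ F.map q.1.2.2)
    (fun q ↦ by
      have := congrArg Tot.bs q.2
      simpa using this) (full_cov hη F m) ?_)
    fun h hh ↦ ⟨h, hh.1, fun r n e ↦ hh.2 ⟨⟨_, r, n⟩, e⟩⟩
  rintro ⟨⟨x₁, r, n⟩, e⟩ ⟨⟨x₂, r', n'⟩, e'⟩ w s s' hs
  dsimp only at s s' hs e e' ⊢
  obtain ⟨y₁, c, s₀, hs₀, hc, hs₁⟩ := F.exists_factor s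
  obtain ⟨y₂, c', s₀', hs₀', hc', hs₁'⟩ := F.exists_factor s'
  have hb := congrArg Tot.bs hs
  rw [Tot.comp_bs, Tot.comp_bs, map_bs, map_bs, ← hc, ← hc'] at hb
  obtain ⟨l, hl, hl'⟩ := Tot.exists_lift (c ≫ r) (c' ≫ r') (𝟙 _)
    (by rw [Tot.comp_bs, Tot.comp_bs, ← hb]; exact Category.id_comp _)
  have e1 : s₀ ≫ F.map l = s₀' := by
    refine Tot.cancel (F.map (c' ≫ r')) (by
      rw [Tot.comp_bs, hs₀, hs₀', map_bs, hl]; exact Category.id_comp _) ?_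
    rw [Category.assoc, ← F.map_comp, hl', F.map_comp, F.map_comp, reassoc_of% hs₁,
      reassoc_of% hs₁', hs]
  have e2 : F.map (c ≫ n) = F.map (l ≫ c' ≫ n') := by
    refine map_eq_of_map_eq hη hZ F ?_
    rw [η.map_comp, e, η.map_comp, η.map_comp, e', ← η.map_comp_assoc, ← η.map_comp_assoc,
      ← η.map_comp_assoc, ← hl', Category.assoc]
  rw [← hs₁, ← hs₁', ← e1, Category.assoc, Category.assoc, Category.assoc, ← F.map_comp, e2,
    F.map_comp, F.map_comp]

lemma exists_ext (F : FunOver X Z) : ∃ E : Ext η Z, (∀ {U : C} (x : Sec X U), E.obj x = F.obj x) ∧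
    ∃ e : ∀ a : Tot X, F.o a ⟶ E.o a, (∀ a, Tot.bs (e a) = 𝟙 _) ∧
      ∀ {a b : Tot X} (n : a ⟶ b), F.map n ≫ e b = e a ≫ E.map (η.map n) := by
  choose k hk hk' using fun (q : Σ (x x' : Tot X), (η.o x ⟶ η.o x')) ↦
    exists_ext_map hη hZ F q.2.2
  refine ⟨⟨F.obj, fun {a b} φ ↦ k ⟨a, b, φ⟩, fun φ ↦ hk _, ?_⟩, fun _ ↦ rfl, fun a ↦ 𝟙 _,
    fun _ ↦ rfl, ?_⟩
  -- Functoriality is checked on a covering by arrows `F.map r` on which `φ` comes from an arrow `n`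
  -- of `X`, and then on a second covering on which `η.map n ≫ ψ` does.
  · intro a b c φ ψ
    refine hZ.sep_family (z := F.o a) (by simp only [hk, Tot.comp_bs])
      _ (fun q : {q : Σ x₁ : Tot X, (x₁ ⟶ a) × (x₁ ⟶ b) //
        η.map q.2.2 = η.map q.2.1 ≫ φ} ↦ F.map q.1.2.1) (full_cov hη F φ) ?_
    rintro ⟨⟨x₁, r, n⟩, e⟩
    dsimp only at e ⊢
    rw [reassoc_of% (hk' ⟨a, b, φ⟩ r n e)]
    refine hZ.sep_family (z := F.o x₁) (by
        have := congrArg Tot.bs e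
        simp only [hk, Tot.comp_bs, map_bs] at this ⊢
        rw [reassoc_of% this])
      _ (fun q : {q : Σ x₂ : Tot X, (x₂ ⟶ x₁) × (x₂ ⟶ c) //
        η.map q.2.2 = η.map q.2.1 ≫ η.map n ≫ ψ} ↦ F.map q.1.2.1)
      (full_cov hη F (η.map n ≫ ψ)) ?_
    rintro ⟨⟨x₂, r', n'⟩, e'⟩
    dsimp only at e' ⊢
    rw [← F.map_comp_assoc, ← F.map_comp_assoc, hk' ⟨_, _, ψ⟩ (r' ≫ n) n' (by
        rw [e', η.map_comp, Category.assoc]),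
      hk' ⟨_, _, φ ≫ ψ⟩ (r' ≫ r) n' (by
        rw [e', η.map_comp, e, Category.assoc, Category.assoc])]
  · intro a b n
    dsimp only
    rw [Category.comp_id, Category.id_comp]
    have := hk' ⟨a, b, η.map n⟩ (𝟙 a) n (by rw [η.map_id, Category.id_comp])
    rw [F.map_id, Category.id_comp] at this
    exact this.symm

omit hη hZ in
lemma span_cov (E : Ext η Z) {y : Tot Y} {ι : Type*} {x : ι → Tot X} {i : ∀ a, η.o (x a) ⟶ y}
    (cov : Loc J y.base (fun V f ↦ ∃ a, ∃ e : V ⟶ (x a).base,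
      e ≫ Tot.bs (a := η.o (x a)) (i a) = f)) {x₀ : Tot X} (i₀ : η.o x₀ ⟶ y) :
    Loc J x₀.base (fun V f ↦ ∃ q : {q : Σ (a : ι) (x₁ : Tot X),
      (η.o x₁ ⟶ η.o (x a)) × (η.o x₁ ⟶ η.o x₀) // q.2.2.1 ≫ i q.1 = q.2.2.2 ≫ i₀},
      ∃ e : V ⟶ (E.o q.1.2.1).base, e ≫ Tot.bs (E.map q.1.2.2.2) = f) := by
  refine (cov.pullback (Tot.bs (a := η.o x₀) i₀)).mono ?_
  rintro V f ⟨a, e, he⟩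
  obtain ⟨l, hl, hl'⟩ := Tot.exists_lift (η.map (Tot.cart (x a) e) ≫ i a) i₀ f (by
    rw [Tot.comp_bs, η.map_bs]; exact he.symm)
  refine ⟨⟨⟨a, _, _, l⟩, hl'.symm⟩, 𝟙 _, ?_⟩
  rw [E.map_bs, hl]
  exact Category.id_comp _

-- The leg at `i₀` is glued from the prescribed legs, along the spans over `y` that connect `x₀` to
-- members of the family. These spans cover `x₀` by `span_cov`.
omit hη in
lemma exists_cocone_leg (E : Ext η Z) {y : Tot Y} {z : Tot Z} (g : y.base ⟶ z.base)
    {ι : Type*} {x : ι → Tot X} {i : ∀ a, η.o (x a) ⟶ y}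
    (cov : Loc J y.base (fun V f ↦ ∃ a, ∃ e : V ⟶ (x a).base,
      e ≫ Tot.bs (a := η.o (x a)) (i a) = f))
    (κ : ∀ a, E.o (x a) ⟶ z) (hκ : ∀ a, Tot.bs (κ a) = Tot.bs (i a) ≫ g)
    (w : ∀ (a b : ι) (x₁ : Tot X) (c : η.o x₁ ⟶ η.o (x a)) (c' : η.o x₁ ⟶ η.o (x b)),
      c ≫ i a = c' ≫ i b → E.map c ≫ κ a = E.map c' ≫ κ b) {x₀ : Tot X} (i₀ : η.o x₀ ⟶ y) :
    ∃ k : E.o x₀ ⟶ z, Tot.bs k = Tot.bs i₀ ≫ g ∧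
      ∀ (a : ι) (x₁ : Tot X) (c : η.o x₁ ⟶ η.o (x a)) (c' : η.o x₁ ⟶ η.o x₀),
        c ≫ i a = c' ≫ i₀ → E.map c' ≫ k = E.map c ≫ κ a := by
  refine Exists.elim (hZ.glue_family (z := E.o x₀) (z' := z)
    (Tot.bs (a := η.o x₀) (b := y) i₀ ≫ g) _
    (fun q : {q : Σ (a : ι) (x₁ : Tot X), (η.o x₁ ⟶ η.o (x a)) × (η.o x₁ ⟶ η.o x₀) //
      q.2.2.1 ≫ i q.1 = q.2.2.2 ≫ i₀} ↦ E.map q.1.2.2.2) (fun q ↦ E.map q.1.2.2.1 ≫ κ q.1.1)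
    ?_ (span_cov E cov i₀) ?_)
    fun k hk ↦ ⟨k, hk.1, fun a x₁ c c' h ↦ hk.2 ⟨⟨a, x₁, c, c'⟩, h⟩⟩
  · rintro ⟨⟨a, x₁, c, c'⟩, h⟩
    have hb := congrArg Tot.bs h
    dsimp only at hb ⊢
    rw [Tot.comp_bs, Tot.comp_bs] at hb
    rw [Tot.comp_bs, hκ, E.map_bs, E.map_bs]
    exact (reassoc_of% hb) g
  · rintro ⟨⟨a, x₁, c, c'⟩, h⟩ ⟨⟨b, x₂, d, d'⟩, h'⟩ v s s' hs
    dsimp only at h h' s s' hs ⊢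
    obtain ⟨x₃, r, s₀, hs₀, hr, hrs⟩ := E.exists_factor s
    have hb := congrArg Tot.bs hs
    rw [Tot.comp_bs, Tot.comp_bs, E.map_bs, E.map_bs, ← hr] at hb
    obtain ⟨l, hl, hl'⟩ := Tot.exists_lift (r ≫ c') d' (Tot.bs (b := E.o x₂) s') hb.symm
    have hs2 : s₀ ≫ E.map l = s' := by
      refine Tot.cancel (E.map d') (by
        rw [Tot.comp_bs, hs₀, E.map_bs, hl]; exact Category.id_comp _) ?_
      rw [Category.assoc, ← E.map_comp, hl', E.map_comp, reassoc_of% hrs, hs]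
    rw [← hrs, ← hs2, Category.assoc, Category.assoc, ← E.map_comp_assoc, ← E.map_comp_assoc,
      w _ _ _ (r ≫ c) (l ≫ d) (by
        rw [Category.assoc, Category.assoc, h, h', reassoc_of% hl'])]

omit hη in
/-- A cocone may be specified on a covering family. -/
lemma exists_cocone_of_family (E : Ext η Z) {y : Tot Y} {z : Tot Z} (g : y.base ⟶ z.base)
    {ι : Type*} {x : ι → Tot X} {i : ∀ a, η.o (x a) ⟶ y}
    (cov : Loc J y.base (fun V f ↦ ∃ a, ∃ e : V ⟶ (x a).base,
      e ≫ Tot.bs (a := η.o (x a)) (i a) = f))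
    (κ : ∀ a, E.o (x a) ⟶ z) (hκ : ∀ a, Tot.bs (κ a) = Tot.bs (i a) ≫ g)
    (w : ∀ (a b : ι) (x₁ : Tot X) (c : η.o x₁ ⟶ η.o (x a)) (c' : η.o x₁ ⟶ η.o (x b)),
      c ≫ i a = c' ≫ i b → E.map c ≫ κ a = E.map c' ≫ κ b) :
    Nonempty (E.Cocone y z g) := by
  choose k hk hk' using fun {x₀ : Tot X} (i₀ : η.o x₀ ⟶ y) ↦
    exists_cocone_leg hZ E g cov κ hκ w i₀
  refine ⟨fun {x₀} i₀ ↦ k i₀, fun i₀ ↦ hk i₀, fun {x₀ x₁} j i₀ ↦ ?_⟩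
  refine hZ.sep_family (z := E.o x₁) (by
    rw [hk, Tot.comp_bs, Tot.comp_bs, E.map_bs, hk]; exact Category.assoc _ _ _) _
    (fun q : {q : Σ (a : ι) (x₂ : Tot X), (η.o x₂ ⟶ η.o (x a)) × (η.o x₂ ⟶ η.o x₁) //
      q.2.2.1 ≫ i q.1 = q.2.2.2 ≫ j ≫ i₀} ↦ E.map q.1.2.2.2) (span_cov E cov (j ≫ i₀)) ?_
  rintro ⟨⟨a, x₂, c, c'⟩, h⟩
  dsimp only at h ⊢
  rw [hk' _ a x₂ c c' h, ← E.map_comp_assoc, hk' i₀ a x₂ c (c' ≫ j) (by rw [Category.assoc, h])]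

/-- The restrictions of `y` along a covering sieve are isomorphic to images of objects of `X`. The
transition arrows lie in the full image of `η`, so `E` sends them to a descent datum in `Z`, and its
effectivity gives the vertex. -/
lemma exists_cocone (E : Ext η Z) (y : Tot Y) :
    ∃ z : Sec Z y.base, Nonempty (E.Cocone y ⟨y.base, z⟩ (𝟙 _)) := by
  obtain ⟨S, hS, H⟩ := hη.essSurj y
  choose x i hi using H
  obtain ⟨z, κ, hκ, hκ'⟩ := hZ.desc y.base S hS (fun V f hf ↦ E.obj (x f hf))
    (fun W V f' hf' f hf h e ↦ E.map (a := ⟨W, x f' hf'⟩) (b := ⟨V, x f hf⟩)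
      (Tot.lift (i f' hf') (i f hf) h (by rw [hi, hi, e])))
    (fun W V f' hf' f hf h e ↦ by rw [E.map_bs]; exact Tot.lift_bs _ _ _ _)
    (fun W' W V f'' hf'' f' hf' f hf h' h e' e ↦ by
      rw [← E.map_comp]
      congr 1
      refine Tot.cancel (i f hf) (by simp) ?_
      rw [Category.assoc, Tot.lift_comp, Tot.lift_comp, Tot.lift_comp])
  have w : ∀ ⦃W V : C⦄ (f' : W ⟶ y.base) (hf' : S f') (f : V ⟶ y.base) (hf : S f)
      (m : η.o ⟨W, x f' hf'⟩ ⟶ η.o ⟨V, x f hf⟩), m ≫ i f hf = i f' hf' →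
      E.map m ≫ κ f hf = κ f' hf' := by
    intro W V f' hf' f hf m hm
    have hmb := congrArg Tot.bs hm
    rw [Tot.comp_bs, hi, hi] at hmb
    rw [← hκ' f' hf' f hf (Tot.bs m) hmb]
    congr 2
    exact Tot.cancel (i f hf) (by rw [Tot.lift_bs]) (by rw [hm, Tot.lift_comp])
  refine ⟨z, exists_cocone_of_family hZ E (ι := Σ V : C, {f : V ⟶ y.base // S f}) (𝟙 _)
    (x := fun q ↦ ⟨q.1, x q.2.1 q.2.2⟩) (i := fun q ↦ i q.2.1 q.2.2)
    ⟨S, hS, fun V f hf ↦ ⟨⟨V, f, hf⟩, 𝟙 V, by rw [hi]; exact Category.id_comp _⟩⟩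
    (fun q ↦ κ q.2.1 q.2.2)
    (fun q ↦ by rw [hκ, hi]; exact (Category.comp_id _).symm) ?_⟩
  rintro ⟨V, f, hf⟩ ⟨V', f', hf'⟩ x₁ c c' h
  dsimp only at c c' h ⊢
  have hb := congrArg Tot.bs h
  rw [Tot.comp_bs, Tot.comp_bs, hi, hi] at hb
  obtain ⟨p, hp⟩ : ∃ p : x₁.base ⟶ V, Tot.bs c = p := ⟨_, rfl⟩
  rw [hp] at hb
  have hf2 : S (p ≫ f) := S.downward_closed hf _
  -- The source of `c` and `c'` need not be a chosen object, but `d` is an isomorphism to it from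
  -- the chosen object over `p ≫ f`. Precomposing with the invertible `E.map d` reduces the claim to
  -- `w`.
  obtain ⟨d, hd, hdc⟩ := Tot.exists_lift (i _ hf2) (c ≫ i f hf) (𝟙 _)
    (by rw [Tot.comp_bs, hi, hi, hp]; exact Category.id_comp _)
  have : IsIso (Tot.bs (E.map (a := ⟨x₁.base, x _ hf2⟩) d)) := by
    rw [E.map_bs, hd]; exact inferInstanceAs (IsIso (𝟙 x₁.base))
  have : IsIso (E.map (a := ⟨x₁.base, x _ hf2⟩) d) := Tot.isIso_of_isIso_bs _
  rw [← cancel_epi (E.map (a := ⟨x₁.base, x _ hf2⟩) d), ← E.map_comp_assoc, ← E.map_comp_assoc,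
    w _ hf2 _ _ (d ≫ c) (by rw [Category.assoc, hdc]),
    w _ hf2 _ _ (d ≫ c') (by rw [Category.assoc, ← h, hdc])]

lemma hom_ext_of_cover (G : FunOver Y Z) {y : Tot Y} {z : Tot Z} {h h' : G.o y ⟶ z}
    (hb : Tot.bs h = Tot.bs h') (H : ∀ {x : Tot X} (i : η.o x ⟶ y), G.map i ≫ h = G.map i ≫ h') :
    h = h' :=
  Ext.Cocone.hom_ext hη hZ (E := Ext.ofFun η G) (z := G.obj y.pt)
    ⟨fun i ↦ G.map i, fun i ↦ (G.map_bs i).trans (Category.comp_id _).symm,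
      fun j i ↦ G.map_comp j i⟩ hb H

lemma exists_desc_of_cover (G : FunOver Y Z) {y : Tot Y} {z : Tot Z} (g : y.base ⟶ z.base)
    (β : ∀ {x : Tot X}, (η.o x ⟶ y) → (G.o (η.o x) ⟶ z))
    (hβ : ∀ {x : Tot X} (i : η.o x ⟶ y), Tot.bs (β i) = Tot.bs i ≫ g)
    (w : ∀ {x x' : Tot X} (j : η.o x' ⟶ η.o x) (i : η.o x ⟶ y), β (j ≫ i) = G.map j ≫ β i) :
    ∃ h : G.o y ⟶ z, Tot.bs h = g ∧ ∀ {x : Tot X} (i : η.o x ⟶ y), G.map i ≫ h = β i :=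
  Ext.Cocone.exists_desc hη hZ (E := Ext.ofFun η G) (z := G.obj y.pt)
    ⟨fun i ↦ G.map i, fun i ↦ (G.map_bs i).trans (Category.comp_id _).symm,
      fun j i ↦ G.map_comp j i⟩ ⟨β, hβ, w⟩

lemma precomp_faithful : (precomp η Z).Faithful where
  map_injective {G G'} α β h := hom_ext fun y ↦
    hom_ext_of_cover hη hZ G (by rw [tapp_bs, tapp_bs]) fun {x} i ↦ by
      have h' : tapp α (η.o x) = tapp β (η.o x) := congrArg (fun δ ↦ tapp δ x) h
      rw [tapp_naturality, tapp_naturality, h']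

/-- An arrow `m` of the full image is locally the image of an arrow of `X`, where naturality is
given, and equality of arrows in a stack is local. -/
lemma naturality_of_full {G G' : FunOver Y Z} (t : ∀ x, G.o (η.o x) ⟶ G'.o (η.o x))
    (ht : ∀ x, Tot.bs (t x) = 𝟙 _)
    (nat : ∀ {x x' : Tot X} (n : x ⟶ x'), G.map (η.map n) ≫ t x' = t x ≫ G'.map (η.map n))
    {x x' : Tot X} (m : η.o x ⟶ η.o x') : G.map m ≫ t x' = t x ≫ G'.map m := by
  refine hZ.sep_family (z := G.o (η.o x)) (z' := G'.o (η.o x'))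
    (by rw [Tot.comp_bs, Tot.comp_bs, ht, ht, G.map_bs, G'.map_bs]
        exact (Category.comp_id _).trans (Category.id_comp _).symm) _ _
    (full_cov hη (η.comp G) m) ?_
  rintro ⟨⟨x₁, r, n⟩, e⟩
  dsimp only [FunOver.comp] at e ⊢
  rw [← G.map_comp_assoc, ← e, nat, reassoc_of% nat, ← G'.map_comp, e]

lemma precomp_full : (precomp η Z).Full where
  map_surjective {G G'} Θ := by
    obtain ⟨t, ht⟩ : ∃ t : ∀ x, G.o (η.o x) ⟶ G'.o (η.o x), ∀ x, t x = tapp Θ x :=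
      ⟨fun x ↦ tapp Θ x, fun _ ↦ rfl⟩
    have htb : ∀ x, Tot.bs (t x) = 𝟙 _ := fun x ↦ by rw [ht]; rfl
    have nat : ∀ {x x' : Tot X} (m : η.o x ⟶ η.o x'), G.map m ≫ t x' = t x ≫ G'.map m :=
      naturality_of_full hη hZ t htb fun n ↦ by
        rw [ht, ht]
        exact tapp_naturality Θ n
    -- The component at `y` is induced by the local components `t x ≫ G'.map i` on the covering of
    -- `y` by images of objects of `X`.
    choose h hb hh using fun y ↦ exists_desc_of_cover hη hZ G (z := G'.o y) (𝟙 _)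
      (fun {x} i ↦ t x ≫ G'.map i) (fun {x} i ↦ by
        rw [Tot.comp_bs, htb, G'.map_bs]
        exact (Category.id_comp _).trans (Category.comp_id _).symm) (fun {x x'} j i ↦ by
        rw [G'.map_comp, reassoc_of% nat j])
    obtain ⟨α, hα⟩ := exists_hom h hb fun {y y'} φ ↦
      hom_ext_of_cover hη hZ G (by
        rw [Tot.comp_bs, Tot.comp_bs, hb, hb, G.map_bs, G'.map_bs]
        exact (Category.comp_id _).trans (Category.id_comp _).symm) fun {x} i ↦ by
          rw [← G.map_comp_assoc, hh, reassoc_of% hh y i, G'.map_comp]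
    refine ⟨α, hom_ext fun x ↦ ?_⟩
    rw [precomp_tapp, hα, ← ht]
    have := hh (η.o x) (𝟙 _)
    rwa [G.map_id, G'.map_id, Category.id_comp, Category.comp_id] at this

lemma precomp_essSurj : (precomp η Z).EssSurj where
  mem_essImage F := by
    obtain ⟨E, hE, e, he, hnat⟩ := exists_ext hη hZ F
    -- The value at `y` is the vertex of a chosen cocone on the objects of `X` over `y`. As every
    -- cocone is universal, an arrow `y ⟶ y'` induces a unique arrow of vertices, and uniqueness
    -- gives functoriality.
    choose z α using fun y ↦ exists_cocone hη hZ E y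
    replace α := fun y ↦ (α y).some
    choose k hk hk' using fun {y y' : Tot Y} (φ : y ⟶ y') ↦
      (α y).exists_desc hη hZ (z' := ⟨y'.base, z y'⟩) (g := Tot.bs φ)
        ⟨fun i ↦ (α y').ι (i ≫ φ), fun i ↦ (α y').ι_bs' _, fun j i ↦ by
          rw [Category.assoc]; exact (α y').w j (i ≫ φ)⟩
    replace hk' : ∀ {y y' : Tot Y} (φ : y ⟶ y') {x : Tot X} (i : η.o x ⟶ y),
      (α y).ι i ≫ k φ = (α y').ι (i ≫ φ) := fun φ _ i ↦ hk' φ i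
    let G : FunOver Y Z :=
      { obj := fun {U} y ↦ z ⟨U, y⟩
        map := fun φ ↦ k φ
        map_bs := fun φ ↦ hk φ
        map_id := fun y ↦ (α y).hom_ext hη hZ (hk _) fun i ↦ by
          rw [hk', Category.comp_id, Category.comp_id]
        map_comp := fun {y y' y''} φ ψ ↦ (α y).hom_ext hη hZ (by
          rw [hk, Tot.comp_bs, Tot.comp_bs]
          exact congrArg₂ (· ≫ ·) (hk φ).symm (hk ψ).symm) fun i ↦ by
          rw [hk', reassoc_of% (hk' φ i), hk', Category.assoc] }
    -- Among arrows to `η.o a` the identity is terminal, so its leg identifies `E.o a` with the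
    -- vertex over `η.o a`.
    obtain ⟨t, ht⟩ : ∃ t : ∀ a, E.o a ⟶ (⟨a.base, z (η.o a)⟩ : Tot Z),
      ∀ a, t a = (α (η.o a)).ι (𝟙 (η.o a)) := ⟨fun a ↦ (α (η.o a)).ι (𝟙 (η.o a)), fun _ ↦ rfl⟩
    have htb : ∀ a, Tot.bs (t a) = 𝟙 _ := fun a ↦ by rw [ht]; exact (α (η.o a)).ι_bs' _
    have htk : ∀ {a b : Tot X} (n : a ⟶ b), t a ≫ k (η.map n) = E.map (η.map n) ≫ t b :=
      fun {a b} n ↦ by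
        rw [ht, ht]
        exact (hk' (η.map n) (𝟙 _)).trans ((congrArg (α (η.o b)).ι
          ((Category.id_comp _).trans (Category.comp_id _).symm)).trans ((α (η.o b)).w _ _))
    have hetb : ∀ a, Tot.bs (e a ≫ t a) = 𝟙 _ := fun a ↦ by
      rw [Tot.comp_bs, he, htb]; exact Category.id_comp _
    have hetk : ∀ {a b : Tot X} (n : a ⟶ b), F.map n ≫ e b ≫ t b = (e a ≫ t a) ≫ k (η.map n) :=
      fun {a b} n ↦ by rw [reassoc_of% hnat n, Category.assoc, htk n]
    obtain ⟨β, -⟩ := exists_hom (F := F) (G := (precomp η Z).obj G) (fun a ↦ e a ≫ t a)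
      hetb hetk
    exact ⟨G, ⟨(asIso β).symm⟩⟩

/-- Restriction along a local equivalence, for functors with values in a stack. -/
theorem isEquivalence_precomp : (precomp η Z).IsEquivalence where
  faithful := precomp_faithful hη hZ
  full := precomp_full hη hZ
  essSurj := precomp_essSurj hη hZ

end

end FunOver

/-! ### Pseudonatural transformations as functors over the site. -/

section Pseudo

open Bicategory Pseudofunctor.StrongTrans

variable {C : Type u} [SmallCategory C] {X Y Z : Cᵒᵖ ⥤ Grpd.{u, u}}

/-- The components of the unit constraint of the pseudofunctor of a presheaf. -/
def mapIdApp {U : C} (z : Sec Z U) : (res Z (𝟙 U)).obj z ⟶ z :=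
  ((toPseudo Z).mapId ⟨op U⟩).hom.toNatTrans.app z

/-- The components of the composition constraint of the pseudofunctor of a presheaf. -/
def mapCompApp {W V U : C} (g : W ⟶ V) (f : V ⟶ U) (z : Sec Z U) :
    (res Z (g ≫ f)).obj z ⟶ (res Z g).obj ((res Z f).obj z) :=
  ((toPseudo Z).mapComp f.op.toLoc g.op.toLoc).hom.toNatTrans.app z

/-- The constraints of a pseudofunctor that comes from a strict functor are identities up to
transport of objects, so no coherence data survive beyond `eqToHom`. -/
lemma mapIdApp_eq {U : C} (z : Sec Z U) : mapIdApp z = eqToHom (res_id_obj Z z) :=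
  Cat.eqToHom_app _ _ ((Z ⋙ Grpd.forgetToCat).map_id (op U)) _

lemma mapCompApp_eq {W V U : C} (g : W ⟶ V) (f : V ⟶ U) (z : Sec Z U) :
    mapCompApp g f z = eqToHom (res_comp_obj Z g f z) :=
  Cat.eqToHom_app _ _ ((Z ⋙ Grpd.forgetToCat).map_comp f.op g.op) _

/-- The functor on sections over `U` underlying a pseudonatural transformation. -/
def pApp (F : toPseudo X ⟶ toPseudo Z) (U : C) : Sec X U ⥤ Sec Z U :=
  (F.app ⟨op U⟩).toFunctor

/-- The naturality constraint of a pseudonatural transformation. -/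
def pNat (F : toPseudo X ⟶ toPseudo Z) {V U : C} (f : V ⟶ U) (x : Sec X U) :
    (pApp F V).obj ((res X f).obj x) ⟶ (res Z f).obj ((pApp F U).obj x) :=
  (F.naturality f.op.toLoc).hom.toNatTrans.app x

lemma pNat_naturality (F : toPseudo X ⟶ toPseudo Z) {V U : C} (f : V ⟶ U) {x y : Sec X U}
    (m : x ⟶ y) : (pApp F V).map ((res X f).map m) ≫ pNat F f y =
      pNat F f x ≫ (res Z f).map ((pApp F U).map m) :=
  (F.naturality f.op.toLoc).hom.toNatTrans.naturality m

lemma pNat_id (F : toPseudo X ⟶ toPseudo Z) {U : C} (x : Sec X U) :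
    pNat F (𝟙 U) x = (pApp F U).map (eqToHom (res_id_obj X x)) ≫
      eqToHom (res_id_obj Z _).symm := by
  have h := congrArg (fun t ↦ t.toNatTrans.app x) (F.naturality_id ⟨op U⟩)
  change pNat F (𝟙 U) x ≫ mapIdApp ((pApp F U).obj x) =
    (pApp F U).map (mapIdApp x) ≫ 𝟙 _ ≫ 𝟙 _ at h
  rw [mapIdApp_eq, mapIdApp_eq, Category.id_comp, Category.comp_id] at h
  rw [← h, Category.assoc, eqToHom_trans, eqToHom_refl, Category.comp_id]

lemma pNat_comp (F : toPseudo X ⟶ toPseudo Z) {W V U : C} (g : W ⟶ V) (f : V ⟶ U) (x : Sec X U) :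
    pNat F (g ≫ f) x = (pApp F W).map (eqToHom (res_comp_obj X g f x)) ≫
      pNat F g ((res X f).obj x) ≫ (res Z g).map (pNat F f x) ≫
        eqToHom (res_comp_obj Z g f _).symm := by
  have h := congrArg (fun t ↦ t.toNatTrans.app x) (F.naturality_comp f.op.toLoc g.op.toLoc)
  change pNat F (g ≫ f) x ≫
      mapCompApp g f ((pApp F U).obj x) =
    (pApp F W).map (mapCompApp g f x) ≫ 𝟙 _ ≫
      pNat F g ((res X f).obj x) ≫ 𝟙 _ ≫ (res Z g).map (pNat F f x) ≫ 𝟙 _ at h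
  rw [mapCompApp_eq, mapCompApp_eq] at h
  simp only [Category.id_comp, Category.comp_id] at h
  rw [← cancel_mono (eqToHom (res_comp_obj Z g f ((pApp F U).obj x))), h]
  simp

/-- A pseudonatural transformation from its components. -/
noncomputable def mkPseudo (A : ∀ U : C, Sec X U ⥤ Sec Z U)
    (n : ∀ {V U : C} (f : V ⟶ U) (x : Sec X U),
      (A V).obj ((res X f).obj x) ⟶ (res Z f).obj ((A U).obj x))
    (nat : ∀ {V U : C} (f : V ⟶ U) {x y : Sec X U} (m : x ⟶ y),
      (A V).map ((res X f).map m) ≫ n f y = n f x ≫ (res Z f).map ((A U).map m))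
    (nat_id : ∀ {U : C} (x : Sec X U), n (𝟙 U) x =
      (A U).map (eqToHom (res_id_obj X x)) ≫ eqToHom (res_id_obj Z _).symm)
    (nat_comp : ∀ {W V U : C} (g : W ⟶ V) (f : V ⟶ U) (x : Sec X U),
      n (g ≫ f) x = (A W).map (eqToHom (res_comp_obj X g f x)) ≫
        n g ((res X f).obj x) ≫ (res Z g).map (n f x) ≫ eqToHom (res_comp_obj Z g f _).symm) :
    toPseudo X ⟶ toPseudo Z where
  app U := (A U.as.unop).toCatHom
  naturality {V U} f := Cat.Hom.isoMk
    (F := res X f.as.unop ⋙ A U.as.unop) (G := A V.as.unop ⋙ res Z f.as.unop)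
    (NatIso.ofComponents (fun x ↦ asIso (n f.as.unop x)) (fun m ↦ nat f.as.unop m))
  naturality_naturality η := by
    obtain rfl := LocallyDiscrete.eq_of_hom η
    obtain rfl := Subsingleton.elim η (𝟙 _)
    rw [PrelaxFunctor.map₂_id, PrelaxFunctor.map₂_id]
    exact strict_naturality_two _ _ _
  naturality_id U := by
    refine Cat.Hom₂.ext (NatTrans.ext (funext fun (x : Sec X U.as.unop) ↦ ?_))
    change n (𝟙 U.as.unop) x ≫
      mapIdApp ((A U.as.unop).obj x) =
      (A U.as.unop).map (mapIdApp (U := U.as.unop) x) ≫ 𝟙 _ ≫ 𝟙 _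
    rw [mapIdApp_eq, mapIdApp_eq, Category.id_comp, Category.comp_id, nat_id,
      Category.assoc, eqToHom_trans, eqToHom_refl, Category.comp_id]
  naturality_comp {U V W} f g := by
    refine Cat.Hom₂.ext (NatTrans.ext (funext fun (x : Sec X U.as.unop) ↦ ?_))
    change n (g.as.unop ≫ f.as.unop) x ≫
      mapCompApp g.as.unop f.as.unop ((A U.as.unop).obj x) =
      (A W.as.unop).map
        (mapCompApp (U := U.as.unop) g.as.unop f.as.unop x) ≫
        𝟙 _ ≫ n g.as.unop ((res X f.as.unop).obj x) ≫ 𝟙 _ ≫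
        (res Z g.as.unop).map (n f.as.unop x) ≫ 𝟙 _
    rw [mapCompApp_eq, mapCompApp_eq, nat_comp]
    simp

/-- The components of a modification. -/
def mApp {F G : toPseudo X ⟶ toPseudo Z} (Γ : F ⟶ G) {U : C} (x : Sec X U) :
    (pApp F U).obj x ⟶ (pApp G U).obj x :=
  (Γ.as.app ⟨op U⟩).toNatTrans.app x

lemma mApp_naturality {F G : toPseudo X ⟶ toPseudo Z} (Γ : F ⟶ G) {U : C} {x y : Sec X U}
    (m : x ⟶ y) : (pApp F U).map m ≫ mApp Γ y = mApp Γ x ≫ (pApp G U).map m :=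
  (Γ.as.app ⟨op U⟩).toNatTrans.naturality m

lemma mApp_pNat {F G : toPseudo X ⟶ toPseudo Z} (Γ : F ⟶ G) {V U : C} (f : V ⟶ U) (x : Sec X U) :
    mApp Γ ((res X f).obj x) ≫ pNat G f x = pNat F f x ≫ (res Z f).map (mApp Γ x) :=
  congrArg (fun t ↦ t.toNatTrans.app x) (Γ.as.naturality f.op.toLoc)

/-- A modification from its components. -/
def mkModif {F G : toPseudo X ⟶ toPseudo Z}
    (t : ∀ {U : C} (x : Sec X U), (pApp F U).obj x ⟶ (pApp G U).obj x)
    (nat : ∀ {U : C} {x y : Sec X U} (m : x ⟶ y),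
      (pApp F U).map m ≫ t y = t x ≫ (pApp G U).map m)
    (comm : ∀ {V U : C} (f : V ⟶ U) (x : Sec X U),
      t ((res X f).obj x) ≫ pNat G f x = pNat F f x ≫ (res Z f).map (t x)) : F ⟶ G where
  as.app U := ⟨⟨fun x ↦ t (U := U.as.unop) x, fun _ _ m ↦ nat m⟩⟩
  as.naturality f := by
    apply Cat.Hom₂.ext
    ext x
    exact comm f.as.unop x

lemma modif_ext {F G : toPseudo X ⟶ toPseudo Z} {Γ Γ' : F ⟶ G}
    (h : ∀ {U : C} (x : Sec X U), mApp Γ x = mApp Γ' x) : Γ = Γ' := by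
  apply homCategory.ext
  intro U
  apply Cat.Hom₂.ext
  ext x
  exact h (U := U.as.unop) x

lemma pNat_toPseudoMap_comp (η : X ⟶ Y) (F : toPseudo Y ⟶ toPseudo Z) {V U : C} (f : V ⟶ U)
    (x : Sec X U) : pNat (toPseudoMap η ≫ F) f x =
      (pApp F V).map (eqToHom (res_sec_obj η f x)) ≫ pNat F f ((sec η U).obj x) := by
  have h : ((toPseudoMap η).naturality f.op.toLoc).hom.toNatTrans.app x =
    eqToHom (res_sec_obj η f x) :=
      Cat.eqToHom_app _ _ ((Functor.whiskerRight η Grpd.forgetToCat).naturality f.op) _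
  have key : ∀ (k : (sec η V).obj ((res X f).obj x) ⟶ (res Y f).obj ((sec η U).obj x)),
      k = eqToHom (res_sec_obj η f x) →
      𝟙 _ ≫ (pApp F V).map k ≫ 𝟙 _ ≫ pNat F f ((sec η U).obj x) ≫ 𝟙 _ =
        (pApp F V).map (eqToHom (res_sec_obj η f x)) ≫ pNat F f ((sec η U).obj x) := by
    rintro _ rfl
    simp
  exact key _ h

lemma pNat_toPseudoMap (η : X ⟶ Z) {V U : C} (f : V ⟶ U) (x : Sec X U) :
    pNat (toPseudoMap η) f x = eqToHom (res_sec_obj η f x) :=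
  Cat.eqToHom_app _ _ ((Functor.whiskerRight η Grpd.forgetToCat).naturality f.op) _

lemma vert_pNat_id (F : toPseudo X ⟶ toPseudo Z) {U : C} {x y : Sec X U}
    (m : x ⟶ (res X (𝟙 U)).obj y) :
    Tot.vert ((pApp F U).map m ≫ pNat F (𝟙 U) y) ≫ Tot.cart ⟨U, (pApp F U).obj y⟩ (𝟙 U) =
      Tot.vert ((pApp F U).map (m ≫ eqToHom (res_id_obj X y))) := by
  rw [pNat_id, Tot.cart_id, ← Tot.vert_comp]
  simp

lemma vert_pNat_comp (F : toPseudo X ⟶ toPseudo Z) {W V U : C} (g : W ⟶ V) (f : V ⟶ U)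
    {x : Sec X W} {y : Sec X V} {z : Sec X U} (m : x ⟶ (res X g).obj y)
    (n : y ⟶ (res X f).obj z) :
    Tot.vert ((pApp F W).map (m ≫ (res X g).map n ≫ eqToHom (res_comp_obj X g f z).symm) ≫
        pNat F (g ≫ f) z) ≫ Tot.cart ⟨U, (pApp F U).obj z⟩ (g ≫ f) =
      (Tot.vert ((pApp F W).map m ≫ pNat F g y) ≫ Tot.cart ⟨V, (pApp F V).obj y⟩ g) ≫
        Tot.vert ((pApp F V).map n ≫ pNat F f z) ≫ Tot.cart ⟨U, (pApp F U).obj z⟩ f := by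
  rw [Category.assoc, Tot.cart_vert_assoc, Tot.cart_comp_cart ⟨U, (pApp F U).obj z⟩, pNat_comp,
    ← Tot.vert_comp_assoc, ← Tot.vert_comp_assoc]
  congr 2
  simp only [Functor.map_comp, Category.assoc, eqToHom_map, eqToHom_trans_assoc, eqToHom_refl,
    Category.id_comp]
  rw [reassoc_of% pNat_naturality F g n]

lemma vert_pNat_congr (F : toPseudo X ⟶ toPseudo Z) {a b : Tot X} {φ : a ⟶ b}
    {f g : a.base ⟶ b.base} (hf : Tot.bs φ = f) (hg : Tot.bs φ = g) :
    Tot.vert ((pApp F a.base).map (Tot.vat φ f hf) ≫ pNat F f b.pt) ≫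
        Tot.cart ⟨b.base, (pApp F b.base).obj b.pt⟩ f =
      Tot.vert ((pApp F a.base).map (Tot.vat φ g hg) ≫ pNat F g b.pt) ≫
        Tot.cart ⟨b.base, (pApp F b.base).obj b.pt⟩ g := by
  subst hf hg
  rfl

/-- The functor over `C` of a pseudonatural transformation. -/
abbrev pFun (F : toPseudo X ⟶ toPseudo Z) : FunOver X Z where
  obj {U} x := (pApp F U).obj x
  map {a b} φ := Tot.vert ((pApp F a.base).map (Tot.vat φ (Tot.bs φ) rfl) ≫
    pNat F (Tot.bs φ) b.pt) ≫ Tot.cart (V := a.base) ⟨b.base, (pApp F b.base).obj b.pt⟩ (Tot.bs φ)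
  map_bs φ := by rw [Tot.comp_bs, Tot.vert_bs, Tot.cart_bs]; exact Category.id_comp _
  map_id a := by
    rw [vert_pNat_congr F rfl (Tot.id_bs a), vert_pNat_id, Tot.id_vat a _ (Tot.id_bs a)]
    simp
  map_comp {a b c} φ ψ := by
    rw [vert_pNat_congr F rfl (Tot.comp_bs φ ψ), Tot.comp_vat φ ψ _ (Tot.comp_bs φ ψ) rfl rfl,
      vert_pNat_comp]

lemma pFun_map (F : toPseudo X ⟶ toPseudo Z) {a b : Tot X} (φ : a ⟶ b) {f : a.base ⟶ b.base}
    (h : Tot.bs φ = f) : (pFun F).map φ =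
      Tot.vert ((pApp F a.base).map (Tot.vat φ f h) ≫ pNat F f b.pt) ≫
        Tot.cart ⟨b.base, (pApp F b.base).obj b.pt⟩ f :=
  vert_pNat_congr F rfl h

lemma pFun_vert (F : toPseudo X ⟶ toPseudo Z) {U : C} {x y : Sec X U} (m : x ⟶ y) :
    (pFun F).map (Tot.vert m) = Tot.vert ((pApp F U).map m) := by
  rw [pFun_map F _ (Tot.vert_bs m), vert_pNat_id, Tot.vert_vat_self]
  simp

lemma pFun_cart (F : toPseudo X ⟶ toPseudo Z) (x : Tot X) {V : C} (f : V ⟶ x.base) :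
    (pFun F).map (Tot.cart x f) = Tot.vert (pNat F f x.pt) ≫
      Tot.cart ⟨x.base, (pApp F x.base).obj x.pt⟩ f := by
  rw [pFun_map F _ (Tot.cart_bs x f), Tot.cart_vat_self]
  simp

/-- A pseudonatural transformation of presheaves of groupoids is the same as a functor over `C`. -/
abbrev pFunctor (X Z : Cᵒᵖ ⥤ Grpd.{u, u}) : (toPseudo X ⟶ toPseudo Z) ⥤ FunOver X Z where
  obj F := pFun F
  map {F G} Γ := ⟨fun x ↦ mApp Γ x, fun {a b} φ ↦ by
    rw [pFun_map F φ rfl, pFun_map G φ rfl, Category.assoc]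
    refine (congrArg (_ ≫ ·) (Tot.cart_vert _ _)).trans ?_
    refine (Tot.vert_comp_assoc _ _ _).symm.trans (Eq.trans ?_ (Tot.vert_comp_assoc _ _ _))
    congr 2
    rw [Category.assoc, ← mApp_pNat, ← Category.assoc, mApp_naturality, Category.assoc]⟩
  map_id _ := rfl
  map_comp _ _ := rfl

lemma cart_cancel {U V : C} {x : Sec Z U} {f : V ⟶ U} {y : Sec Z V}
    {m n : y ⟶ (res Z f).obj x} (h : Tot.vert m ≫ Tot.cart ⟨U, x⟩ f = Tot.vert n ≫ Tot.cart ⟨U, x⟩ f) :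
    m = n := Tot.vert_injective (Tot.cancel _ rfl h)

instance : (pFunctor X Z).Faithful where
  map_injective {F G Γ Γ'} h := modif_ext fun {U} x ↦ by
    have := congrArg (fun (α : pFun F ⟶ pFun G) ↦ FunOver.Hom.app α x) h
    exact this

instance : (pFunctor X Z).Full where
  map_surjective {F G} α := by
    refine ⟨mkModif (fun x ↦ FunOver.Hom.app α x) (fun {U x y} m ↦ Tot.vert_injective ?_)
      (fun {V U} f x ↦ cart_cancel ?_), rfl⟩
    -- Naturality at vertical arrows is naturality on each fibre; naturality at cartesian arrows is
    -- the axiom of a modification.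
    · have h := FunOver.Hom.naturality α (Tot.vert m)
      rw [pFun_vert, pFun_vert] at h
      rw [Tot.vert_comp, Tot.vert_comp]
      exact h
    · have h := FunOver.Hom.naturality α (Tot.cart ⟨U, x⟩ f)
      rw [pFun_cart, pFun_cart] at h
      rw [Tot.vert_comp, Tot.vert_comp, Category.assoc, Category.assoc, ← Tot.cart_vert]
      simpa using h.symm

/-- Vertical and cartesian arrows generate the total category. The images of the former give
functors on the fibres, and the vertical parts of the images of the latter give the naturality
constraints. Coherence of the constraints is functoriality of `G` on identities and on composites of
cartesian arrows. -/
instance : (pFunctor X Z).EssSurj where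
  mem_essImage G := by
    choose a ha using fun {U : C} {x y : Sec X U} (m : x ⟶ y) ↦
      Tot.exists_vert (x := G.obj x) (y := G.obj y)
        (G.map (Tot.vert m)) (by rw [G.map_bs, Tot.vert_bs])
    let A (U : C) : Sec X U ⥤ Sec Z U :=
      { obj := G.obj
        map := a
        map_id := fun x ↦ Tot.vert_injective (by rw [ha, Tot.vert_id, G.map_id, Tot.vert_id])
        map_comp := fun m n ↦ Tot.vert_injective (by
          rw [ha, Tot.vert_comp, G.map_comp, Tot.vert_comp, ha, ha]) }
    have hA : ∀ {U : C} {x y : Sec X U} (m : x ⟶ y), Tot.vert ((A U).map m) = G.map (Tot.vert m) :=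
      fun m ↦ ha m
    obtain ⟨n, hn⟩ : ∃ n : ∀ {V U : C} (f : V ⟶ U) (x : Sec X U),
        (A V).obj ((res X f).obj x) ⟶ (res Z f).obj ((A U).obj x),
        ∀ {V U : C} (f : V ⟶ U) (x : Sec X U),
          Tot.vert (n f x) ≫ Tot.cart ⟨U, (A U).obj x⟩ f = G.map (Tot.cart ⟨U, x⟩ f) :=
      ⟨fun {V U} f x ↦ Tot.vat (G.map (Tot.cart ⟨U, x⟩ f)) f (G.map_bs _),
        fun {V U} f x ↦ Tot.vert_cart _ _⟩
    let F : toPseudo X ⟶ toPseudo Z := mkPseudo A n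
      (fun {V U} f x y m ↦ cart_cancel (by
        rw [Tot.vert_comp, Tot.vert_comp, Category.assoc, Category.assoc, hn, ← Tot.cart_vert,
          reassoc_of% hn f x, hA, hA, ← G.map_comp, ← G.map_comp, Tot.cart_vert]))
      (fun {U} x ↦ cart_cancel (by
        rw [hn, Tot.cart_id, ← hA, Tot.cart_id, ← Tot.vert_comp]
        simp))
      (fun {W V U} g f x ↦ cart_cancel (by
        rw [hn]
        have h1 := Tot.cart_comp_cart ⟨U, x⟩ f g
        have h2 := Tot.cart_comp_cart ⟨U, (A U).obj x⟩ f g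
        have h3 : Tot.cart ⟨U, x⟩ (g ≫ f) = Tot.vert (eqToHom (res_comp_obj X g f x)) ≫
            Tot.cart ⟨V, (res X f).obj x⟩ g ≫ Tot.cart ⟨U, x⟩ f := by
          rw [h1, ← Tot.vert_comp_assoc]; simp
        rw [h3, G.map_comp, G.map_comp, ← hn, ← hn, ← hA, Tot.vert_comp, Tot.vert_comp,
          Tot.vert_comp]
        simp only [Category.assoc]
        rw [Tot.cart_vert_assoc, h2]))
    have hF : ∀ {a b : Tot X} (φ : a ⟶ b), (pFun F).map φ = G.map φ := fun {a b} φ ↦ by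
      refine (pFun_map F φ rfl).trans ?_
      rw [Tot.vert_comp, Category.assoc]
      refine (congrArg (_ ≫ ·) (hn _ _)).trans ?_
      refine (congrArg (· ≫ _) (hA _)).trans ?_
      rw [← G.map_comp, Tot.vert_cart]
    obtain ⟨α, -⟩ := FunOver.exists_hom (F := (pFunctor X Z).obj F) (G := G) (fun a ↦ 𝟙 (G.o a))
      (fun _ ↦ rfl) (fun {a b} φ ↦
        (Category.comp_id _).trans ((hF φ).trans (Category.id_comp _).symm))
    exact ⟨F, ⟨asIso α⟩⟩

instance : (pFunctor X Z).IsEquivalence where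

/-- The functor over `C` underlying a morphism of presheaves of groupoids. -/
abbrev FunOver.ofNat (η : X ⟶ Y) : FunOver X Y := pFun (toPseudoMap η)

lemma FunOver.ofNat_map (η : X ⟶ Y) {a b : Tot X} (φ : a ⟶ b) {f : a.base ⟶ b.base}
    (h : Tot.bs φ = f) : (FunOver.ofNat η).map φ =
      Tot.vert ((sec η a.base).map (Tot.vat φ f h) ≫ eqToHom (res_sec_obj η f b.pt)) ≫
        Tot.cart ⟨b.base, (sec η b.base).obj b.pt⟩ f := by
  rw [← pNat_toPseudoMap]
  exact pFun_map _ _ h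

lemma FunOver.ofNat_vert (η : X ⟶ Y) {U : C} {x y : Sec X U} (m : x ⟶ y) :
    (FunOver.ofNat η).map (Tot.vert m) = Tot.vert ((sec η U).map m) := pFun_vert _ _

lemma FunOver.ofNat_cart (η : X ⟶ Y) (x : Tot X) {V : C} (f : V ⟶ x.base) :
    (FunOver.ofNat η).map (Tot.cart x f) = Tot.vert (eqToHom (res_sec_obj η f x.pt)) ≫
      Tot.cart ⟨x.base, (sec η x.base).obj x.pt⟩ f := by
  rw [pFun_cart, pNat_toPseudoMap]
  rfl

/-- Restriction of pseudonatural transformations corresponds to restriction of functors over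
`C`. -/
lemma exists_precompIso (η : X ⟶ Y) (Z : Cᵒᵖ ⥤ Grpd.{u, u}) :
    Nonempty (precomp (toPseudo Z) (toPseudoMap η) ⋙ pFunctor X Z ≅
      pFunctor Y Z ⋙ (FunOver.ofNat η).precomp Z) := by
  have key (F : toPseudo Y ⟶ toPseudo Z) {a b : Tot X} (φ : a ⟶ b) :
      (pFun (toPseudoMap η ≫ F)).map φ = (pFun F).map ((FunOver.ofNat η).map φ) := by
    refine (pFun_map _ φ rfl).trans ?_
    refine Eq.trans ?_ (congrArg (pFun F).map (FunOver.ofNat_map η φ rfl).symm)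
    refine Eq.trans ?_ ((pFun F).map_comp (a := ⟨a.base, (sec η a.base).obj a.pt⟩)
      (b := ⟨a.base, _⟩) (c := ⟨b.base, (sec η b.base).obj b.pt⟩) _ _).symm
    refine Eq.trans ?_ (congrArg₂ (· ≫ ·) (pFun_vert F _).symm (pFun_cart F (V := a.base)
      ⟨b.base, (sec η b.base).obj b.pt⟩ (Tot.bs (a := a) (b := b) φ)).symm)
    refine Eq.trans ?_ (Tot.vert_comp_assoc _ _ _)
    rw [pNat_toPseudoMap_comp]
    refine congrArg (fun t ↦ Tot.vert t ≫ Tot.cart (V := a.base)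
      ⟨b.base, (pApp F b.base).obj ((sec η b.base).obj b.pt)⟩ (Tot.bs (a := a) (b := b) φ)) ?_
    refine Eq.trans ?_ (congrArg (· ≫ _) ((pApp F a.base).map_comp _ _)).symm
    exact (Category.assoc _ _ _).symm
  exact ⟨NatIso.ofComponents (fun F ↦ asIso (X := pFun (toPseudoMap η ≫ F))
    (Y := (FunOver.ofNat η).comp (pFun F)) ⟨fun {U} x ↦ 𝟙 ((pApp F U).obj ((sec η U).obj x)),
      fun {a b} φ ↦ by
        refine (congrArg (_ ≫ ·) (Tot.vert_id _)).trans
          (Eq.trans ?_ (congrArg (· ≫ _) (Tot.vert_id _)).symm)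
        exact (Category.comp_id _).trans ((key F φ).trans (Category.id_comp _).symm)⟩)
    fun {F G} Γ ↦ FunOver.Hom.ext (by
      funext U x
      exact (Category.comp_id _).trans (Category.id_comp _).symm)⟩

/-- Two out of three in the square of `exists_precompIso`, whose other two sides are the
equivalences `pFunctor`. -/
lemma isEquivalence_precomp_iff (η : X ⟶ Y) (Z : Cᵒᵖ ⥤ Grpd.{u, u}) :
    (precomp (toPseudo Z) (toPseudoMap η)).IsEquivalence ↔
      ((FunOver.ofNat η).precomp Z).IsEquivalence := by
  obtain ⟨e⟩ := exists_precompIso η Z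
  constructor
  · intro h
    have := Functor.isEquivalence_of_iso e
    exact Functor.isEquivalence_of_comp_left (pFunctor Y Z) _
  · intro h
    have := Functor.isEquivalence_of_iso e.symm
    exact Functor.isEquivalence_of_comp_right _ (pFunctor X Z)

end Pseudo

/-! ### Descent data and the stack condition in the total category. -/

namespace Tot

variable {C : Type u} [SmallCategory C] {X : Cᵒᵖ ⥤ Grpd.{u, u}}

/-- The canonical arrow from the restriction along `g ≫ f` to the restriction along `f`. -/
def rest (x : Tot X) {W V : C} (f : V ⟶ x.base) (g : W ⟶ V) (k : W ⟶ x.base) (h : g ≫ f = k) :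
    (⟨W, (res X k).obj x.pt⟩ : Tot X) ⟶ ⟨V, (res X f).obj x.pt⟩ :=
  vert (eqToHom (by rw [← h, res_comp_obj])) ≫ cart ⟨V, (res X f).obj x.pt⟩ g

@[simp] lemma rest_bs (x : Tot X) {W V : C} (f : V ⟶ x.base) (g : W ⟶ V) (k : W ⟶ x.base)
    (h : g ≫ f = k) : bs (rest x f g k h) = g := by
  rw [rest, comp_bs, vert_bs, cart_bs]
  exact Category.id_comp _

lemma rest_cart (x : Tot X) {W V : C} (f : V ⟶ x.base) (g : W ⟶ V) (k : W ⟶ x.base)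
    (h : g ≫ f = k) : rest x f g k h ≫ cart x f = cart x k := by
  subst h
  rw [rest, Category.assoc, cart_comp_cart, ← vert_comp_assoc]
  simp

lemma vert_inv {U : C} {x y : Sec X U} (m : x ⟶ y) : vert (inv m) ≫ vert m = 𝟙 _ := by
  rw [← vert_comp, IsIso.inv_hom_id, vert_id]

lemma vert_inv_comp {U : C} {x y : Sec X U} (m : x ⟶ y) : vert m ≫ vert (inv m) = 𝟙 _ := by
  rw [← vert_comp, IsIso.hom_inv_id, vert_id]

lemma vert_inv_assoc {U : C} {x y : Sec X U} (m : x ⟶ y) {a : Tot X} (h : (⟨U, y⟩ : Tot X) ⟶ a) :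
    vert (inv m) ≫ vert m ≫ h = h := by
  rw [← Category.assoc, vert_inv, Category.id_comp]

lemma vert_inv_comp_assoc {U : C} {x y : Sec X U} (m : x ⟶ y) {a : Tot X}
    (h : (⟨U, x⟩ : Tot X) ⟶ a) : vert m ≫ vert (inv m) ≫ h = h := by
  rw [← Category.assoc, vert_inv_comp, Category.id_comp]

end Tot

section

variable {C : Type u} [SmallCategory C] {Z : Cᵒᵖ ⥤ Grpd.{u, u}}

lemma mapComp'_hom_app {W V U : C} (g : W ⟶ V) (f : V ⟶ U) (k : W ⟶ U) (h : g ≫ f = k)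
    (h' : f.op.toLoc ≫ g.op.toLoc = k.op.toLoc) (z : Sec Z U) :
    ((toPseudo Z).mapComp' f.op.toLoc g.op.toLoc k.op.toLoc h').hom.toNatTrans.app z =
      eqToHom ((res_obj_congr Z h z).symm.trans (res_comp_obj Z g f z)) := by
  subst h
  have e : (toPseudo Z).mapComp' f.op.toLoc g.op.toLoc (g ≫ f).op.toLoc h' =
    (toPseudo Z).mapComp f.op.toLoc g.op.toLoc := Pseudofunctor.mapComp'_eq_mapComp _ _ _
  rw [e]
  exact mapCompApp_eq g f z

lemma mapComp'_inv_app {W V U : C} (g : W ⟶ V) (f : V ⟶ U) (k : W ⟶ U) (h : g ≫ f = k)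
    (h' : f.op.toLoc ≫ g.op.toLoc = k.op.toLoc) (z : Sec Z U) :
    ((toPseudo Z).mapComp' f.op.toLoc g.op.toLoc k.op.toLoc h').inv.toNatTrans.app z =
      eqToHom ((res_comp_obj Z g f z).symm.trans (res_obj_congr Z h z)) := by
  have e := Cat.Hom.hom_inv_id_toNatTrans_app
    ((toPseudo Z).mapComp' f.op.toLoc g.op.toLoc k.op.toLoc h') z
  have e' := mapComp'_hom_app g f k h h' z
  have key : ∀ {a b : Sec Z W} (p : a ⟶ b) (q : b ⟶ a) (hab : a = b), p = eqToHom hab →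
      p ≫ q = 𝟙 _ → q = eqToHom hab.symm := by
    rintro a b p q rfl rfl h
    simpa using h
  exact key _ _ _ e' e

/-- In the total category the pullback of a gluing arrow is the arrow that makes the square with the
canonical arrows commute. The composition constraints in `pullHom` are absorbed by `Tot.rest`. -/
lemma vert_pullHom {V₁ V₂ W W' : C} {M₁ : Sec Z V₁} {M₂ : Sec Z V₂} {f₁ : W ⟶ V₁} {f₂ : W ⟶ V₂}
    (φ : (res Z f₁).obj M₁ ⟶ (res Z f₂).obj M₂) (g : W' ⟶ W) (k₁ : W' ⟶ V₁) (k₂ : W' ⟶ V₂)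
    (h₁ : g ≫ f₁ = k₁) (h₂ : g ≫ f₂ = k₂) (ψ : (res Z k₁).obj M₁ ⟶ (res Z k₂).obj M₂)
    (hψ : Pseudofunctor.LocallyDiscreteOpToCat.pullHom (F := toPseudo Z) φ g k₁ k₂ h₁ h₂ = ψ) :
    Tot.vert ψ ≫ Tot.rest ⟨V₂, M₂⟩ f₂ g k₂ h₂ = Tot.rest ⟨V₁, M₁⟩ f₁ g k₁ h₁ ≫ Tot.vert φ := by
  have e1 := mapComp'_hom_app g f₁ k₁ h₁ (by rw [← h₁]; rfl) M₁
  have e2 := mapComp'_inv_app g f₂ k₂ h₂ (by rw [← h₂]; rfl) M₂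
  have key : ∀ (p : (res Z k₁).obj M₁ ⟶ (res Z g).obj ((res Z f₁).obj M₁))
    (q : (res Z g).obj ((res Z f₂).obj M₂) ⟶ (res Z k₂).obj M₂),
      p = eqToHom ((res_obj_congr Z h₁ M₁).symm.trans (res_comp_obj Z g f₁ M₁)) →
      q = eqToHom ((res_comp_obj Z g f₂ M₂).symm.trans (res_obj_congr Z h₂ M₂)) →
      p ≫ (res Z g).map φ ≫ q = ψ →
    Tot.vert ψ ≫ Tot.rest ⟨V₂, M₂⟩ f₂ g k₂ h₂ =
      Tot.rest ⟨V₁, M₁⟩ f₁ g k₁ h₁ ≫ Tot.vert φ := by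
    rintro _ _ rfl rfl rfl
    simp only [Tot.rest, Category.assoc, Tot.cart_vert]
    rw [← Tot.vert_comp_assoc, ← Tot.vert_comp_assoc]
    simp
  exact key _ _ e1 e2 hψ

/-- The arrows of a sieve. -/
abbrev CategoryTheory.Sieve.Idx {U : C} (S : Sieve U) := Σ V : C, {f : V ⟶ U // S f}

/-- Descent data for a sieve. -/
abbrev SieveDescent (Z : Cᵒᵖ ⥤ Grpd.{u, u}) {U : C} (S : Sieve U) :=
  (toPseudo Z).DescentData (fun q : S.Idx ↦ q.2.1)

namespace SieveDescent

variable {U : C} {S : Sieve U}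

/-- The objects of a descent datum. -/
def ob (D : SieveDescent Z S) {V : C} (f : V ⟶ U) (hf : S f) : Sec Z V := D.obj ⟨V, f, hf⟩

/-- The gluing isomorphisms of a descent datum. -/
def gl (D : SieveDescent Z S) {W V V' : C} (q : W ⟶ U) {f : V ⟶ U} (hf : S f) {f' : V' ⟶ U}
    (hf' : S f') (g : W ⟶ V) (g' : W ⟶ V') (h : g ≫ f = q) (h' : g' ≫ f' = q) :
    (res Z g).obj (D.ob f hf) ⟶ (res Z g').obj (D.ob f' hf') :=
  D.hom (i₁ := ⟨V, f, hf⟩) (i₂ := ⟨V', f', hf'⟩) q g g' h h'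

lemma gl_comp (D : SieveDescent Z S) {W V V' V'' : C} (q : W ⟶ U) {f : V ⟶ U} (hf : S f)
    {f' : V' ⟶ U} (hf' : S f') {f'' : V'' ⟶ U} (hf'' : S f'') (g : W ⟶ V) (g' : W ⟶ V')
    (g'' : W ⟶ V'') (h : g ≫ f = q) (h' : g' ≫ f' = q) (h'' : g'' ≫ f'' = q) :
    D.gl q hf hf' g g' h h' ≫ D.gl q hf' hf'' g' g'' h' h'' = D.gl q hf hf'' g g'' h h'' :=
  D.hom_comp (i₁ := ⟨V, f, hf⟩) (i₂ := ⟨V', f', hf'⟩) (i₃ := ⟨V'', f'', hf''⟩) q g g' g'' h h' h''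

lemma gl_pull (D : SieveDescent Z S) {W' W V V' : C} (e : W' ⟶ W) (q : W ⟶ U) (q' : W' ⟶ U)
    (hq : e ≫ q = q') {f : V ⟶ U} (hf : S f) {f' : V' ⟶ U}
    (hf' : S f') (g : W ⟶ V) (g' : W ⟶ V') (h : g ≫ f = q) (h' : g' ≫ f' = q)
    (k : W' ⟶ V) (k' : W' ⟶ V') (hk : e ≫ g = k) (hk' : e ≫ g' = k') :
    Tot.vert (D.gl q' hf hf' k k' (by rw [← hk, ← hq, ← h, Category.assoc])
      (by rw [← hk', ← hq, ← h', Category.assoc])) ≫ Tot.rest ⟨V', D.ob f' hf'⟩ g' e k' hk' =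
      Tot.rest ⟨V, D.ob f hf⟩ g e k hk ≫ Tot.vert (D.gl q hf hf' g g' h h') :=
  vert_pullHom _ _ _ _ _ _ _
    (D.pullHom_hom (i₁ := ⟨V, f, hf⟩) (i₂ := ⟨V', f', hf'⟩) e q q' hq g g' h h' k k' hk hk')

/-- The components of a morphism of descent data. -/
def mor {D D' : SieveDescent Z S} (φ : D ⟶ D') {V : C} (f : V ⟶ U) (hf : S f) :
    D.ob f hf ⟶ D'.ob f hf := φ.hom ⟨V, f, hf⟩

lemma mor_comm {D D' : SieveDescent Z S} (φ : D ⟶ D') {W V V' : C} (q : W ⟶ U) {f : V ⟶ U}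
    (hf : S f) {f' : V' ⟶ U} (hf' : S f') (g : W ⟶ V) (g' : W ⟶ V') (h : g ≫ f = q)
    (h' : g' ≫ f' = q) : (res Z g).map (mor φ f hf) ≫ D'.gl q hf hf' g g' h h' =
      D.gl q hf hf' g g' h h' ≫ (res Z g').map (mor φ f' hf') :=
  φ.comm (i₁ := ⟨V, f, hf⟩) (i₂ := ⟨V', f', hf'⟩) q g g' h h'

/-- A morphism of descent data from its components. -/
def mkMor {D D' : SieveDescent Z S} (t : ∀ {V : C} (f : V ⟶ U) (hf : S f), D.ob f hf ⟶ D'.ob f hf)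
    (ht : ∀ {W V V' : C} (q : W ⟶ U) {f : V ⟶ U} (hf : S f) {f' : V' ⟶ U} (hf' : S f')
      (g : W ⟶ V) (g' : W ⟶ V') (h : g ≫ f = q) (h' : g' ≫ f' = q),
      (res Z g).map (t f hf) ≫ D'.gl q hf hf' g g' h h' =
        D.gl q hf hf' g g' h h' ≫ (res Z g').map (t f' hf')) : D ⟶ D' where
  hom q := t q.2.1 q.2.2
  comm _ q i₁ i₂ g g' h h' := ht q i₁.2.2 i₂.2.2 g g' h h'

instance {D D' : SieveDescent Z S} (φ : D ⟶ D') : IsIso φ := by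
  refine ⟨mkMor (fun f hf ↦ inv (mor φ f hf)) ?_, ?_, ?_⟩
  · intro W V V' q f hf f' hf' g g' h h'
    rw [← cancel_mono ((res Z g').map (mor φ f' hf')), ← cancel_epi ((res Z g).map (mor φ f hf)),
      Category.assoc, Category.assoc, ← mor_comm φ]
    simp only [← Functor.map_comp, ← Functor.map_comp_assoc]
    simp
  · refine Pseudofunctor.DescentData.hom_ext ?_
    rintro ⟨V, f, hf⟩
    exact IsIso.hom_inv_id (mor φ f hf)
  · refine Pseudofunctor.DescentData.hom_ext ?_
    rintro ⟨V, f, hf⟩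
    exact IsIso.inv_hom_id (mor φ f hf)

/-- A descent datum from arrows of the total category. -/
def mk (z : ∀ ⦃V : C⦄ (f : V ⟶ U), S f → Sec Z V)
    (γ : ∀ {W V V' : C} (q : W ⟶ U) {f : V ⟶ U} (hf : S f) {f' : V' ⟶ U} (hf' : S f')
      (g : W ⟶ V) (g' : W ⟶ V') (_ : g ≫ f = q) (_ : g' ≫ f' = q),
      (res Z g).obj (z f hf) ⟶ (res Z g').obj (z f' hf'))
    (pull : ∀ {W' W V V' : C} (e : W' ⟶ W) (q : W ⟶ U) (q' : W' ⟶ U)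
      (hq : e ≫ q = q') {f : V ⟶ U} (hf : S f) {f' : V' ⟶ U}
      (hf' : S f') (g : W ⟶ V) (g' : W ⟶ V') (h : g ≫ f = q) (h' : g' ≫ f' = q)
      (k : W' ⟶ V) (k' : W' ⟶ V') (hk : e ≫ g = k) (hk' : e ≫ g' = k'),
      Tot.vert (γ q' hf hf' k k' (by rw [← hk, ← hq, ← h, Category.assoc])
        (by rw [← hk', ← hq, ← h', Category.assoc])) ≫ Tot.rest ⟨V', z f' hf'⟩ g' e k' hk' =
        Tot.rest ⟨V, z f hf⟩ g e k hk ≫ Tot.vert (γ q hf hf' g g' h h'))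
    (self : ∀ {W V : C} (q : W ⟶ U) {f : V ⟶ U} (hf : S f)
      (g : W ⟶ V) (h : g ≫ f = q), γ q hf hf g g h h = 𝟙 ((res Z g).obj (z f hf)))
    (comp : ∀ {W V V' V'' : C} (q : W ⟶ U) {f : V ⟶ U} (hf : S f)
      {f' : V' ⟶ U} (hf' : S f') {f'' : V'' ⟶ U} (hf'' : S f'') (g : W ⟶ V) (g' : W ⟶ V')
      (g'' : W ⟶ V'') (h : g ≫ f = q) (h' : g' ≫ f' = q) (h'' : g'' ≫ f'' = q),
      γ q hf hf' g g' h h' ≫ γ q hf' hf'' g' g'' h' h'' = γ q hf hf'' g g'' h h'') :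
    SieveDescent Z S where
  obj q := z q.2.1 q.2.2
  hom W q i₁ i₂ g g' h h' := γ q i₁.2.2 i₂.2.2 g g' h h'
  pullHom_hom W' W e q q' hq i₁ i₂ f₁ f₂ hf₁ hf₂ gf₁ gf₂ hgf₁ hgf₂ := by
    have h1 := vert_pullHom (γ q i₁.2.2 i₂.2.2 f₁ f₂ hf₁ hf₂) e gf₁ gf₂ hgf₁ hgf₂ _ rfl
    have h2 := pull e q q' hq i₁.2.2 i₂.2.2 f₁ f₂ hf₁ hf₂ gf₁ gf₂ hgf₁ hgf₂
    exact Tot.vert_injective (Tot.cancel _ rfl (h1.trans h2.symm))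
  hom_self W q i g h := self q i.2.2 g h
  hom_comp W q i₁ i₂ i₃ g g' g'' h h' h'' := comp q i₁.2.2 i₂.2.2 i₃.2.2 g g' g'' h h' h''

/-- The descent datum of an object. -/
abbrev ofSec (S : Sieve U) (M : Sec Z U) : SieveDescent Z S :=
  Pseudofunctor.DescentData.ofObj (F := toPseudo Z) M

/-- The canonical arrow from a restriction of `M`. -/
def leg (S : Sieve U) (M : Sec Z U) {V : C} (f : V ⟶ U) (hf : S f) :
    (⟨V, (ofSec S M).ob f hf⟩ : Tot Z) ⟶ ⟨U, M⟩ := Tot.cart ⟨U, M⟩ f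

@[simp] lemma leg_bs (M : Sec Z U) {V : C} (f : V ⟶ U) (hf : S f) :
    Tot.bs (leg S M f hf) = f := rfl

lemma ofSec_gl (M : Sec Z U) {W V V' : C} (q : W ⟶ U) {f : V ⟶ U}
    (hf : S f) {f' : V' ⟶ U} (hf' : S f') (g : W ⟶ V) (g' : W ⟶ V') (h : g ≫ f = q)
    (h' : g' ≫ f' = q) :
    Tot.vert ((ofSec S M).gl q hf hf' g g' h h') ≫
        Tot.cart ⟨V', (ofSec S M).ob f' hf'⟩ g' ≫ leg S M f' hf' =
      Tot.cart ⟨V, (ofSec S M).ob f hf⟩ g ≫ leg S M f hf := by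
  have e1 := mapComp'_inv_app g f q h (by rw [← h]; rfl) M
  have e2 := mapComp'_hom_app g' f' q h' (by rw [← h']; rfl) M
  have key : ∀ (p : (res Z g).obj ((res Z f).obj M) ⟶ (res Z q).obj M)
    (p' : (res Z q).obj M ⟶ (res Z g').obj ((res Z f').obj M)) (hp) (hp'),
      p = eqToHom hp → p' = eqToHom hp' →
      Tot.vert (p ≫ p') ≫ Tot.cart ⟨V', (res Z f').obj M⟩ g' ≫ Tot.cart ⟨U, M⟩ f' =
      Tot.cart ⟨V, (res Z f).obj M⟩ g ≫ Tot.cart ⟨U, M⟩ f := by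
    rintro _ _ hp hp' rfl rfl
    subst h
    have e : ∀ {k : W ⟶ U} (hk : k = g ≫ f), Tot.cart ⟨U, M⟩ k =
        Tot.vert (eqToHom (by rw [hk])) ≫ Tot.cart ⟨U, M⟩ (g ≫ f) := by
      rintro _ rfl; simp
    rw [Tot.cart_comp_cart ⟨U, M⟩ f g, Tot.cart_comp_cart ⟨U, M⟩ f' g', e h',
      ← Tot.vert_comp_assoc, ← Tot.vert_comp_assoc]
    simp
  exact key _ _ _ _ e1 e2

lemma gl_leg {D : SieveDescent Z S} {M : Sec Z U} (φ : D ⟶ ofSec S M) {W V V' : C} (q : W ⟶ U)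
    {f : V ⟶ U} (hf : S f) {f' : V' ⟶ U} (hf' : S f') (g : W ⟶ V) (g' : W ⟶ V') (h : g ≫ f = q)
    (h' : g' ≫ f' = q) :
    Tot.vert (D.gl q hf hf' g g' h h') ≫ Tot.cart ⟨V', D.ob f' hf'⟩ g' ≫
        Tot.vert (mor φ f' hf') ≫ leg S M f' hf' =
      Tot.cart ⟨V, D.ob f hf⟩ g ≫ Tot.vert (mor φ f hf) ≫ leg S M f hf := by
  have e1 := Tot.cart_vert g (mor φ f hf)
  have e2 := Tot.cart_vert g' (mor φ f' hf')
  rw [reassoc_of% e1, reassoc_of% e2, ← Tot.vert_comp_assoc, ← mor_comm φ, Tot.vert_comp_assoc, ofSec_gl M q hf hf' g g' h h']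

/-- The gluing arrow over `f'` starts at the restriction along `𝟙 W` of the object at `f'`, which
equals that object only propositionally. The cartesian arrow over `𝟙 W` is invertible, so it can be
divided out. -/
lemma exists_tr (D : SieveDescent Z S) {W V : C} (f' : W ⟶ U) (hf' : S f') (f : V ⟶ U) (hf : S f)
    (h : W ⟶ V) (e : h ≫ f = f') : ∃ t : (⟨W, D.ob f' hf'⟩ : Tot Z) ⟶ ⟨V, D.ob f hf⟩,
      Tot.bs t = h ∧ Tot.cart ⟨W, D.ob f' hf'⟩ (𝟙 W) ≫ t =
        Tot.vert (D.gl f' hf' hf (𝟙 W) h (Category.id_comp _) e) ≫ Tot.cart ⟨V, D.ob f hf⟩ h := by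
  have : IsIso (Tot.bs (Tot.cart ⟨W, D.ob f' hf'⟩ (𝟙 W))) := by
    rw [Tot.cart_bs]; exact inferInstanceAs (IsIso (𝟙 W))
  have := Tot.isIso_of_isIso_bs (Tot.cart ⟨W, D.ob f' hf'⟩ (𝟙 W))
  refine ⟨inv (Tot.cart ⟨W, D.ob f' hf'⟩ (𝟙 W)) ≫
    Tot.vert (D.gl f' hf' hf (𝟙 W) h (Category.id_comp _) e) ≫ Tot.cart ⟨V, D.ob f hf⟩ h, ?_, ?_⟩
  · have h1 : Tot.bs (inv (Tot.cart ⟨W, D.ob f' hf'⟩ (𝟙 W))) = 𝟙 W := by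
      have := congrArg Tot.bs (IsIso.hom_inv_id (Tot.cart ⟨W, D.ob f' hf'⟩ (𝟙 W)))
      rw [Tot.comp_bs, Tot.cart_bs] at this
      exact (Category.id_comp _).symm.trans this
    rw [Tot.comp_bs, Tot.comp_bs, h1, Tot.vert_bs, Tot.cart_bs]
    exact (Category.id_comp _).trans (Category.id_comp _)
  · rw [IsIso.hom_inv_id_assoc]

/-- The transition arrows of a descent datum. -/
noncomputable def tr (D : SieveDescent Z S) {W V : C} (f' : W ⟶ U) (hf' : S f') (f : V ⟶ U)
    (hf : S f) (h : W ⟶ V) (e : h ≫ f = f') : (⟨W, D.ob f' hf'⟩ : Tot Z) ⟶ ⟨V, D.ob f hf⟩ :=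
  (D.exists_tr f' hf' f hf h e).choose

lemma tr_bs (D : SieveDescent Z S) {W V : C} (f' : W ⟶ U) (hf' : S f') (f : V ⟶ U)
    (hf : S f) (h : W ⟶ V) (e : h ≫ f = f') : Tot.bs (D.tr f' hf' f hf h e) = h :=
  (D.exists_tr f' hf' f hf h e).choose_spec.1

lemma cart_tr (D : SieveDescent Z S) {W V : C} (f' : W ⟶ U) (hf' : S f') (f : V ⟶ U)
    (hf : S f) (h : W ⟶ V) (e : h ≫ f = f') :
    Tot.cart ⟨W, D.ob f' hf'⟩ (𝟙 W) ≫ D.tr f' hf' f hf h e =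
      Tot.vert (D.gl f' hf' hf (𝟙 W) h (Category.id_comp _) e) ≫ Tot.cart ⟨V, D.ob f hf⟩ h :=
  (D.exists_tr f' hf' f hf h e).choose_spec.2

lemma cart_tr_assoc (D : SieveDescent Z S) {W V : C} (f' : W ⟶ U) (hf' : S f') (f : V ⟶ U)
    (hf : S f) (h : W ⟶ V) (e : h ≫ f = f') {a : Tot Z} (k : (⟨V, D.ob f hf⟩ : Tot Z) ⟶ a) :
    Tot.cart ⟨W, D.ob f' hf'⟩ (𝟙 W) ≫ D.tr f' hf' f hf h e ≫ k =
      Tot.vert (D.gl f' hf' hf (𝟙 W) h (Category.id_comp _) e) ≫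
        Tot.cart ⟨V, D.ob f hf⟩ h ≫ k := by
  rw [← Category.assoc, D.cart_tr, Category.assoc]

lemma cart_id_cancel {W : C} {z : Sec Z W} {y : Tot Z} {a b : (⟨W, z⟩ : Tot Z) ⟶ y}
    (h : Tot.cart ⟨W, z⟩ (𝟙 W) ≫ a = Tot.cart ⟨W, z⟩ (𝟙 W) ≫ b) : a = b := by
  have : IsIso (Tot.bs (Tot.cart ⟨W, z⟩ (𝟙 W))) := by
    rw [Tot.cart_bs]; exact inferInstanceAs (IsIso (𝟙 W))
  have := Tot.isIso_of_isIso_bs (Tot.cart ⟨W, z⟩ (𝟙 W))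
  exact (cancel_epi _).1 h

lemma cart_tr' (D : SieveDescent Z S) {W' W V : C} (f' : W ⟶ U) (hf' : S f') (f : V ⟶ U)
    (hf : S f) (h : W ⟶ V) (e : h ≫ f = f') (h' : W' ⟶ W) (q : W' ⟶ U) (hq : h' ≫ f' = q) :
    Tot.cart ⟨W, D.ob f' hf'⟩ h' ≫ D.tr f' hf' f hf h e =
      Tot.vert (D.gl q hf' hf h' (h' ≫ h) hq (by rw [Category.assoc, e, hq])) ≫
        Tot.cart ⟨V, D.ob f hf⟩ (h' ≫ h) := by
  have h1 := D.gl_pull h' f' q hq hf' hf (𝟙 W) h (Category.id_comp _) e h' (h' ≫ h)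
    (Category.comp_id _) rfl
  have h2 := Tot.rest_cart ⟨V, D.ob f hf⟩ h h' (h' ≫ h) rfl
  have h3 := Tot.rest_cart ⟨W, D.ob f' hf'⟩ (𝟙 W) h' h' (Category.comp_id _)
  rw [← h2, reassoc_of% h1, ← cart_tr, reassoc_of% h3]

lemma tr_comp (D : SieveDescent Z S) {W' W V : C} (f'' : W' ⟶ U) (hf'' : S f'') (f' : W ⟶ U)
    (hf' : S f') (f : V ⟶ U) (hf : S f) (h' : W' ⟶ W) (h : W ⟶ V) (e' : h' ≫ f' = f'')
    (e : h ≫ f = f') : D.tr f'' hf'' f' hf' h' e' ≫ D.tr f' hf' f hf h e =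
      D.tr f'' hf'' f hf (h' ≫ h) (by rw [Category.assoc, e, e']) := by
  refine cart_id_cancel ?_
  rw [cart_tr_assoc, cart_tr, cart_tr' D f' hf' f hf h e h' f'' e', ← Tot.vert_comp_assoc,
    gl_comp]

/-- As `q` itself lies in the sieve, the gluing arrow from `f` to `f'` can be routed through the
object at `q`; both halves are transition arrows, with which the legs are compatible. -/
lemma gl_cocone (D : SieveDescent Z S) {z : Tot Z}
    (κ : ∀ ⦃V : C⦄ (f : V ⟶ U) (hf : S f), (⟨V, D.ob f hf⟩ : Tot Z) ⟶ z)
    (hκ : ∀ ⦃W V : C⦄ (f' : W ⟶ U) (hf' : S f') (f : V ⟶ U) (hf : S f) (h : W ⟶ V)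
      (e : h ≫ f = f'), D.tr f' hf' f hf h e ≫ κ f hf = κ f' hf')
    {W V V' : C} (q : W ⟶ U)
    {f : V ⟶ U} (hf : S f) {f' : V' ⟶ U} (hf' : S f') (g : W ⟶ V) (g' : W ⟶ V') (h : g ≫ f = q)
    (h' : g' ≫ f' = q) :
    Tot.vert (D.gl q hf hf' g g' h h') ≫ Tot.cart ⟨V', D.ob f' hf'⟩ g' ≫ κ f' hf' =
      Tot.cart ⟨V, D.ob f hf⟩ g ≫ κ f hf := by
  have hq : S q := h ▸ S.downward_closed hf g
  have h1 := congrArg (Tot.cart ⟨W, D.ob q hq⟩ (𝟙 W) ≫ ·) (hκ q hq f hf g h)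
  have h2 := congrArg (Tot.cart ⟨W, D.ob q hq⟩ (𝟙 W) ≫ ·) (hκ q hq f' hf' g' h')
  rw [cart_tr_assoc] at h1 h2
  rw [← h2, ← D.gl_comp q hq hf hf' (𝟙 W) g g' (Category.id_comp _) h h',
    Tot.vert_comp_assoc] at h1
  have h3 := congrArg (Tot.vert (inv (D.gl q hq hf (𝟙 W) g (Category.id_comp _) h)) ≫ ·) h1
  rw [Tot.vert_inv_assoc, Tot.vert_inv_assoc] at h3
  exact h3.symm

end SieveDescent

open SieveDescent

variable {J : GrothendieckTopology C}

/-- The functor to descent data for a sieve. -/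
abbrev toSieveDescent (Z : Cᵒᵖ ⥤ Grpd.{u, u}) {U : C} (S : Sieve U) :
    Sec Z U ⥤ SieveDescent Z S :=
  (toPseudo Z).toDescentData (fun q : S.Idx ↦ q.2.1)

lemma ofArrows_idx {U : C} (S : Sieve U) :
    Sieve.ofArrows _ (fun q : S.Idx ↦ q.2.1) = S := by
  ext V f
  constructor
  · rintro ⟨_, g, _, ⟨q⟩, rfl⟩
    exact S.downward_closed q.2.2 g
  · intro hf
    exact ⟨V, 𝟙 V, f, ⟨(⟨V, f, hf⟩ : S.Idx)⟩, Category.id_comp _⟩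

/-- A sieve is generated by the family of all its arrows, so it is enough to test descent on these
families. -/
lemma isStack_iff_toSieveDescent : (toPseudo Z).IsStack J ↔
    ∀ (U : C) (S : Sieve U) (_ : S ∈ J U), (toSieveDescent Z S).IsEquivalence := by
  constructor
  · intro h U S hS
    exact (toPseudo Z).isEquivalence_toDescentData _ (by rwa [ofArrows_idx])
  · intro h
    refine Pseudofunctor.IsStack.of_isStackFor fun U S hS ↦ ?_
    have := ((toPseudo Z).isStackFor_ofArrows_iff (fun q : S.Idx ↦ q.2.1)).2 (h U S hS)
    rw [← Pseudofunctor.IsStackFor_generate_iff] at this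
    exact (congrArg (fun R : Sieve U ↦ (toPseudo Z).IsStackFor R.arrows) (ofArrows_idx S)).mp this

lemma cart_vert_leg {U : C} {S : Sieve U} {M M' : Sec Z U} (m : M ⟶ M') {V : C} (f : V ⟶ U)
    (hf : S f) : leg S M f hf ≫ Tot.vert m =
      Tot.vert (mor ((toSieveDescent Z S).map m) f hf) ≫ leg S M' f hf :=
  Tot.cart_vert f m

lemma exists_vat_leg {U : C} {S : Sieve U} {M : Sec Z U} {v : Tot Z} (r : v ⟶ ⟨U, M⟩)
    (hr : S (Tot.bs r)) : ∃ m : v ⟶ ⟨v.base, (ofSec S M).ob (Tot.bs r) hr⟩,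
      Tot.bs m = 𝟙 _ ∧ m ≫ leg S M (Tot.bs r) hr = r :=
  Tot.exists_lift _ _ _ (by rw [leg_bs]; exact Category.id_comp _)

lemma TotStack.toSieveDescent_faithful (hZ : TotStack J Z) {U : C} {S : Sieve U} (hS : S ∈ J U) :
    (toSieveDescent Z S).Faithful where
  map_injective {M M' m m'} h := Tot.vert_injective (hZ.sep ⟨U, M⟩ ⟨U, M'⟩ _ _ rfl
    ⟨S, hS, fun V f hf ↦ (cart_vert_leg m f hf).trans (Eq.trans (by rw [h])
      (cart_vert_leg m' f hf).symm)⟩)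

/-- A morphism of descent data yields arrows `κ f` from the restrictions of `M` to `M'`. Its
commutation with the gluing arrows makes them compatible, so they glue to an arrow `M ⟶ M'`. -/
lemma TotStack.toSieveDescent_full (hZ : TotStack J Z) {U : C} {S : Sieve U} (hS : S ∈ J U) :
    (toSieveDescent Z S).Full where
  map_surjective {M M'} := show ∀ φ : ofSec S M ⟶ ofSec S M', _ from fun φ ↦ by
    obtain ⟨κ, hκ⟩ : ∃ κ : ∀ ⦃V : C⦄ (f : V ⟶ U) (hf : S f),
        (⟨V, (ofSec S M).ob f hf⟩ : Tot Z) ⟶ ⟨U, M'⟩,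
        ∀ ⦃V : C⦄ (f : V ⟶ U) (hf : S f), κ f hf = Tot.vert (mor φ f hf) ≫ leg S M' f hf :=
      ⟨_, fun _ _ _ ↦ rfl⟩
    have hκb : ∀ ⦃V : C⦄ (f : V ⟶ U) (hf : S f), Tot.bs (κ f hf) = f := fun V f hf ↦ by
      rw [hκ, Tot.comp_bs, Tot.vert_bs, leg_bs]; exact Category.id_comp _
    have key : ∀ ⦃W V : C⦄ (f' : W ⟶ U) (hf' : S f') (f : V ⟶ U) (hf : S f) (h : W ⟶ V)
        (_ : h ≫ f = f') (t : (⟨W, (ofSec S M).ob f' hf'⟩ : Tot Z) ⟶ ⟨V, (ofSec S M).ob f hf⟩),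
        Tot.bs t = h → t ≫ leg S M f hf = leg S M f' hf' → t ≫ κ f hf = κ f' hf' := by
      intro W V f' hf' f hf h e t ht htl
      refine cart_id_cancel ?_
      have h1 := gl_leg φ f' hf' hf (𝟙 W) h (Category.id_comp _) e
      have h2 := ofSec_gl M f' hf' hf (𝟙 W) h (Category.id_comp _) e
      have h3 : Tot.cart ⟨W, (ofSec S M).ob f' hf'⟩ (𝟙 W) ≫ t =
          Tot.vert ((ofSec S M).gl f' hf' hf (𝟙 W) h (Category.id_comp _) e) ≫
            Tot.cart ⟨V, (ofSec S M).ob f hf⟩ h := by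
        refine Tot.cancel (leg S M f hf) ?_ ?_
        · rw [Tot.comp_bs, Tot.comp_bs, ht]; rfl
        · rw [Category.assoc, htl, Category.assoc, h2]
      rw [reassoc_of% h3, hκ, hκ, h1]
    choose m hm hml using fun (v : Tot Z) (r : v ⟶ ⟨U, M⟩) (hr : S (Tot.bs r)) ↦
      exists_vat_leg r hr
    obtain ⟨h, hb, hh⟩ := hZ.glue ⟨U, M⟩ ⟨U, M'⟩ (𝟙 U) S hS (fun v r hr ↦ m v r hr ≫ κ _ hr)
      (fun v r hr ↦ by
        refine (Tot.comp_bs _ _).trans ((congrArg₂ (· ≫ ·) (hm v r hr) (hκb _ hr)).trans ?_)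
        exact (Category.id_comp _).trans (Category.comp_id _).symm) (by
      intro w v s r hr hsr
      obtain ⟨t, ht, htl⟩ := Tot.exists_lift (leg S M (Tot.bs (s ≫ r)) hsr) (leg S M (Tot.bs r) hr)
        (Tot.bs (a := w) (b := v) s) ((congrArg (Tot.bs (a := w) (b := v) s ≫ ·) (leg_bs _ _ hr)).trans
          ((Tot.comp_bs _ _).symm.trans (leg_bs _ _ hsr).symm))
      have h1 : m w (s ≫ r) hsr ≫ t = s ≫ m v r hr := by
        refine Tot.cancel (leg S M (Tot.bs r) hr) ?_ ?_
        · refine (Tot.comp_bs _ _).trans (Eq.trans ?_ (Tot.comp_bs _ _).symm)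
          refine (congrArg₂ (· ≫ ·) (hm _ _ hsr) ht).trans (Eq.trans ?_
            (congrArg (Tot.bs (a := w) (b := v) s ≫ ·) (hm _ _ hr)).symm)
          exact (Category.id_comp _).trans (Category.comp_id _).symm
        · rw [Category.assoc, htl, hml, Category.assoc, hml]
      rw [← Category.assoc, ← h1, Category.assoc, key _ hsr _ hr (Tot.bs s) rfl t ht htl])
    obtain ⟨a, ha⟩ := Tot.exists_vert h hb
    refine ⟨a, Pseudofunctor.DescentData.hom_ext ?_⟩
    rintro ⟨V, f, hf⟩
    change mor ((toSieveDescent Z S).map a) f hf = mor φ f hf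
    refine Tot.vert_injective (Tot.cancel (leg S M' f hf) rfl ?_)
    refine ((cart_vert_leg _ f hf).symm.trans ((congrArg _ ha).trans ?_)).trans (hκ f hf)
    refine (hh _ (leg S M f hf) hf).trans ?_
    have h2 : m _ (leg S M f hf) hf = 𝟙 _ :=
      Tot.cancel (leg S M f hf) (hm _ _ _) ((hml _ _ _).trans (Category.id_comp _).symm)
    rw [h2]
    exact Category.id_comp _

/-- The transition arrows of `D` have a cocone with vertex `M` by effectivity. Its legs factor
through the cartesian arrows to `M`, and the vertical parts identify `D` with the descent datum of
`M`. -/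
lemma TotStack.toSieveDescent_essSurj (hZ : TotStack J Z) {U : C} {S : Sieve U} (hS : S ∈ J U) :
    (toSieveDescent Z S).EssSurj where
  mem_essImage D := by
    obtain ⟨M, κ, hκb, hκ⟩ := hZ.desc U S hS (fun _ f hf ↦ D.ob f hf)
      (fun _ _ f' hf' f hf h e ↦ D.tr f' hf' f hf h e)
      (fun _ _ f' hf' f hf h e ↦ D.tr_bs f' hf' f hf h e) (by
        intro _ _ _ f'' hf'' f' hf' f hf h' h e' e
        exact D.tr_comp f'' hf'' f' hf' f hf h' h e' e)
    choose l hl hl' using fun {V : C} (f : V ⟶ U) (hf : S f) ↦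
      Tot.exists_lift (κ f hf) (leg S M f hf) (𝟙 _) (by
        rw [leg_bs, hκb]; exact Category.id_comp _)
    choose n hn using fun {V : C} (f : V ⟶ U) (hf : S f) ↦ Tot.exists_vert (l f hf) (hl f hf)
    let φ : D ⟶ ofSec S M := mkMor n (by
      intro W V V' q f hf f' hf' g g' h h'
      refine Tot.vert_injective (Tot.cancel (Tot.cart ⟨V', (ofSec S M).ob f' hf'⟩ g' ≫ leg S M f' hf')
        rfl ?_)
      have h1 := Tot.cart_vert g (n f hf)
      have h2 := Tot.cart_vert g' (n f' hf')
      rw [Tot.vert_comp_assoc, ofSec_gl, ← reassoc_of% h1, Tot.vert_comp_assoc, ← reassoc_of% h2,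
        hn, hn, hl', hl', D.gl_cocone κ hκ])
    exact ⟨M, ⟨(asIso φ).symm⟩⟩

/-- Replacing `z'` by its restriction `M'` along `g` makes the problem vertical. The vertical parts
of the given arrows on the legs of `M` are a morphism of descent data, which comes from an arrow `M
⟶ M'` by fullness. -/
lemma IsStack.glue (h : ∀ (U : C) (S : Sieve U) (_ : S ∈ J U), (toSieveDescent Z S).IsEquivalence)
    (z z' : Tot Z) (g : z.base ⟶ z'.base) (S : Sieve z.base) (hS : S ∈ J z.base)
    (β : ∀ (v : Tot Z) (r : v ⟶ z), S (Tot.bs r) → (v ⟶ z'))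
    (hβ : ∀ v r hr, Tot.bs (β v r hr) = Tot.bs r ≫ g)
    (compat : ∀ (w v : Tot Z) (s : w ⟶ v) (r : v ⟶ z) (hr : S (Tot.bs r))
      (hsr : S (Tot.bs (s ≫ r))), β w (s ≫ r) hsr = s ≫ β v r hr) :
    ∃ h : z ⟶ z', Tot.bs h = g ∧ ∀ v r hr, r ≫ h = β v r hr := by
  obtain ⟨U, M⟩ := z
  obtain ⟨M', c, hc⟩ : ∃ (M' : Sec Z U) (c : (⟨U, M'⟩ : Tot Z) ⟶ z'), Tot.bs c = g :=
    ⟨_, Tot.cart z' g, rfl⟩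
  choose l hl hl' using fun {V : C} (f : V ⟶ U) (hf : S f) ↦
    Tot.exists_lift (β _ (leg S M f hf) hf) (leg S M' f hf ≫ c) (𝟙 V) (by
      refine Eq.trans ?_ (hβ _ _ _).symm
      rw [Tot.comp_bs, leg_bs, hc]; exact Category.id_comp _)
  choose n hn using fun {V : C} (f : V ⟶ U) (hf : S f) ↦ Tot.exists_vert (l f hf) (hl f hf)
  let φ : ofSec S M ⟶ ofSec S M' := mkMor n (by
    intro W V V' q f hf f' hf' g₁ g₁' h₁ h₁'
    refine Tot.vert_injective (Tot.cancel
      (Tot.cart ⟨V', (ofSec S M').ob f' hf'⟩ g₁' ≫ leg S M' f' hf' ≫ c) rfl ?_)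
    have h1 := Tot.cart_vert g₁ (n f hf)
    have h2 := Tot.cart_vert g₁' (n f' hf')
    have h3 := ofSec_gl M' q hf hf' g₁ g₁' h₁ h₁'
    have h4 := ofSec_gl M q hf hf' g₁ g₁' h₁ h₁'
    have hq : S (g₁ ≫ f) := S.downward_closed hf g₁
    have hq' : S (g₁' ≫ f') := S.downward_closed hf' g₁'
    have h5 : ∀ {v : Tot Z} {r r' : v ⟶ ⟨U, M⟩} (_ : r = r') (hr hr'), β v r hr = β v r' hr' := by
      rintro v r _ rfl _ _; rfl
    rw [Tot.vert_comp_assoc, reassoc_of% h3, ← reassoc_of% h1, Tot.vert_comp_assoc,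
      ← reassoc_of% h2, hn, hn, hl', hl', ← compat _ _ (Tot.cart ⟨V, _⟩ g₁) (leg S M f hf) hf (by rw [Tot.comp_bs]; exact hq),
      ← compat _ _ (Tot.cart ⟨V', _⟩ g₁') (leg S M f' hf') hf' (by rw [Tot.comp_bs]; exact hq')]
    have hq'' : S (𝟙 W ≫ g₁' ≫ f') := by rwa [Category.id_comp]
    exact (h5 h4.symm _ _).trans (compat _ _ (Tot.vert ((ofSec S M).gl q hf hf' g₁ g₁' h₁ h₁'))
      (Tot.cart ⟨V', _⟩ g₁' ≫ leg S M f' hf') hq' hq''))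
  have := h U S hS
  obtain ⟨m, hm⟩ := (toSieveDescent Z S).map_surjective φ
  refine ⟨Tot.vert m ≫ c, by rw [Tot.comp_bs, hc, Tot.vert_bs]; exact Category.id_comp _,
    fun v r hr ↦ ?_⟩
  obtain ⟨a, ha, har⟩ := exists_vat_leg r hr
  have h1 := cart_vert_leg m (Tot.bs r) hr
  have h2 : mor ((toSieveDescent Z S).map m) (Tot.bs r) hr = n (Tot.bs r) hr := by
    rw [hm]; rfl
  have h5 : ∀ {v : Tot Z} {r r' : v ⟶ ⟨U, M⟩} (_ : r = r') (hr hr'), β v r hr = β v r' hr' := by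
    rintro v r _ rfl _ _; rfl
  rw [← h5 har (by rwa [har]) hr, compat _ _ a (leg S M (Tot.bs r) hr) hr, ← hl', ← hn, ← h2]
  refine (congrArg (· ≫ Tot.vert m ≫ c) har).symm.trans ((Category.assoc _ _ _).trans ?_)
  exact congrArg (a ≫ ·) ((Category.assoc _ _ _).symm.trans
    ((congrArg (· ≫ c) h1).trans (Category.assoc _ _ _)))

lemma IsStack.sep (h : ∀ (U : C) (S : Sieve U) (_ : S ∈ J U), (toSieveDescent Z S).IsEquivalence)
    (z z' : Tot Z) (k k' : z ⟶ z') (hb : Tot.bs k = Tot.bs k')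
    (loc : Loc J z.base (fun _ f ↦ Tot.cart z f ≫ k = Tot.cart z f ≫ k')) : k = k' := by
  obtain ⟨S, hS, H⟩ := loc
  have := h _ S hS
  have h1 := Tot.vert_cart k hb
  have h2 := Tot.vert_cart k' rfl
  suffices e : Tot.vat k _ hb = Tot.vat k' _ rfl from
    h1.symm.trans ((congrArg (fun a ↦ Tot.vert a ≫ _) e).trans h2)
  refine (toSieveDescent Z S).map_injective (Pseudofunctor.DescentData.hom_ext ?_)
  rintro ⟨V, f, hf⟩
  refine Tot.vert_injective (Tot.cancel (leg S _ f hf) rfl ?_)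
  refine (cart_vert_leg _ f hf).symm.trans (Eq.trans ?_ (cart_vert_leg _ f hf))
  refine Tot.cancel (Tot.cart z' (Tot.bs k')) rfl ?_
  rw [Category.assoc, Category.assoc, h1, h2]
  exact H f hf

lemma IsStack.desc (hst : ∀ (U : C) (S : Sieve U) (_ : S ∈ J U), (toSieveDescent Z S).IsEquivalence)
    (U : C) (S : Sieve U) (hS : S ∈ J U) (z : ∀ ⦃V : C⦄ (f : V ⟶ U), S f → Sec Z V)
    (t : ∀ ⦃W V : C⦄ (f' : W ⟶ U) (hf' : S f') (f : V ⟶ U) (hf : S f) (h : W ⟶ V),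
      h ≫ f = f' → ((⟨W, z f' hf'⟩ : Tot Z) ⟶ ⟨V, z f hf⟩))
    (ht : ∀ ⦃W V : C⦄ (f' : W ⟶ U) (hf' : S f') (f : V ⟶ U) (hf : S f) (h : W ⟶ V)
      (e : h ≫ f = f'), Tot.bs (t f' hf' f hf h e) = h)
    (comp : ∀ ⦃W' W V : C⦄ (f'' : W' ⟶ U) (hf'' : S f'') (f' : W ⟶ U) (hf' : S f') (f : V ⟶ U)
      (hf : S f) (h' : W' ⟶ W) (h : W ⟶ V) (e' : h' ≫ f' = f'') (e : h ≫ f = f'),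
      t f'' hf'' f' hf' h' e' ≫ t f' hf' f hf h e =
        t f'' hf'' f hf (h' ≫ h) (by rw [Category.assoc, e, e'])) :
    ∃ (z₀ : Sec Z U) (κ : ∀ ⦃V : C⦄ (f : V ⟶ U) (hf : S f), (⟨V, z f hf⟩ : Tot Z) ⟶ ⟨U, z₀⟩),
      (∀ ⦃V : C⦄ (f : V ⟶ U) (hf : S f), Tot.bs (κ f hf) = f) ∧
      ∀ ⦃W V : C⦄ (f' : W ⟶ U) (hf' : S f') (f : V ⟶ U) (hf : S f) (h : W ⟶ V) (e : h ≫ f = f'),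
        t f' hf' f hf h e ≫ κ f hf = κ f' hf' := by
  choose l hl hl' using fun {W V : C} (f' : W ⟶ U) (hf' : S f') (f : V ⟶ U) (hf : S f) (h : W ⟶ V)
      (e : h ≫ f = f') ↦
    Tot.exists_lift (t f' hf' f hf h e) (Tot.cart ⟨V, z f hf⟩ h) (𝟙 W) (by
      rw [ht, Tot.cart_bs]; exact Category.id_comp _)
  choose a ha using fun {W V : C} (f' : W ⟶ U) (hf' : S f') (f : V ⟶ U) (hf : S f) (h : W ⟶ V)
      (e : h ≫ f = f') ↦ Tot.exists_vert (l f' hf' f hf h e) (hl f' hf' f hf h e)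
  replace ha : ∀ {W V : C} (f' : W ⟶ U) (hf' : S f') (f : V ⟶ U) (hf : S f) (h : W ⟶ V)
      (e : h ≫ f = f'), Tot.vert (a f' hf' f hf h e) ≫ Tot.cart ⟨V, z f hf⟩ h =
        t f' hf' f hf h e := fun f' hf' f hf h e ↦ by rw [ha, hl']
  have hS' : ∀ {W V : C} {q : W ⟶ U} {f : V ⟶ U} (_ : S f) (g : W ⟶ V) (_ : g ≫ f = q), S q := by
    rintro W V q f hf g rfl
    exact S.downward_closed hf g
  have epi : ∀ {U : C} {x y : Sec Z U} (m : x ⟶ y) {w : Tot Z} {p q : (⟨U, y⟩ : Tot Z) ⟶ w},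
      Tot.vert m ≫ p = Tot.vert m ≫ q → p = q := by
    intro U x y m w p q hpq
    have := congrArg (Tot.vert (inv m) ≫ ·) hpq
    simpa only [Tot.vert_inv_assoc] using this
  -- The transition over an identity is not assumed to be an identity; it is idempotent, and arrows
  -- can be cancelled.
  have tid : ∀ {V : C} (f : V ⟶ U) (hf : S f), t f hf f hf (𝟙 V) (Category.id_comp _) = 𝟙 _ := by
    intro V f hf
    have h1 := comp f hf f hf f hf (𝟙 V) (𝟙 V) (Category.id_comp _) (Category.id_comp _)
    simp only [Category.comp_id] at h1
    exact Tot.cancel _ (ht _ _ _ _ _ _) (h1.trans (Category.id_comp _).symm)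
  -- A `q` that factors through the sieve belongs to it, so the gluing isomorphism over `q` can pass
  -- through the object `z q`: back along the vertical part of one transition arrow and forward
  -- along that of the other.
  let D : SieveDescent Z S := SieveDescent.mk z
    (fun {W V V'} q f hf f' hf' g g' h h' ↦ inv (a q (hS' hf g h) f hf g h) ≫
      a q (hS' hf g h) f' hf' g' h') (by
    intro W' W V V' e q q' hq f hf f' hf' g g' h h' k k' hk hk'
    have hSq := hS' hf g h
    have hSq' := hS' hSq e hq
    have hkf : k ≫ f = q' := by rw [← hk, Category.assoc, h, hq]
    have h1 : Tot.vert (a q' hSq' f hf k hkf) ≫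
        Tot.rest ⟨V, z f hf⟩ g e k hk =
        t q' hSq' q hSq e hq ≫ Tot.vert (a q hSq f hf g h) := by
      refine Tot.cancel (Tot.cart ⟨V, z f hf⟩ g) ?_ ?_
      · rw [Tot.comp_bs, Tot.comp_bs, ht, Tot.rest_bs, Tot.vert_bs, Tot.vert_bs]
        exact (Category.id_comp _).trans (Category.comp_id _).symm
      · rw [Category.assoc, Tot.rest_cart, Category.assoc, ha, ha, comp]
        subst hk; rfl
    refine epi (a q' hSq' f hf k hkf) ?_
    rw [Tot.vert_comp, Tot.vert_comp, Category.assoc, Tot.vert_inv_comp_assoc, reassoc_of% h1,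
      Tot.vert_inv_comp_assoc]
    refine Tot.cancel (Tot.cart ⟨V', z f' hf'⟩ g') ?_ ?_
    · rw [Tot.comp_bs, Tot.comp_bs, ht, Tot.rest_bs, Tot.vert_bs, Tot.vert_bs]
      exact (Category.id_comp _).trans (Category.comp_id _).symm
    · refine (Category.assoc _ _ _).trans (Eq.trans ?_ (Category.assoc _ _ _).symm)
      rw [Tot.rest_cart, ha, ha, comp]
      subst hk'; rfl)
    (fun {W V} q f hf g h ↦ IsIso.inv_hom_id _)
    (fun {W V V' V''} q f hf f' hf' f'' hf'' g g' g'' h h' h'' ↦ by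
      rw [Category.assoc, IsIso.hom_inv_id_assoc])
  have hD : ∀ {W V V' : C} (q : W ⟶ U) (hq : S q) {f : V ⟶ U} (hf : S f) {f' : V' ⟶ U} (hf' : S f')
      (g : W ⟶ V) (g' : W ⟶ V') (h : g ≫ f = q) (h' : g' ≫ f' = q),
      Tot.vert (a q hq f hf g h) ≫ Tot.vert (D.gl q hf hf' g g' h h') =
        Tot.vert (a q hq f' hf' g' h') := fun {W V V'} q hq f hf f' hf' g g' h h' ↦ by
    exact (Tot.vert_comp (a q hq f hf g h) (inv (a q hq f hf g h) ≫ a q hq f' hf' g' h')).symm.trans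
      (congrArg Tot.vert (IsIso.hom_inv_id_assoc _ _))
  have := hst U S hS
  let M := (toSieveDescent Z S).objPreimage D
  let φ : D ⟶ ofSec S M := ((toSieveDescent Z S).objObjPreimageIso D).inv
  refine ⟨M, fun V f hf ↦ Tot.vert (mor φ f hf) ≫ leg S M f hf, fun V f hf ↦ by
    rw [Tot.comp_bs, leg_bs]; exact Category.id_comp _, ?_⟩
  intro W V f' hf' f hf h e
  have h1 := gl_leg φ f' hf' hf (𝟙 W) h (Category.id_comp _) e
  have h2 := hD f' hf' hf' hf (𝟙 W) h (Category.id_comp _) e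
  have h3 := ha f' hf' f hf h e
  have h4 := ha f' hf' f' hf' (𝟙 W) (Category.id_comp _)
  rw [tid] at h4
  refine (congrArg (· ≫ _) h3).symm.trans ((Category.assoc _ _ _).trans ?_)
  refine (congrArg (· ≫ _) h2).symm.trans ((Category.assoc _ _ _).trans ?_)
  refine (congrArg (_ ≫ ·) h1).trans ((Category.assoc _ _ _).symm.trans ?_)
  exact (congrArg (· ≫ _) h4).trans (Category.id_comp _)

/-- The stack conditions for the pseudofunctor and for the total category agree. -/
theorem isStack_iff_totStack : (toPseudo Z).IsStack J ↔ TotStack J Z := by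
  rw [isStack_iff_toSieveDescent]
  constructor
  · intro h
    exact ⟨IsStack.sep h, IsStack.glue h, IsStack.desc h⟩
  · intro hZ U S hS
    have := hZ.toSieveDescent_faithful hS
    have := hZ.toSieveDescent_full hS
    have := hZ.toSieveDescent_essSurj hS
    exact {}

end

/-! ### From gluing of objects and arrows to the strict sheaf condition. -/

section Sheaf

variable {C : Type u} [SmallCategory C] {J : GrothendieckTopology C} {Z : Cᵒᵖ ⥤ Grpd.{u, u}}

/-- The objects of a presheaf of groupoids form a sheaf of sets. -/
def GluesObjects (J : GrothendieckTopology C) (Z : Cᵒᵖ ⥤ Grpd.{u, u}) : Prop :=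
  ∀ (U : C) (S : Sieve U) (_ : S ∈ J U) (z : ∀ ⦃V : C⦄ (f : V ⟶ U), S f → Sec Z V),
    (∀ ⦃W V : C⦄ (g : W ⟶ V) (f : V ⟶ U) (hf : S f) (hg : S (g ≫ f)),
      (res Z g).obj (z f hf) = z (g ≫ f) hg) →
    ∃! z₀ : Sec Z U, ∀ ⦃V : C⦄ (f : V ⟶ U) (hf : S f), (res Z f).obj z₀ = z f hf

lemma TotStack.sep_vert (hZ : TotStack J Z) {U : C} {S : Sieve U} (hS : S ∈ J U) {x y : Sec Z U}
    {m m' : x ⟶ y} (h : ∀ ⦃V : C⦄ (f : V ⟶ U), S f → (res Z f).map m = (res Z f).map m') :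
    m = m' :=
  Tot.vert_injective (hZ.sep _ _ _ _ rfl ⟨S, hS, fun _ f hf ↦
    (Tot.cart_vert f m).trans ((congrArg (fun a ↦ Tot.vert a ≫ _) (h f hf)).trans
      (Tot.cart_vert f m').symm)⟩)

lemma TotStack.glue_vert (hZ : TotStack J Z) {U : C} {S : Sieve U} (hS : S ∈ J U) {x y : Sec Z U}
    (m : ∀ ⦃V : C⦄ (f : V ⟶ U), S f → ((res Z f).obj x ⟶ (res Z f).obj y))
    (hm : ∀ ⦃W V : C⦄ (g : W ⟶ V) (f : V ⟶ U) (hf : S f) (hg : S (g ≫ f)),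
      (res Z g).map (m f hf) = eqToHom (res_comp_obj Z g f x).symm ≫ m (g ≫ f) hg ≫
        eqToHom (res_comp_obj Z g f y)) :
    ∃ m₀ : x ⟶ y, ∀ ⦃V : C⦄ (f : V ⟶ U) (hf : S f), (res Z f).map m₀ = m f hf := by
  obtain ⟨h, hb, hh⟩ := hZ.glue_family (z := ⟨U, x⟩) (z' := ⟨U, y⟩) (𝟙 U)
    (fun q : Σ V : C, {f : V ⟶ U // S f} ↦ ⟨q.1, (res Z q.2.1).obj x⟩)
    (fun q ↦ Tot.cart ⟨U, x⟩ q.2.1) (fun q ↦ Tot.vert (m q.2.1 q.2.2) ≫ Tot.cart ⟨U, y⟩ q.2.1)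
    (fun q ↦ (Category.id_comp _).trans (Category.comp_id _).symm)
    ⟨S, hS, fun V f hf ↦ ⟨⟨V, f, hf⟩, 𝟙 _, Category.id_comp _⟩⟩ (by
      rintro ⟨V, f, hf⟩ ⟨V', f', hf'⟩ w s s' hs
      -- The prescribed value on an arrow through the piece over `f` is expressed by its composite
      -- `k` to `(U, x)` alone, so two factorizations of the same `k` give the same value.
      have key : ∀ {V : C} (f : V ⟶ U) (hf : S f) (s : w ⟶ (⟨V, (res Z f).obj x⟩ : Tot Z))
          (k : w ⟶ ⟨U, x⟩) (_ : s ≫ Tot.cart ⟨U, x⟩ f = k), ∃ hk : S (Tot.bs k),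
          ∃ s₀ : w ⟶ ⟨w.base, (res Z (Tot.bs k)).obj x⟩, Tot.bs s₀ = 𝟙 _ ∧
            s₀ ≫ Tot.cart ⟨U, x⟩ (Tot.bs k) = k ∧
            s ≫ Tot.vert (m f hf) ≫ Tot.cart ⟨U, y⟩ f =
              s₀ ≫ Tot.vert (m (Tot.bs k) hk) ≫ Tot.cart ⟨U, y⟩ (Tot.bs (b := ⟨U, x⟩) k) := by
        rintro V f hf s _ rfl
        have hk : S (Tot.bs (b := ⟨V, (res Z f).obj x⟩) s ≫ f) := S.downward_closed hf _
        obtain ⟨s₀, h₀, h₁⟩ := Tot.exists_lift s (Tot.cart ⟨V, (res Z f).obj x⟩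
          (Tot.bs (b := ⟨V, (res Z f).obj x⟩) s)) (𝟙 _) (Category.id_comp _)
        have h₂ := Tot.cart_comp_cart (⟨U, x⟩ : Tot Z) f (Tot.bs (b := ⟨V, (res Z f).obj x⟩) s)
        have h₃ := Tot.cart_comp_cart (⟨U, y⟩ : Tot Z) f (Tot.bs (b := ⟨V, (res Z f).obj x⟩) s)
        refine ⟨hk, s₀ ≫ Tot.vert (eqToHom (res_comp_obj Z _ f x).symm),
          (congrArg (· ≫ 𝟙 _) h₀).trans (Category.id_comp _), ?_, ?_⟩
        · refine (Category.assoc _ _ _).trans ?_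
          refine (congrArg (s₀ ≫ ·) h₂.symm).trans ?_
          rw [reassoc_of% h₁]
        · refine (congrArg (· ≫ _) h₁.symm).trans ?_
          rw [Category.assoc, Category.assoc, Tot.cart_vert_assoc, h₃, hm _ f hf hk, Tot.vert_comp,
            Tot.vert_comp]
          simp only [Category.assoc, ← Tot.vert_comp_assoc]
          simp
      obtain ⟨hk, s₀, e, e', h⟩ := key f hf s _ hs
      obtain ⟨hk', s₀', e₁, e₁', h'⟩ := key f' hf' s' _ rfl
      exact h.trans (Eq.trans (by rw [Tot.cancel _ (e.trans e₁.symm) (e'.trans e₁'.symm)]) h'.symm))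
  obtain ⟨m₀, rfl⟩ := Tot.exists_vert h hb
  refine ⟨m₀, fun V f hf ↦ Tot.vert_injective (Tot.cancel (Tot.cart ⟨U, y⟩ f) rfl ?_)⟩
  rw [← Tot.cart_vert]
  exact hh ⟨V, f, hf⟩

/-- A presheaf of groupoids whose objects and arrows can be glued uniquely is a sheaf. -/
theorem TotStack.isSheaf (hZ : TotStack J Z) (hob : GluesObjects J Z) : Presheaf.IsSheaf J Z := by
  intro E U S hS x hx
  obtain ⟨F, hF⟩ : ∃ F : ∀ ⦃V : C⦄ (f : V ⟶ U), S f → (E ⥤ Sec Z V), ∀ V f hf, F f hf = x f hf :=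
    ⟨x, fun _ _ _ ↦ rfl⟩
  have hc : ∀ ⦃W V : C⦄ (g : W ⟶ V) (f : V ⟶ U) (hf : S f) (hg : S (g ≫ f)),
      F f hf ⋙ res Z g = F (g ≫ f) hg := fun W V g f hf hg ↦
    (congrArg (· ⋙ res Z g) (hF V f hf)).trans
      (((Presieve.compatible_iff_sieveCompatible x).1 hx f g hf).symm.trans (hF _ _ _).symm)
  -- The sheaf condition for `Grpd`-valued presheaves is tested on functors from each groupoid `E`.
  -- Their objects glue strictly by `hob`, and their arrows are then glued between the objects so
  -- obtained.
  choose o ho hu using fun e : E ↦ hob U S hS (fun V f hf ↦ (F f hf).obj e)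
    (fun W V g f hf hg ↦ Functor.congr_obj (hc g f hf hg) e)
  choose a ha using fun (e e' : E) (m : e ⟶ e') ↦ hZ.glue_vert hS (x := o e) (y := o e')
    (fun V f hf ↦ eqToHom (ho e f hf) ≫ (F f hf).map m ≫ eqToHom (ho e' f hf).symm)
    (fun W V g f hf hg ↦ by
      have := Functor.congr_hom (hc g f hf hg) m
      simp only [Functor.comp_map] at this
      simp [eqToHom_map, this])
  let G : E ⥤ Sec Z U :=
    { obj := o
      map := fun {e e'} m ↦ a e e' m
      map_id := fun e ↦ hZ.sep_vert hS fun V f hf ↦ by rw [ha _ _ _ _ hf]; simp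
      map_comp := fun m n ↦ hZ.sep_vert hS fun V f hf ↦ by
        rw [Functor.map_comp, ha _ _ _ _ hf, ha _ _ _ _ hf, ha _ _ _ _ hf]; simp }
  have hG : ∀ ⦃V : C⦄ (f : V ⟶ U) (hf : S f), G ⋙ res Z f = F f hf := fun V f hf ↦
    CategoryTheory.Functor.ext (fun e ↦ ho e f hf) (fun e e' m ↦ ha e e' m f hf)
  refine ⟨G, fun V f hf ↦ (hG f hf).trans (hF _ _ _), ?_⟩
  intro G' hG'
  obtain ⟨G', rfl⟩ : ∃ H : E ⥤ Sec Z U, H = G' := ⟨G', rfl⟩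
  have hG₁ : ∀ ⦃V : C⦄ (f : V ⟶ U) (hf : S f), G' ⋙ res Z f = F f hf := fun V f hf ↦
    (hG' f hf).trans (hF _ _ _).symm
  have hob : ∀ e, G'.obj e = G.obj e := fun e ↦ hu e _ fun V f hf ↦ Functor.congr_obj (hG₁ f hf) e
  refine CategoryTheory.Functor.ext hob fun e e' m ↦ hZ.sep_vert hS fun V f hf ↦ ?_
  have := Functor.congr_hom ((hG₁ f hf).trans (hG f hf).symm) m
  simp only [Functor.comp_map] at this
  simp [this, eqToHom_map]

end Sheaf

/-! ### Stalks: every object and arrow is a germ, and equality of germs is local. -/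

section Germs

variable {C : Type u} [SmallCategory C] {J : GrothendieckTopology C}
  (t : GrothendieckTopology.Point.{u} J) (X : Cᵒᵖ ⥤ Grpd.{u, u})

/-- The presheaf of objects of a presheaf of groupoids. -/
abbrev obPresheaf : Cᵒᵖ ⥤ Type u where
  obj U := Sec X U.unop
  map f := ↾(res X f.unop).obj
  map_id U := by ext x; exact res_id_obj X x
  map_comp f g := by ext x; exact res_comp_obj X g.unop f.unop x

/-- The presheaf of arrows of a presheaf of groupoids. -/
abbrev arPresheaf : Cᵒᵖ ⥤ Type u where
  obj U := Arrow (Sec X U.unop)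
  map f := ↾(res X f.unop).mapArrow.obj
  map_id U := by
    ext m
    exact congrArg (fun F : Sec X U.unop ⥤ Sec X U.unop ↦ F.mapArrow.obj m) (res_id X U.unop)
  map_comp {U V W} f g := by
    ext m
    exact congrArg (fun F : Sec X U.unop ⥤ Sec X W.unop ↦ F.mapArrow.obj m)
      (res_comp X g.unop f.unop)

namespace GermModel

/-- The germs of objects. -/
abbrev Ob : Type u := t.presheafFiber.obj (obPresheaf X)

/-- The germs of arrows. -/
abbrev Ar : Type u := t.presheafFiber.obj (arPresheaf X)

variable {X}

/-- The germ of an object. -/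
noncomputable abbrev ob {U : C} (y : t.fiber.obj U) (x : Sec X U) : Ob t X :=
  t.toPresheafFiber U y (obPresheaf X) x

/-- The germ of an arrow. -/
noncomputable abbrev ar {U : C} (y : t.fiber.obj U) {x x' : Sec X U} (m : x ⟶ x') : Ar t X :=
  t.toPresheafFiber U y (arPresheaf X) (Arrow.mk m)

lemma ob_res {V U : C} (f : V ⟶ U) (y : t.fiber.obj V) (x : Sec X U) :
    ob t y ((res X f).obj x) = ob t (t.fiber.map f y) x :=
  ConcreteCategory.congr_hom (t.toPresheafFiber_w f y (obPresheaf X)) x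

lemma ar_res {V U : C} (f : V ⟶ U) (y : t.fiber.obj V) {x x' : Sec X U} (m : x ⟶ x') :
    ar t y ((res X f).map m) = ar t (t.fiber.map f y) m :=
  ConcreteCategory.congr_hom (t.toPresheafFiber_w f y (arPresheaf X)) (Arrow.mk m)

/-- The source of a germ. -/
noncomputable def src (α : Ar t X) : Ob t X :=
  t.presheafFiber.map (X := arPresheaf X) (Y := obPresheaf X) { app := fun _ ↦ ↾fun m ↦ m.left } α

/-- The target of a germ. -/
noncomputable def tgt (α : Ar t X) : Ob t X :=
  t.presheafFiber.map (X := arPresheaf X) (Y := obPresheaf X) { app := fun _ ↦ ↾fun m ↦ m.right } α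

lemma src_ar {U : C} (y : t.fiber.obj U) {x x' : Sec X U} (m : x ⟶ x') :
    src t (ar t y m) = ob t y x :=
  ConcreteCategory.congr_hom (t.toPresheafFiber_naturality (P := arPresheaf X) (Q := obPresheaf X)
    { app := fun _ ↦ ↾fun m ↦ m.left } U y) (Arrow.mk m)

lemma tgt_ar {U : C} (y : t.fiber.obj U) {x x' : Sec X U} (m : x ⟶ x') :
    tgt t (ar t y m) = ob t y x' :=
  ConcreteCategory.congr_hom (t.toPresheafFiber_naturality (P := arPresheaf X) (Q := obPresheaf X)
    { app := fun _ ↦ ↾fun m ↦ m.right } U y) (Arrow.mk m)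

lemma ob_eq {U : C} {y : t.fiber.obj U} {x x' : Sec X U} (h : ob t y x = ob t y x') :
    ∃ (V : C) (f : V ⟶ U) (y' : t.fiber.obj V), t.fiber.map f y' = y ∧
      (res X f).obj x = (res X f).obj x' :=
  (t.toPresheafFiber_eq_iff' (P := obPresheaf X) U y x x').1 h

lemma ar_eq {U : C} {y : t.fiber.obj U} {x x' z z' : Sec X U} {m : x ⟶ x'} {n : z ⟶ z'}
    (h : ar t y m = ar t y n) : ∃ (V : C) (f : V ⟶ U) (y' : t.fiber.obj V), t.fiber.map f y' = y ∧
      Arrow.mk ((res X f).map m) = Arrow.mk ((res X f).map n) :=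
  (t.toPresheafFiber_eq_iff' (P := arPresheaf X) U y (Arrow.mk m) (Arrow.mk n)).1 h

lemma exists_refinement {U U' : C} (y : t.fiber.obj U) (y' : t.fiber.obj U') :
    ∃ (W : C) (f : W ⟶ U) (f' : W ⟶ U') (w : t.fiber.obj W), t.fiber.map f w = y ∧
      t.fiber.map f' w = y' := by
  let a : t.fiber.Elements := ⟨U, y⟩
  let b : t.fiber.Elements := ⟨U', y'⟩
  exact ⟨_, (IsCofiltered.minToLeft a b).1, (IsCofiltered.minToRight a b).1,
    (IsCofiltered.min a b).2, (IsCofiltered.minToLeft a b).2, (IsCofiltered.minToRight a b).2⟩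

/-- The graph of the composition of germs. -/
def Comp (α β γ : Ar t X) : Prop := ∃ (U : C) (y : t.fiber.obj U) (x₁ x₂ x₃ : Sec X U)
  (m : x₁ ⟶ x₂) (n : x₂ ⟶ x₃), ar t y m = α ∧ ar t y n = β ∧ ar t y (m ≫ n) = γ

lemma ar_surjective (α : Ar t X) : ∃ (U : C) (y : t.fiber.obj U) (x x' : Sec X U) (m : x ⟶ x'),
    ar t y m = α := by
  obtain ⟨U, y, m, h⟩ := t.toPresheafFiber_jointly_surjective (P := arPresheaf X) α
  exact ⟨U, y, _, _, (show Arrow (Sec X U) from m).hom, h⟩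

lemma ob_surjective (a : Ob t X) : ∃ (U : C) (y : t.fiber.obj U) (x : Sec X U), ob t y x = a :=
  t.toPresheafFiber_jointly_surjective (P := obPresheaf X) a

/-- A germ starting where the germ of `m` ends has a representative composable with a restriction
of `m`. -/
lemma exists_composable {U : C} (y : t.fiber.obj U) {x₁ x₂ : Sec X U} (m : x₁ ⟶ x₂) (β : Ar t X)
    (h : ob t y x₂ = src t β) : ∃ (V : C) (f : V ⟶ U) (y' : t.fiber.obj V) (x₃ : Sec X V)
      (n : (res X f).obj x₂ ⟶ x₃), t.fiber.map f y' = y ∧ ar t y' n = β := by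
  obtain ⟨U', y', z, z', n, rfl⟩ := ar_surjective t β
  rw [src_ar] at h
  obtain ⟨W, f, f', w, rfl, rfl⟩ := exists_refinement t y y'
  rw [← ob_res, ← ob_res] at h
  obtain ⟨V, g, v, rfl, e⟩ := ob_eq t h
  rw [← res_comp_obj] at e
  refine ⟨V, g ≫ f, v, _, eqToHom e ≫ (res X g).map ((res X f').map n), by simp, ?_⟩
  have key : ∀ {a b c : Sec X V} (h : a = b) (k : b ⟶ c), ar t v (eqToHom h ≫ k) = ar t v k := by
    rintro a _ c rfl k
    rw [eqToHom_refl, Category.id_comp]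
  rw [key, ar_res, ar_res]

lemma Comp.exists {α β : Ar t X} (h : tgt t α = src t β) : ∃ γ, Comp t α β γ := by
  obtain ⟨U, y, x, x', m, rfl⟩ := ar_surjective t α
  rw [tgt_ar] at h
  obtain ⟨V, f, y', x₃, n, rfl, rfl⟩ := exists_composable t y m β h
  exact ⟨_, V, y', _, _, _, (res X f).map m, n, ar_res t f y' m, rfl, rfl⟩

lemma comp_congr {U : C} {x₁ x₂ x₃ x₁' x₂' x₃' : Sec X U} {m : x₁ ⟶ x₂} {n : x₂ ⟶ x₃}
    {m' : x₁' ⟶ x₂'} {n' : x₂' ⟶ x₃'} (h : Arrow.mk m = Arrow.mk m')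
    (h' : Arrow.mk n = Arrow.mk n') : Arrow.mk (m ≫ n) = Arrow.mk (m' ≫ n') := by
  obtain rfl : x₁ = x₁' := congrArg (·.left) h
  obtain rfl : x₂ = x₂' := congrArg (·.right) h
  obtain rfl : x₃ = x₃' := congrArg (·.right) h'
  obtain rfl : m = m' := Arrow.mk_injective _ _ h
  obtain rfl : n = n' := Arrow.mk_injective _ _ h'
  rfl

lemma res_arrow_congr {V U : C} (f : V ⟶ U) {x₁ x₂ x₁' x₂' : Sec X U} {m : x₁ ⟶ x₂}
    {m' : x₁' ⟶ x₂'} (h : Arrow.mk m = Arrow.mk m') :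
    Arrow.mk ((res X f).map m) = Arrow.mk ((res X f).map m') :=
  congrArg (res X f).mapArrow.obj h

/-- Representatives of the same two germs agree on a small enough neighbourhood: one shrinking
serves the first arrow, a further one the second, and there the composites agree. -/
lemma Comp.unique {α β γ γ' : Ar t X} (h : Comp t α β γ) (h' : Comp t α β γ') : γ = γ' := by
  obtain ⟨U, y, x₁, x₂, x₃, m, n, rfl, rfl, rfl⟩ := h
  obtain ⟨U', y', z₁, z₂, z₃, m', n', e, e', rfl⟩ := h'
  obtain ⟨W, f, f', w, rfl, rfl⟩ := exists_refinement t y y'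
  rw [← ar_res, ← ar_res] at e e'
  obtain ⟨V, g, v, rfl, e₁⟩ := ar_eq t e
  rw [← ar_res, ← ar_res t g] at e'
  obtain ⟨V', g', v', rfl, e₂⟩ := ar_eq t e'
  rw [← ar_res, ← ar_res, ← ar_res, ← ar_res t f', ← ar_res t g, ← ar_res t g']
  simp only [Functor.map_comp]
  exact (congrArg (t.toPresheafFiber V' v' (arPresheaf X))
    (comp_congr (res_arrow_congr g' e₁) e₂)).symm

end GermModel

/-- An explicit model of the stalk: its objects are the germs of objects. -/
structure GermModel : Type u where
  pt : GermModel.Ob t X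

namespace GermModel

variable {X}

lemma exists_id (a : Ob t X) : ∃ α : Ar t X, (src t α = a ∧ tgt t α = a) ∧
    ∀ (U : C) (y : t.fiber.obj U) (x : Sec X U), ob t y x = a → ar t y (𝟙 x) = α := by
  obtain ⟨U, y, x, rfl⟩ := ob_surjective t a
  refine ⟨ar t y (𝟙 x), ⟨src_ar _ _ _, tgt_ar _ _ _⟩, fun U' y' x' h ↦ ?_⟩
  obtain ⟨W, f, f', w, rfl, rfl⟩ := exists_refinement t y y'
  rw [← ob_res, ← ob_res] at h
  obtain ⟨V, g, v, rfl, e⟩ := ob_eq t h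
  have k : ∀ {V U : C} (f : V ⟶ U) (y : t.fiber.obj V) (x : Sec X U),
      ar t (t.fiber.map f y) (𝟙 x) = ar t y (𝟙 ((res X f).obj x)) := fun f y x ↦ by
    rw [← ar_res, CategoryTheory.Functor.map_id]
  rw [k f', k g, k f, k g, e]

lemma Comp.src_tgt {α β γ : Ar t X} (h : Comp t α β γ) :
    src t γ = src t α ∧ tgt t γ = tgt t β := by
  obtain ⟨U, y, x₁, x₂, x₃, m, n, rfl, rfl, rfl⟩ := h
  simp only [src_ar, tgt_ar, and_self]

lemma Comp.assoc {α β δ αβ βδ γ γ' : Ar t X} (h : Comp t α β αβ) (h₁ : Comp t αβ δ γ)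
    (h₂ : Comp t β δ βδ) (h₃ : Comp t α βδ γ') : γ = γ' := by
  obtain ⟨U, y, x₁, x₂, x₃, m, n, rfl, rfl, rfl⟩ := h
  have e : ob t y x₃ = src t δ := by
    obtain ⟨U', y', z₁, z₂, z₃, m', n', e, rfl, -⟩ := h₂
    rw [src_ar, ← tgt_ar t y n, ← e, tgt_ar]
  obtain ⟨V, f, y', x₄, p, rfl, rfl⟩ := exists_composable t y n δ e
  rw [← ar_res t f] at h₁ h₂ h₃
  rw [h₁.unique t ⟨V, y', _, _, _, (res X f).map (m ≫ n), p, rfl, rfl, rfl⟩]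
  obtain rfl := h₂.unique t ⟨V, y', _, _, _, (res X f).map n, p, rfl, rfl, rfl⟩
  rw [h₃.unique t ⟨V, y', _, _, _, (res X f).map m, (res X f).map n ≫ p, rfl, rfl, rfl⟩]
  simp only [Functor.map_comp, Category.assoc]

lemma id_comp' {α ι γ : Ar t X} (h : Comp t ι α γ)
    (hι : ∀ (U : C) (y : t.fiber.obj U) (x : Sec X U), ob t y x = src t α → ar t y (𝟙 x) = ι) :
    γ = α := by
  obtain ⟨U, y, x, x', m, rfl⟩ := ar_surjective t α
  obtain rfl := hι U y x (src_ar t y m).symm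
  rw [h.unique t ⟨U, y, _, _, _, 𝟙 x, m, rfl, rfl, rfl⟩, Category.id_comp]

lemma comp_id' {α ι γ : Ar t X} (h : Comp t α ι γ)
    (hι : ∀ (U : C) (y : t.fiber.obj U) (x : Sec X U), ob t y x = tgt t α → ar t y (𝟙 x) = ι) :
    γ = α := by
  obtain ⟨U, y, x, x', m, rfl⟩ := ar_surjective t α
  obtain rfl := hι U y x' (tgt_ar t y m).symm
  rw [h.unique t ⟨U, y, _, _, _, m, 𝟙 x', rfl, rfl, rfl⟩, Category.comp_id]

noncomputable instance : CategoryStruct (GermModel t X) where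
  Hom a b := {α : Ar t X // src t α = a.pt ∧ tgt t α = b.pt}
  id a := ⟨(exists_id t a.pt).choose, (exists_id t a.pt).choose_spec.1⟩
  comp α β := ⟨(Comp.exists t (α.2.2.trans β.2.1.symm)).choose, by
    have h := (Comp.exists t (α.2.2.trans β.2.1.symm)).choose_spec.src_tgt
    exact ⟨h.1.trans α.2.1, h.2.trans β.2.2⟩⟩

variable {t} in
/-- The germ underlying an arrow. -/
def val {a b : GermModel t X} (α : a ⟶ b) : Ar t X := Subtype.val α

lemma comp_val {a b c : GermModel t X} (α : a ⟶ b) (β : b ⟶ c) :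
    Comp t (val α) (val β) (val (α ≫ β)) :=
  (Comp.exists t (α.2.2.trans β.2.1.symm)).choose_spec

noncomputable instance : Category (GermModel t X) where
  id_comp {a b} α := Subtype.ext (id_comp' t (comp_val t (𝟙 a) α)
    (by rw [show src t α.1 = _ from α.2.1]; exact (exists_id t a.pt).choose_spec.2))
  comp_id {a b} α := Subtype.ext (comp_id' t (comp_val t α (𝟙 b))
    (by rw [show tgt t α.1 = _ from α.2.2]; exact (exists_id t b.pt).choose_spec.2))
  assoc α β γ := Subtype.ext (Comp.assoc t (comp_val t α β) (comp_val t _ γ) (comp_val t β γ)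
    (comp_val t α _))

lemma val_injective {a b : GermModel t X} {α β : a ⟶ b} (h : val α = val β) : α = β :=
  Subtype.ext h

lemma val_eqToHom {a b a' b' : GermModel t X} (h : a = a') (h' : b' = b) (α : a' ⟶ b') :
    val (eqToHom h ≫ α ≫ eqToHom h') = val α := by
  subst h h'
  simp

/-- The germ functors to the model. -/
noncomputable def germ {U : C} (y : t.fiber.obj U) : Sec X U ⥤ GermModel t X where
  obj x := ⟨ob t y x⟩
  map m := ⟨ar t y m, src_ar t y m, tgt_ar t y m⟩
  map_id x := Subtype.ext ((exists_id t _).choose_spec.2 U y x rfl)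
  map_comp {x₁ x₂ x₃} m n := Subtype.ext (Comp.unique t ⟨U, y, x₁, x₂, x₃, m, n, rfl, rfl, rfl⟩
    (Comp.exists t ((tgt_ar t y m).trans (src_ar t y n).symm)).choose_spec)

lemma res_germ {V U : C} (f : V ⟶ U) (y : t.fiber.obj V) :
    res X f ⋙ germ t y = germ t (t.fiber.map f y) := by
  refine CategoryTheory.Functor.ext (fun x ↦ congrArg GermModel.mk (ob_res t f y x)) fun x x' m ↦
    val_injective t ((ar_res t f y m).trans (val_eqToHom t _ _ ((germ t (t.fiber.map f y)).map m)).symm)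

end GermModel

/-- The stalk of a presheaf of groupoids. -/
abbrev Stalk : Type u := (t.presheafFiber.obj (X ⋙ Grpd.forgetToCat) : Cat.{u, u})

variable {X}

/-- The functor taking sections over a neighbourhood to their germs. -/
noncomputable def germ {U : C} (y : t.fiber.obj U) : Sec X U ⥤ Stalk t X :=
  (t.toPresheafFiber U y (X ⋙ Grpd.forgetToCat)).toFunctor

lemma res_germ {V U : C} (f : V ⟶ U) (y : t.fiber.obj V) :
    res X f ⋙ germ t y = germ t (t.fiber.map f y) :=
  congrArg Cat.Hom.toFunctor (t.toPresheafFiber_w f y (X ⋙ Grpd.forgetToCat))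

lemma res_germ_obj {V U : C} (f : V ⟶ U) (y : t.fiber.obj V) (x : Sec X U) :
    (germ t y).obj ((res X f).obj x) = (germ t (t.fiber.map f y)).obj x :=
  Functor.congr_obj (res_germ t f y) x

lemma res_germ_map {V U : C} (f : V ⟶ U) (y : t.fiber.obj V) {x x' : Sec X U} (m : x ⟶ x') :
    (germ t y).map ((res X f).map m) = eqToHom (res_germ_obj t f y x) ≫
      (germ t (t.fiber.map f y)).map m ≫ eqToHom (res_germ_obj t f y x').symm :=
  Functor.congr_hom (res_germ t f y) m

lemma exists_desc {D : Type u} [Category.{u} D] (G : ∀ (U : C) (_ : t.fiber.obj U), Sec X U ⥤ D)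
    (hG : ∀ ⦃V U : C⦄ (f : V ⟶ U) (y : t.fiber.obj V), res X f ⋙ G V y = G U (t.fiber.map f y)) :
    ∃ H : Stalk t X ⥤ D, ∀ (U : C) (y : t.fiber.obj U), germ t y ⋙ H = G U y :=
  ⟨(t.presheafFiberDesc (P := X ⋙ Grpd.forgetToCat) (T := Cat.of D)
    (fun U y ↦ Functor.toCatHom (G U y)) (fun _ _ f y ↦ congrArg Functor.toCatHom (hG f y))).toFunctor,
    fun U y ↦ congrArg Cat.Hom.toFunctor (t.toPresheafFiber_presheafFiberDesc
      (P := X ⋙ Grpd.forgetToCat) (T := Cat.of D) (fun U y ↦ Functor.toCatHom (G U y))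
      (fun _ _ f y ↦ congrArg Functor.toCatHom (hG f y)) U y)⟩

lemma stalk_functor_ext {D : Type u} [Category.{u} D] {H H' : Stalk t X ⥤ D}
    (h : ∀ (U : C) (y : t.fiber.obj U), germ t y ⋙ H = germ t y ⋙ H') : H = H' :=
  congrArg Cat.Hom.toFunctor (t.presheafFiber_hom_ext (P := X ⋙ Grpd.forgetToCat) (T := Cat.of D)
    (f := Functor.toCatHom H) (g := Functor.toCatHom H')
    fun U y ↦ congrArg Functor.toCatHom (h U y))

/-- The stalk is a colimit of categories, known only through its universal property. That property
maps it to `GermModel`, where equality of objects is equality in a filtered colimit of sets. -/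
lemma germ_obj_eq {U : C} {y : t.fiber.obj U} {x x' : Sec X U}
    (h : (germ t y).obj x = (germ t y).obj x') :
    ∃ (V : C) (f : V ⟶ U) (y' : t.fiber.obj V), t.fiber.map f y' = y ∧
      (res X f).obj x = (res X f).obj x' := by
  obtain ⟨H, hH⟩ := exists_desc t (fun U y ↦ GermModel.germ (X := X) t y)
    (fun _ _ f y ↦ GermModel.res_germ t f y)
  have h' := congrArg H.obj h
  have e := fun x ↦ Functor.congr_obj (hH U y) x
  simp only [Functor.comp_obj] at e
  rw [e, e] at h'
  exact GermModel.ob_eq t (congrArg GermModel.pt h')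

lemma germ_map_eq {U : C} {y : t.fiber.obj U} {x x' : Sec X U} {m m' : x ⟶ x'}
    (h : (germ t y).map m = (germ t y).map m') :
    ∃ (V : C) (f : V ⟶ U) (y' : t.fiber.obj V), t.fiber.map f y' = y ∧
      (res X f).map m = (res X f).map m' := by
  obtain ⟨H, hH⟩ := exists_desc t (fun U y ↦ GermModel.germ (X := X) t y)
    (fun _ _ f y ↦ GermModel.res_germ t f y)
  have e := fun m : x ⟶ x' ↦ Functor.congr_hom (hH U y).symm m
  have h' : GermModel.val ((GermModel.germ t y).map m) =
      GermModel.val ((GermModel.germ t y).map m') := by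
    rw [e, e, Functor.comp_map, Functor.comp_map, h]
  obtain ⟨V, f, y', hy, e⟩ := GermModel.ar_eq t h'
  exact ⟨V, f, y', hy, Arrow.mk_injective _ _ e⟩

lemma exists_refinement₂ {U U' : C} (y : t.fiber.obj U) (y' : t.fiber.obj U') :
    ∃ (W : C) (f : W ⟶ U) (f' : W ⟶ U') (w : t.fiber.obj W), t.fiber.map f w = y ∧
      t.fiber.map f' w = y' := GermModel.exists_refinement t y y'

variable {t} in
/-- The arrows of the stalk that are germs of arrows. -/
def IsGerm {p q : Stalk t X} (h : p ⟶ q) : Prop :=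
  ∃ (U : C) (y : t.fiber.obj U) (x x' : Sec X U) (m : x ⟶ x') (e : p = (germ t y).obj x)
    (e' : (germ t y).obj x' = q), h = eqToHom e ≫ (germ t y).map m ≫ eqToHom e'

lemma IsGerm.res {p q : Stalk t X} {U V : C} (f : V ⟶ U) {y : t.fiber.obj U} {v : t.fiber.obj V}
    (hv : t.fiber.map f v = y) {x x' : Sec X U} (m : x ⟶ x') (e : p = (germ t y).obj x)
    (e' : (germ t y).obj x' = q) : ∃ (d : p = (germ t v).obj ((_root_.res X f).obj x))
      (d' : (germ t v).obj ((_root_.res X f).obj x') = q),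
      eqToHom e ≫ (germ t y).map m ≫ eqToHom e' =
        eqToHom d ≫ (germ t v).map ((_root_.res X f).map m) ≫ eqToHom d' := by
  subst hv e e'
  exact ⟨(res_germ_obj t f v x).symm, res_germ_obj t f v x', by simp [res_germ_map]⟩

/-- On a common neighbourhood the target of one representative and the source of the other have the
same germ. They become equal on a smaller one, where the representatives can be composed. -/
lemma IsGerm.comp {p q r : Stalk t X} {h : p ⟶ q} {k : q ⟶ r} (hh : IsGerm h) (hk : IsGerm k) :
    IsGerm (h ≫ k) := by
  obtain ⟨U, y, x, x', m, e, e', rfl⟩ := hh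
  obtain ⟨U', y', z, z', n, d, d', rfl⟩ := hk
  obtain ⟨W, f, f', w, hw, hw'⟩ := exists_refinement₂ t y y'
  obtain ⟨e₁, e₁', h₁⟩ := IsGerm.res t f hw m e e'
  obtain ⟨d₁, d₁', h₂⟩ := IsGerm.res t f' hw' n d d'
  obtain ⟨V, g, v, hv, a⟩ := germ_obj_eq t (e₁'.trans d₁)
  obtain ⟨e₂, e₂', h₃⟩ := IsGerm.res t g hv ((_root_.res X f).map m) e₁ e₁'
  obtain ⟨d₂, d₂', h₄⟩ := IsGerm.res t g hv ((_root_.res X f').map n) d₁ d₁'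
  refine ⟨V, v, _, _, (_root_.res X g).map ((_root_.res X f).map m) ≫ eqToHom a ≫
    (_root_.res X g).map ((_root_.res X f').map n), e₂, d₂', ?_⟩
  rw [h₁, h₂, h₃, h₄]
  simp [eqToHom_map]

variable (X) in
/-- The subcategory of germs in the stalk. -/
structure GermSub : Type u where
  pt : Stalk t X
  exists_germ : ∃ (U : C) (y : t.fiber.obj U) (x : Sec X U), (germ t y).obj x = pt

noncomputable instance : Category (GermSub t X) where
  Hom p q := {h : p.pt ⟶ q.pt // IsGerm h}
  id p := ⟨𝟙 _, by
    obtain ⟨U, y, x, h⟩ := p.exists_germ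
    exact ⟨U, y, x, x, 𝟙 x, h.symm, h, by simp⟩⟩
  comp h k := ⟨h.1 ≫ k.1, h.2.comp t k.2⟩
  id_comp _ := Subtype.ext (Category.id_comp _)
  comp_id _ := Subtype.ext (Category.comp_id _)
  assoc _ _ _ := Subtype.ext (Category.assoc _ _ _)

/-- The germs form a subcategory through which all germ functors factor. The universal property
gives a functor to it, and by uniqueness its composite with the inclusion is the identity; hence the
stalk contains nothing but germs. -/
lemma exists_section : ∃ (G : Stalk t X ⥤ GermSub t X) (I : GermSub t X ⥤ Stalk t X),
    G ⋙ I = 𝟭 _ ∧ (∀ p, I.obj p = p.pt) ∧ ∀ {p q : GermSub t X} (h : p ⟶ q),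
      IsGerm (I.map h) := by
  let I : GermSub t X ⥤ Stalk t X :=
    { obj := fun p ↦ p.pt
      map := fun h ↦ h.1
      map_id := fun _ ↦ rfl
      map_comp := fun _ _ ↦ rfl }
  have hI : ∀ {p q : GermSub t X} {h k : p ⟶ q}, I.map h = I.map k → h = k := fun e ↦ Subtype.ext e
  let γ : ∀ (U : C) (_ : t.fiber.obj U), Sec X U ⥤ GermSub t X := fun U y ↦
    { obj := fun x ↦ ⟨(germ t y).obj x, U, y, x, rfl⟩
      map := fun {x x'} m ↦ ⟨(germ t y).map m, U, y, x, x', m, rfl, rfl, by simp⟩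
      map_id := fun x ↦ Subtype.ext ((germ t y).map_id x)
      map_comp := fun m n ↦ Subtype.ext ((germ t y).map_comp m n) }
  obtain ⟨G, hG⟩ := exists_desc t γ (fun V U f y ↦
    CategoryTheory.Functor.ext (fun x ↦ by simp only [γ, Functor.comp_obj, res_germ_obj]) fun x x' m ↦ hI (by
      rw [Functor.map_comp, Functor.map_comp, eqToHom_map, eqToHom_map]
      exact res_germ_map t f y m))
  refine ⟨G, I, stalk_functor_ext t fun U y ↦ ?_, fun _ ↦ rfl, fun h ↦ h.2⟩
  exact (congrArg (· ⋙ I) (hG U y)).trans rfl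

lemma exists_germ_obj (p : Stalk t X) :
    ∃ (U : C) (y : t.fiber.obj U) (x : Sec X U), (germ t y).obj x = p := by
  obtain ⟨G, I, h, h', -⟩ := exists_section (X := X) t
  obtain ⟨U, y, x, e⟩ := (G.obj p).exists_germ
  exact ⟨U, y, x, e.trans ((h' _).symm.trans (Functor.congr_obj h p))⟩

lemma isGerm {p q : Stalk t X} (k : p ⟶ q) : IsGerm k := by
  obtain ⟨G, I, h, -, h'⟩ := exists_section (X := X) t
  obtain ⟨U, y, x, x', m, e, e', hm⟩ := h' (G.map k)
  have := Functor.congr_hom h.symm k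
  simp only [Functor.id_map, Functor.comp_map, hm] at this
  exact ⟨U, y, x, x', m, (Functor.congr_obj h p).symm.trans e, e'.trans (Functor.congr_obj h q),
    by rw [this]; simp⟩

/-- Every arrow between germs at a point is, after a restriction, the germ of an arrow. -/
lemma exists_germ_map {U : C} {y : t.fiber.obj U} {x x' : Sec X U}
    (k : (germ t y).obj x ⟶ (germ t y).obj x') :
    ∃ (V : C) (f : V ⟶ U) (v : t.fiber.obj V) (hv : t.fiber.map f v = y)
      (n : (res X f).obj x ⟶ (res X f).obj x'),
      (germ t v).map n = eqToHom (by rw [res_germ_obj, hv]) ≫ k ≫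
        eqToHom (by rw [res_germ_obj, hv]) := by
  obtain ⟨U', y', z, z', m, e, e', rfl⟩ := isGerm t k
  obtain ⟨W, f, f', w, rfl, hw'⟩ := exists_refinement₂ t y y'
  obtain ⟨e₁, e₁', h₁⟩ := IsGerm.res t f' hw' m e e'
  rw [h₁]
  -- The representative `m` has the required source and target only as germs. A first shrinking
  -- makes the sources equal, a second one the targets.
  obtain ⟨V, g, v, rfl, a⟩ := germ_obj_eq t ((res_germ_obj t f w x).trans e₁)
  obtain ⟨V', g', v', rfl, a'⟩ := germ_obj_eq t (y := v) (x := (res X g).obj ((res X f').obj z'))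
    (x' := (res X g).obj ((res X f).obj x')) (by
      rw [res_germ_obj t g, res_germ_obj t g, e₁', res_germ_obj])
  refine ⟨V', (g' ≫ g) ≫ f, v', by simp, eqToHom (by rw [res_comp_obj, res_comp_obj, a]) ≫
    (res X g').map ((res X g).map ((res X f').map m)) ≫
    eqToHom (by rw [a', res_comp_obj, res_comp_obj]), ?_⟩
  simp [eqToHom_map, res_germ_map]

instance {p q : Stalk t X} (k : p ⟶ q) : IsIso k := by
  obtain ⟨U, y, x, x', m, e, e', rfl⟩ := isGerm t k
  infer_instance

noncomputable instance : Groupoid (Stalk t X) := Groupoid.ofIsIso fun _ ↦ inferInstance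

variable {Y : Cᵒᵖ ⥤ Grpd.{u, u}} (φ : X ⟶ Y)

/-- The functor induced on stalks. -/
noncomputable def stalkMap : Stalk t X ⥤ Stalk t Y :=
  (t.presheafFiber.map (Functor.whiskerRight φ Grpd.forgetToCat)).toFunctor

lemma germ_stalkMap {U : C} (y : t.fiber.obj U) :
    germ t y ⋙ stalkMap t φ = sec φ U ⋙ germ t y :=
  congrArg Cat.Hom.toFunctor (t.toPresheafFiber_naturality (Functor.whiskerRight φ Grpd.forgetToCat)
    U y)

lemma stalkMap_id : stalkMap t (𝟙 X) = 𝟭 _ :=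
  stalk_functor_ext t fun _ y ↦ (germ_stalkMap t (𝟙 X) y).trans rfl

lemma stalkMap_comp {Z : Cᵒᵖ ⥤ Grpd.{u, u}} (ψ : Y ⟶ Z) :
    stalkMap t (φ ≫ ψ) = stalkMap t φ ⋙ stalkMap t ψ :=
  stalk_functor_ext t fun U y ↦ (germ_stalkMap t (φ ≫ ψ) y).trans (by
    rw [← Functor.assoc, germ_stalkMap, Functor.assoc, germ_stalkMap]
    rfl)

end Germs

lemma eqToHom_conj_injective {D : Type*} [Category* D] {a b a' b' : D} (h : a' = a) (h' : b = b')
    {m n : a ⟶ b} (e : eqToHom h ≫ m ≫ eqToHom h' = eqToHom h ≫ n ≫ eqToHom h') : m = n := by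
  subst h h'
  simpa using e

lemma germ_map_congr {C : Type u} [SmallCategory C] {J : GrothendieckTopology C}
    {X : Cᵒᵖ ⥤ Grpd.{u, u}} (t : GrothendieckTopology.Point.{u} J) {U V : C} (f : V ⟶ U)
    (v : t.fiber.obj V) {x x' : Sec X U} {m m' : x ⟶ x'}
    (h : (germ t v).map ((res X f).map m) = (germ t v).map ((res X f).map m')) :
    (germ t (t.fiber.map f v)).map m = (germ t (t.fiber.map f v)).map m' := by
  rw [res_germ_map, res_germ_map] at h
  exact eqToHom_conj_injective _ _ h

/-! ### Local equivalences and their effect on stalks. -/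

section LocEquiv

variable {C : Type u} [SmallCategory C] {J : GrothendieckTopology C} {X Y : Cᵒᵖ ⥤ Grpd.{u, u}}

/-- A morphism of presheaves of groupoids is a local equivalence if it is locally faithful, full
and essentially surjective. -/
structure IsLocEquiv (J : GrothendieckTopology C) (η : X ⟶ Y) : Prop where
  faithful {U : C} {x x' : Sec X U} {m m' : x ⟶ x'} (h : (sec η U).map m = (sec η U).map m') :
    Loc J U (fun _ f ↦ (res X f).map m = (res X f).map m')
  full {U : C} {x x' : Sec X U} (m : (sec η U).obj x ⟶ (sec η U).obj x') :
    Loc J U (fun V f ↦ ∃ n : (res X f).obj x ⟶ (res X f).obj x', (sec η V).map n =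
      eqToHom (res_sec_obj η f x) ≫ (res Y f).map m ≫ eqToHom (res_sec_obj η f x').symm)
  essSurj {U : C} (y : Sec Y U) : Loc J U (fun V f ↦ ∃ x : Sec X V,
    Nonempty ((sec η V).obj x ⟶ (res Y f).obj y))

variable {η : X ⟶ Y}

lemma FunOver.ofNat_vert_cart (η : X ⟶ Y) {V U : C} (f : V ⟶ U) {x : Sec X V} {x' : Sec X U}
    (n : x ⟶ (res X f).obj x') :
    (FunOver.ofNat η).map (Tot.vert n ≫ Tot.cart ⟨U, x'⟩ f) =
      Tot.vert ((sec η V).map n ≫ eqToHom (res_sec_obj η f x')) ≫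
        Tot.cart ⟨U, (sec η U).obj x'⟩ f := by
  refine ((FunOver.ofNat η).map_comp _ _).trans ?_
  refine (congrArg₂ (· ≫ ·) (FunOver.ofNat_vert η n) (FunOver.ofNat_cart η ⟨U, x'⟩ f)).trans ?_
  exact (Tot.vert_comp_assoc _ _ _).symm

lemma sec_map_of_ofNat_map {V U : C} {f : V ⟶ U} {x₁ : Sec X V} {x x' : Sec X U}
    {a : x₁ ⟶ (res X f).obj x} {b : x₁ ⟶ (res X f).obj x'} {m : (sec η U).obj x ⟶ (sec η U).obj x'}
    (h : (FunOver.ofNat η).map (Tot.vert b ≫ Tot.cart ⟨U, x'⟩ f) =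
      (FunOver.ofNat η).map (Tot.vert a ≫ Tot.cart ⟨U, x⟩ f) ≫ Tot.vert m) :
    (sec η V).map (inv a ≫ b) =
      eqToHom (res_sec_obj η f x) ≫ (res Y f).map m ≫ eqToHom (res_sec_obj η f x').symm := by
  have h₁ : (sec η V).map b ≫ eqToHom (res_sec_obj η f x') =
      (sec η V).map a ≫ eqToHom (res_sec_obj η f x) ≫ (res Y f).map m := by
    refine Tot.vert_injective (Tot.cancel (Tot.cart ⟨U, (sec η U).obj x'⟩ f) rfl ?_)
    refine (FunOver.ofNat_vert_cart η f b).symm.trans (h.trans ?_)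
    refine (congrArg (· ≫ _) (FunOver.ofNat_vert_cart η f a)).trans ?_
    refine (Category.assoc _ _ _).trans ((congrArg (_ ≫ ·) (Tot.cart_vert f m)).trans ?_)
    exact (Tot.vert_comp_assoc _ _ _).symm.trans (by rw [Category.assoc])
  rw [Functor.map_comp, Functor.map_inv, IsIso.inv_comp_eq, ← reassoc_of% h₁]
  simp

/-- The two notions of local equivalence agree. -/
lemma FunOver.IsLocEquiv.isLocEquiv (h : (FunOver.ofNat η).IsLocEquiv J) : _root_.IsLocEquiv J η where
  faithful {U x x' m m'} e := by
    refine (h.faithful (Tot.vert m) (Tot.vert m') ?_).mono fun V f hf ↦ ?_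
    · exact (FunOver.ofNat_vert η m).trans ((congrArg Tot.vert e).trans (FunOver.ofNat_vert η m').symm)
    · refine Tot.vert_injective (Tot.cancel (Tot.cart ⟨U, x'⟩ f) rfl ?_)
      exact (Tot.cart_vert f m).symm.trans (hf.trans (Tot.cart_vert f m'))
  full {U x x'} m := by
    refine (h.full (x := ⟨U, x⟩) (x' := ⟨U, x'⟩) (Tot.vert m)).mono ?_
    rintro V f ⟨x₁, r, n, rfl, hn⟩
    have hb : Tot.bs n = Tot.bs r := by
      refine ((FunOver.ofNat η).map_bs n).symm.trans ((congrArg Tot.bs hn).trans ?_)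
      refine (Tot.comp_bs _ _).trans ((Category.comp_id _).trans ((FunOver.ofNat η).map_bs r))
    exact ⟨inv (Tot.vat r _ rfl) ≫ Tot.vat n _ hb, sec_map_of_ofNat_map
      (by rw [Tot.vert_cart r rfl, Tot.vert_cart n hb]; exact hn)⟩
  essSurj {U} y := by
    refine (h.essSurj ⟨U, y⟩).mono ?_
    rintro V f ⟨x, i, hi⟩
    exact ⟨x, ⟨Tot.vat i f hi⟩⟩

/-- A local equivalence induces equivalences on stalks. -/
theorem IsLocEquiv.isLocalWeakEquiv (h : IsLocEquiv J η) : IsLocalWeakEquiv J η := by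
  intro t
  change (stalkMap t η).IsEquivalence
  have e : ∀ {U : C} (y : t.fiber.obj U) (x : Sec X U),
      (stalkMap t η).obj ((germ t y).obj x) = (germ t y).obj ((sec η U).obj x) :=
    fun y x ↦ Functor.congr_obj (germ_stalkMap t η y) x
  have em : ∀ {U : C} (y : t.fiber.obj U) {x x' : Sec X U} (m : x ⟶ x'),
      (stalkMap t η).map ((germ t y).map m) =
        eqToHom (e y x) ≫ (germ t y).map ((sec η U).map m) ≫ eqToHom (e y x').symm :=
    fun y x x' m ↦ Functor.congr_hom (germ_stalkMap t η y) m
  -- two objects of the stalk are germs at a common neighbourhood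
  have two : ∀ p q : Stalk t X, ∃ (U : C) (y : t.fiber.obj U) (x x' : Sec X U),
      p = (germ t y).obj x ∧ q = (germ t y).obj x' := by
    intro p q
    obtain ⟨U, y, x, rfl⟩ := exists_germ_obj t p
    obtain ⟨U', y', x', rfl⟩ := exists_germ_obj t q
    obtain ⟨W, f, f', w, rfl, rfl⟩ := exists_refinement₂ t y y'
    exact ⟨W, w, _, _, (res_germ_obj t f w x).symm, (res_germ_obj t f' w x').symm⟩
  have iso : ∀ {U V : C} (f : V ⟶ U) {y : t.fiber.obj U} {v : t.fiber.obj V}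
      (hv : t.fiber.map f v = y) (x : Sec X U),
      (germ t v).obj ((res X f).obj x) = (germ t y).obj x := by
    rintro U V f y v rfl x
    exact res_germ_obj t f v x
  constructor
  · constructor
    intro p q k k' hk
    obtain ⟨U, y, x, x', rfl, rfl⟩ := two p q
    obtain ⟨V, f, v, hv, n, hn⟩ := exists_germ_map t k
    obtain ⟨V', f', v', rfl, n', hn'⟩ := exists_germ_map t (eqToHom (iso f hv x) ≫ k' ≫
      eqToHom (iso f hv x').symm)
    subst hv
    have e₁ : (germ t v').map ((res X f').map n) = eqToHom (by simp [res_germ_obj]) ≫ k ≫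
        eqToHom (by simp [res_germ_obj]) := by
      rw [res_germ_map, hn]
      simp
    have e₂ : (germ t v').map n' = eqToHom (by simp [res_germ_obj]) ≫ k' ≫
        eqToHom (by simp [res_germ_obj]) := by
      rw [hn']
      simp
    have h₁ : (stalkMap t η).map ((germ t v').map ((res X f').map n)) =
        (stalkMap t η).map ((germ t v').map n') := by
      rw [e₁, e₂, Functor.map_comp, Functor.map_comp, hk, Functor.map_comp, Functor.map_comp]
    rw [em, em] at h₁
    obtain ⟨W, g, w, rfl, h₂⟩ := germ_map_eq t (y := v') (m := (sec η V').map ((res X f').map n))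
      (m' := (sec η V').map n') (eqToHom_conj_injective _ _ h₁)
    -- The images of the two representatives agree near the point. By local faithfulness the
    -- representatives agree on a covering, and one of its members is a neighbourhood of the point.
    obtain ⟨S, hS, H⟩ := h.faithful (m := (res X g).map ((res X f').map n))
      (m' := (res X g).map n') (by rw [res_sec_map, h₂, res_sec_map])
    obtain ⟨W', g', hg', w', rfl⟩ := t.jointly_surjective S hS w
    have h₄ := germ_map_congr t _ _ (germ_map_congr t _ _ (congrArg (germ t w').map (H g' hg')))
    rw [e₁, e₂] at h₄
    exact eqToHom_conj_injective _ _ h₄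
  · constructor
    intro p q k
    obtain ⟨U, y, x, x', rfl, rfl⟩ := two p q
    obtain ⟨V, f, v, rfl, n, hn⟩ := exists_germ_map t (eqToHom (e y x).symm ≫ k ≫ eqToHom (e y x'))
    obtain ⟨S, hS, H⟩ := h.full (eqToHom (res_sec_obj η f x) ≫ n ≫ eqToHom (res_sec_obj η f x').symm)
    obtain ⟨W, g, hg, w, rfl⟩ := t.jointly_surjective S hS v
    obtain ⟨a, ha⟩ := H g hg
    have e₁ : ∀ x : Sec X U, (germ t (t.fiber.map f (t.fiber.map g w))).obj x =
        (germ t w).obj ((res X g).obj ((res X f).obj x)) := fun x ↦ by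
      rw [res_germ_obj, res_germ_obj]
    refine ⟨eqToHom (e₁ x) ≫ (germ t w).map a ≫ eqToHom (e₁ x').symm, ?_⟩
    simp only [Functor.map_comp, eqToHom_map, em, ha, res_germ_map, hn]
    simp
  · constructor
    intro q
    obtain ⟨U, y, z, rfl⟩ := exists_germ_obj t q
    obtain ⟨S, hS, H⟩ := h.essSurj z
    obtain ⟨V, f, hf, v, rfl⟩ := t.jointly_surjective S hS y
    obtain ⟨x, ⟨i⟩⟩ := H f hf
    exact ⟨(germ t v).obj x, ⟨eqToIso (e v x) ≪≫ asIso ((germ t v).map i) ≪≫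
      eqToIso (res_germ_obj t f v z)⟩⟩

end LocEquiv

/-! ### Homotopy fixed points preserve local equivalences. -/

namespace HFix

variable {G G' G₁ G₁' : Type u} [Groupoid.{u} G] [Groupoid.{u} G'] [Groupoid.{u} G₁]
  [Groupoid.{u} G₁'] {σ : G ⥤ G} {hσ : σ ⋙ σ = 𝟭 G} {σ' : G' ⥤ G'} {hσ' : σ' ⋙ σ' = 𝟭 G'}
  {σ₁ : G₁ ⥤ G₁} {hσ₁ : σ₁ ⋙ σ₁ = 𝟭 G₁} {σ₁' : G₁' ⥤ G₁'} {hσ₁' : σ₁' ⋙ σ₁' = 𝟭 G₁'}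
  {F : G ⥤ G'} (hF : σ ⋙ F = F ⋙ σ')

lemma eqToHom_hom {p q : HFix σ hσ} (h : p = q) :
    Hom.hom (eqToHom h) = eqToHom (congrArg HFix.pt h) := by
  subst h
  rfl

include hF in
lemma map_bar {x y : G} (m : x ⟶ y) : F.map (σ.map m) =
    eqToHom (Functor.congr_obj hF x) ≫ σ'.map (F.map m) ≫
      eqToHom (Functor.congr_obj hF y).symm := Functor.congr_hom hF m

/-- Applied with `F` a restriction functor: an arrow that commutes with the structure arrows only
after restriction becomes an arrow of homotopy fixed points there. -/
lemma exists_hom_map {p q : HFix σ hσ} (n : p.pt ⟶ q.pt)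
    (h : F.map (n ≫ q.iso) = F.map (p.iso ≫ σ.map n)) :
    ∃ k : (map (hσ' := hσ') F hF).obj p ⟶ (map F hF).obj q, Hom.hom k = F.map n := by
  refine ⟨⟨F.map n, ?_⟩, rfl⟩
  change F.map n ≫ F.map q.iso ≫ eqToHom _ = (F.map p.iso ≫ eqToHom _) ≫ σ'.map (F.map n)
  rw [← Functor.map_comp_assoc, h, Functor.map_comp, map_bar hF]
  simp

/-- Applied with `F` the functor `η` on sections: a lift of an arrow of homotopy fixed points
commutes with the structure arrows after `η`, which is the input for local faithfulness. -/
lemma map_comm {p q : HFix σ hσ} (m : (map (hσ' := hσ') F hF).obj p ⟶ (map F hF).obj q)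
    (n : p.pt ⟶ q.pt) (h : F.map n = Hom.hom m) :
    F.map (n ≫ q.iso) = F.map (p.iso ≫ σ.map n) := by
  obtain ⟨m, e⟩ := m
  obtain rfl : F.map n = m := h
  have e : F.map n ≫ F.map q.iso ≫ eqToHom (Functor.congr_obj hF q.pt) =
    (F.map p.iso ≫ eqToHom (Functor.congr_obj hF p.pt)) ≫ σ'.map (F.map n) := e
  rw [Functor.map_comp, Functor.map_comp, map_bar hF, ← cancel_mono (eqToHom (Functor.congr_obj hF q.pt))]
  simpa using e

/-- Local lifting of homotopy fixed points. -/
lemma exists_lift {F₁ : G₁ ⥤ G₁'} (hF₁ : σ₁ ⋙ F₁ = F₁ ⋙ σ₁') {R : G ⥤ G₁} (hR : σ ⋙ R = R ⋙ σ₁)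
    {R' : G' ⥤ G₁'} (hR' : σ' ⋙ R' = R' ⋙ σ₁') (hsq : R ⋙ F₁ = F ⋙ R') {x : G}
    {y : HFix σ' hσ'} {i : F.obj x ⟶ y.pt} {φ : x ⟶ σ.obj x}
    (h : F.map φ ≫ eqToHom (Functor.congr_obj hF x) ≫ σ'.map i = i ≫ y.iso)
    (h' : R.map (φ ≫ σ.map φ) = R.map (eqToHom (Functor.congr_obj hσ x).symm)) :
    ∃ p : HFix σ₁ hσ₁, Nonempty ((map (hσ' := hσ₁') F₁ hF₁).obj p ⟶ (map R' hR').obj y) := by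
  refine ⟨⟨R.obj x, R.map φ ≫ eqToHom (Functor.congr_obj hR x), ?_⟩,
    ⟨eqToHom (Functor.congr_obj hsq x) ≫ R'.map i, ?_⟩⟩
  · rw [Functor.map_comp, map_bar hR, eqToHom_map] at h'
    have := congrArg (· ≫ eqToHom ((Functor.congr_obj hR (σ.obj x)).trans
      (congrArg σ₁.obj (Functor.congr_obj hR x)))) h'
    simpa [eqToHom_map] using this
  · have h₁ := congrArg R'.map h
    simp only [Functor.map_comp, map_bar hR', eqToHom_map] at h₁
    have h₂ := Functor.congr_hom hsq φ
    simp only [Functor.comp_map] at h₂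
    have key : (eqToHom (Functor.congr_obj hsq x) ≫ R'.map i) ≫ R'.map y.iso ≫
        eqToHom (Functor.congr_obj hR' y.pt) = (F₁.map (R.map φ ≫ eqToHom (Functor.congr_obj hR x)) ≫
          eqToHom (Functor.congr_obj hF₁ (R.obj x))) ≫
            σ₁'.map (eqToHom (Functor.congr_obj hsq x) ≫ R'.map i) := by
      simp only [Category.assoc, Functor.map_comp, eqToHom_map, h₂]
      rw [← reassoc_of% h₁]
      simp
    exact key

/-- The lift of the structure arrow of a homotopy fixed point is an involution after applying the
functor. -/
lemma map_lift_comp_bar {x : G} {y : HFix σ' hσ'} {i : F.obj x ⟶ y.pt} {φ : x ⟶ σ.obj x}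
    (h : F.map φ ≫ eqToHom (Functor.congr_obj hF x) ≫ σ'.map i = i ≫ y.iso) :
    F.map (φ ≫ σ.map φ) = F.map (eqToHom (Functor.congr_obj hσ x).symm) := by
  have h₁ := congrArg σ'.map h
  have h₂ := Functor.congr_hom hσ' i
  simp only [Functor.comp_map, Functor.id_map] at h₂
  simp only [Functor.map_comp, h₂, eqToHom_map] at h₁
  have h₃ := y.iso_comp_bar
  have e : (F.map φ ≫ F.map (σ.map φ)) ≫ eqToHom (by
      exact congrArg F.obj (Functor.congr_obj hσ x)) ≫ i = i := by
    have := congrArg (· ≫ σ'.map y.iso ≫ eqToHom (Functor.congr_obj hσ' y.pt)) h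
    simp only [Category.assoc, reassoc_of% h₃] at this
    rw [← reassoc_of% h₁] at this
    rw [map_bar hF]
    simpa using this
  rw [eqToHom_map, Functor.map_comp, ← cancel_mono (eqToHom (congrArg F.obj
    (Functor.congr_obj hσ x)) ≫ i), e]
  simp

/-- The arrow `φ` lifts the structure arrow of `y` conjugated by `i`. Undoing the conjugation shows
that the restriction of `i` is compatible with `φ`, which is the hypothesis of `exists_lift`. -/
lemma lift_comm {F₁ : G₁ ⥤ G₁'} (hF₁ : σ₁ ⋙ F₁ = F₁ ⋙ σ₁') {R : G ⥤ G₁} (hR : σ ⋙ R = R ⋙ σ₁)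
    {R' : G' ⥤ G₁'} (hR' : σ' ⋙ R' = R' ⋙ σ₁') (hsq : R ⋙ F₁ = F ⋙ R') {x : G}
    {y : HFix σ' hσ'} {i : F.obj x ⟶ y.pt} {φ : R.obj x ⟶ R.obj (σ.obj x)}
    (h : F₁.map φ = eqToHom (Functor.congr_obj hsq x) ≫ R'.map (i ≫ y.iso ≫ σ'.map (inv i) ≫
      eqToHom (Functor.congr_obj hF x).symm) ≫ eqToHom (Functor.congr_obj hsq (σ.obj x)).symm) :
    F₁.map (φ ≫ eqToHom (Functor.congr_obj hR x)) ≫ eqToHom (Functor.congr_obj hF₁ (R.obj x)) ≫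
        σ₁'.map (eqToHom (Functor.congr_obj hsq x) ≫ R'.map i) =
      (eqToHom (Functor.congr_obj hsq x) ≫ R'.map i) ≫
        R'.map y.iso ≫ eqToHom (Functor.congr_obj hR' y.pt) := by
  have e := map_bar hR' (inv i)
  simp only [Functor.map_comp, h, e, eqToHom_map, Category.assoc, eqToHom_trans_assoc]
  simp

end HFix

section

variable {C : Type u} [SmallCategory C] {J : GrothendieckTopology C}

namespace IsLocEquiv

variable {X Y : Cᵒᵖ ⥤ Grpd.{u, u}} {η : X ⟶ Y}

/-- Local fullness at an arrow is a local property. -/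
lemma full_of_loc {U : C} {x x' : Sec X U} {m : (sec η U).obj x ⟶ (sec η U).obj x'}
    (h : Loc J U (fun V f ↦ Loc J V (fun W g ↦ ∃ n : (res X g).obj ((res X f).obj x) ⟶
      (res X g).obj ((res X f).obj x'), (sec η W).map n =
        eqToHom (res_sec_obj η g _) ≫ (res Y g).map (eqToHom (res_sec_obj η f x) ≫
          (res Y f).map m ≫ eqToHom (res_sec_obj η f x').symm) ≫
            eqToHom (res_sec_obj η g _).symm))) :
    Loc J U (fun V f ↦ ∃ n : (res X f).obj x ⟶ (res X f).obj x', (sec η V).map n =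
      eqToHom (res_sec_obj η f x) ≫ (res Y f).map m ≫ eqToHom (res_sec_obj η f x').symm) := by
  refine h.bind fun V f hf ↦ hf.mono ?_
  rintro W g ⟨n, hn⟩
  refine ⟨eqToHom (res_comp_obj X g f x) ≫ n ≫ eqToHom (res_comp_obj X g f x').symm, ?_⟩
  rw [Functor.map_comp, Functor.map_comp, hn, res_comp_map]
  simp [eqToHom_map]

/-- Local essential surjectivity at an object is a local property. -/
lemma essSurj_of_loc {U : C} {y : Sec Y U} (h : Loc J U (fun V f ↦ Loc J V (fun W g ↦
      ∃ x : Sec X W, Nonempty ((sec η W).obj x ⟶ (res Y g).obj ((res Y f).obj y))))) :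
    Loc J U (fun V f ↦ ∃ x : Sec X V, Nonempty ((sec η V).obj x ⟶ (res Y f).obj y)) := by
  refine h.bind fun V f hf ↦ hf.mono ?_
  rintro W g ⟨x, ⟨i⟩⟩
  exact ⟨x, ⟨i ≫ eqToHom (res_comp_obj Y g f y).symm⟩⟩

end IsLocEquiv

variable {X Y : PreGrpdAct C} {η : X ⟶ Y}

/-- The action on sections. -/
abbrev secBar (X : PreGrpdAct C) (U : C) : Sec X.toPreGrpd U ⥤ Sec X.toPreGrpd U :=
  HFix.bar (X.obj (op U))

lemma secBar_secBar (X : PreGrpdAct C) (U : C) : secBar X U ⋙ secBar X U = 𝟭 _ :=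
  HFix.bar_comp_bar (X.obj (op U))

lemma secBar_res (X : PreGrpdAct C) {V U : C} (f : V ⟶ U) :
    secBar X U ⋙ res X.toPreGrpd f = res X.toPreGrpd f ⋙ secBar X V := (X.map f.op).comm _

lemma secBar_sec (η : X ⟶ Y) (U : C) :
    secBar X U ⋙ sec (PreGrpdAct.forgetMap η) U = sec (PreGrpdAct.forgetMap η) U ⋙ secBar Y U :=
  (η.app (op U)).comm _

/-- Homotopy fixed points preserve local equivalences. -/
theorem IsLocEquiv.hFixedMap (h : IsLocEquiv J (PreGrpdAct.forgetMap η)) :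
    IsLocEquiv J (PreGrpdAct.hFixedMap η) where
  faithful {U p q m m'} e :=
    (h.faithful (m := HFix.Hom.hom m) (m' := HFix.Hom.hom m') (congrArg HFix.Hom.hom e)).mono
      fun V f hf ↦ HFix.Hom.ext hf
  full {U p q} m := by
    refine full_of_loc ((h.full (x := p.pt) (x' := q.pt) (HFix.Hom.hom m)).mono ?_)
    rintro V f ⟨n, hn⟩
    obtain ⟨m', hm'⟩ : ∃ m' : (sec (PreGrpdAct.hFixedMap η) V).obj ((res X.hFixed f).obj p) ⟶
        (sec (PreGrpdAct.hFixedMap η) V).obj ((res X.hFixed f).obj q), m' =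
          eqToHom (res_sec_obj (PreGrpdAct.hFixedMap η) f p) ≫ (res Y.hFixed f).map m ≫
            eqToHom (res_sec_obj (PreGrpdAct.hFixedMap η) f q).symm := ⟨_, rfl⟩
    rw [← hm']
    have hn' : (sec (PreGrpdAct.forgetMap η) V).map n = HFix.Hom.hom m' := by
      rw [hn, hm']
      refine Eq.symm ((HFix.comp_hom _ _).trans ?_)
      refine congrArg₂ (· ≫ ·) (HFix.eqToHom_hom _) ((HFix.comp_hom _ _).trans ?_)
      exact congrArg (_ ≫ ·) (HFix.eqToHom_hom _)
    -- The underlying arrow has been lifted to `n`. Compatibility of `n` with the structure arrows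
    -- holds after `η`, hence in `X` after one more covering.
    refine (h.faithful (HFix.map_comm (secBar_sec η V) m' n hn')).mono fun W g hg ↦ ?_
    obtain ⟨k, hk⟩ := HFix.exists_hom_map (hσ' := secBar_secBar X W) (secBar_res X g)
      (p := (res X.hFixed f).obj p) (q := (res X.hFixed f).obj q) n hg
    refine ⟨k, HFix.Hom.ext ?_⟩
    refine (congrArg (sec (PreGrpdAct.forgetMap η) W).map hk).trans ?_
    refine (res_sec_map (PreGrpdAct.forgetMap η) g n).trans ?_
    rw [hn']
    refine Eq.symm ((HFix.comp_hom _ _).trans ?_)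
    refine congrArg₂ (· ≫ ·) (HFix.eqToHom_hom _) ((HFix.comp_hom _ _).trans ?_)
    exact congrArg (_ ≫ ·) (HFix.eqToHom_hom _)
  essSurj {U} y := by
    -- Once the structure arrow has a lift `φ`, the arrow `φ ≫ φ̄` becomes an identity under `η`. By
    -- local faithfulness it is an identity on a covering, where `φ` defines a homotopy fixed point.
    have step : ∀ {U : C} (y : Sec Y.hFixed U) {x : Sec X.toPreGrpd U}
        (i : (sec (PreGrpdAct.forgetMap η) U).obj x ⟶ y.pt) (φ : x ⟶ (secBar X U).obj x)
        (_ : (sec (PreGrpdAct.forgetMap η) U).map φ ≫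
          eqToHom (Functor.congr_obj (secBar_sec η U) x) ≫ (secBar Y U).map i = i ≫ y.iso),
        Loc J U (fun V f ↦ ∃ x : Sec X.hFixed V,
          Nonempty ((sec (PreGrpdAct.hFixedMap η) V).obj x ⟶ (res Y.hFixed f).obj y)) :=
      fun {U} y {x} i φ hφ ↦ (h.faithful (HFix.map_lift_comp_bar (hσ := secBar_secBar X U)
        (hσ' := secBar_secBar Y U) (secBar_sec η U) hφ)).mono fun V f hf ↦
          HFix.exists_lift (hσ := secBar_secBar X U) (secBar_sec η U) (secBar_sec η V) (secBar_res X f) (secBar_res Y f)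
            (res_sec (PreGrpdAct.forgetMap η) f) hφ hf
    refine essSurj_of_loc ((h.essSurj y.pt).mono ?_)
    rintro V f ⟨x, ⟨i⟩⟩
    obtain ⟨y', hy'⟩ : ∃ y', y' = (res Y.hFixed f).obj y := ⟨_, rfl⟩
    obtain ⟨i', -⟩ : ∃ i' : (sec (PreGrpdAct.forgetMap η) V).obj x ⟶ y'.pt, True :=
      ⟨i ≫ eqToHom (by rw [hy']; rfl), trivial⟩
    rw [← hy']
    have : IsIso i' := IsIso.of_groupoid (C := Sec Y.toPreGrpd V) i'
    -- Conjugating the structure arrow of `y'` by `i'` gives an arrow from the image of `x` to the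
    -- image of `x̄`, which local fullness lifts.
    refine essSurj_of_loc ((h.full (x := x) (x' := (secBar X V).obj x) (i' ≫ y'.iso ≫
      (secBar Y V).map (inv i') ≫ eqToHom (Functor.congr_obj (secBar_sec η V) x).symm)).mono ?_)
    rintro W g ⟨φ, hφ⟩
    refine step ((res Y.hFixed g).obj y') (x := (res X.toPreGrpd g).obj x)
      (eqToHom (res_sec_obj (PreGrpdAct.forgetMap η) g x) ≫ (res Y.toPreGrpd g).map i')
      (φ ≫ eqToHom (Functor.congr_obj (secBar_res X g) x)) ?_
    exact HFix.lift_comm (secBar_sec η V) (secBar_sec η W) (secBar_res X g) (secBar_res Y g)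
      (res_sec (PreGrpdAct.forgetMap η) g) hφ

end

/-! ### Torsors realized in an object, and their gluing. -/

section Torsors

variable {C : Type u} [SmallCategory C] {J : GrothendieckTopology C} {X Z : Cᵒᵖ ⥤ Grpd.{u, u}}

/-- A torsor under `X` realized in `z`: a class of arrows from objects of `X` to `z` that is
locally non-empty and in which any two arrows locally differ by an arrow of `X`. -/
structure Tors (J : GrothendieckTopology C) (g : FunOver X Z) (z : Tot Z) : Type u where
  mem ⦃x : Tot X⦄ : (g.o x ⟶ z) → Prop
  res ⦃x x' : Tot X⦄ (j : x' ⟶ x) {m : g.o x ⟶ z} : mem m → mem (g.map j ≫ m)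
  loc ⦃x : Tot X⦄ {m : g.o x ⟶ z} : Loc J x.base (fun V f ↦ ∃ (x₁ : Sec X V)
    (r : (⟨V, x₁⟩ : Tot X) ⟶ x), Tot.bs r = f ∧ mem (g.map r ≫ m)) → mem m
  ne : Loc J z.base (fun V f ↦ ∃ (x : Sec X V) (m : g.o ⟨V, x⟩ ⟶ z), Tot.bs m = f ∧ mem m)
  tors ⦃x x' : Tot X⦄ {m : g.o x ⟶ z} {m' : g.o x' ⟶ z} : mem m → mem m' →
    ∀ h : x.base ⟶ x'.base, Tot.bs (a := g.o x) (b := z) m =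
      h ≫ Tot.bs (a := g.o x') (b := z) m' → Loc J x.base (fun V f ↦ ∃ (x₁ : Sec X V)
      (r : (⟨V, x₁⟩ : Tot X) ⟶ x) (n : (⟨V, x₁⟩ : Tot X) ⟶ x'), Tot.bs r = f ∧ Tot.bs n = f ≫ h ∧
        g.map r ≫ m = g.map n ≫ m')

namespace Tors

variable {g : FunOver X Z} {z z' : Tot Z}

lemma ext' {P Q : Tors J g z} (h : ∀ ⦃x : Tot X⦄ (m : g.o x ⟶ z), P.mem m ↔ Q.mem m) : P = Q := by
  obtain ⟨p, _, _, _, _⟩ := P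
  obtain ⟨q, _, _, _, _⟩ := Q
  obtain rfl : p = q := by
    funext x m
    exact propext (h m)
  rfl

lemma mem_congr (P : Tors J g z) ⦃x : Tot X⦄ {m m' : g.o x ⟶ z} (h : m = m') (hm : P.mem m) :
    P.mem m' := h ▸ hm

/-- Torsors with the same support are comparable only if they are equal. -/
lemma mem_of_le {P Q : Tors J g z} (h : ∀ ⦃x : Tot X⦄ (m : g.o x ⟶ z), P.mem m → Q.mem m)
    ⦃x : Tot X⦄ {m : g.o x ⟶ z} (hm : Q.mem m) : P.mem m := by
  -- Locally `P` has a member `m₀`, which also lies in `Q`. There `m` and `m₀` differ by an arrow of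
  -- `X`, so `m` lies in `P`.
  refine P.loc ((P.ne.pullback (Tot.bs m)).bind ?_)
  rintro V f ⟨x₀, m₀, hb, h₀⟩
  refine (Q.tors (Q.res (Tot.cart x f) hm) (h _ h₀) (𝟙 V) ?_).mono ?_
  · rw [Tot.comp_bs, hb, FunOver.map_bs, Tot.cart_bs]
    exact (Category.id_comp _).symm
  · rintro W f' ⟨x₁, r, n, rfl, -, e⟩
    refine ⟨x₁, r ≫ Tot.cart x f, Tot.comp_bs _ _, ?_⟩
    rw [FunOver.map_comp, Category.assoc, e]
    exact P.res n h₀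

/-- The pullback of a torsor. -/
def pull (μ : z' ⟶ z) (P : Tors J g z) : Tors J g z' where
  mem _ m := P.mem (m ≫ μ)
  res _ _ j m h := by
    rw [Category.assoc]
    exact P.res j h
  loc x m h := P.loc (h.mono fun V f ⟨x₁, r, hr, hm⟩ ↦ ⟨x₁, r, hr, by rwa [Category.assoc] at hm⟩)
  ne := (P.ne.pullback (Tot.bs μ)).mono fun V f ⟨x, m, hb, hm⟩ ↦ by
    obtain ⟨m', hb', rfl⟩ := Tot.exists_lift m μ f hb.symm
    exact ⟨x, m', hb', hm⟩
  tors x x' m m' hm hm' h e := (P.tors hm hm' h (by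
      rw [Tot.comp_bs, Tot.comp_bs, e, Category.assoc])).mono fun V f ⟨x₁, r, n, hr, hn, h'⟩ ↦
    ⟨x₁, r, n, hr, hn, Tot.cancel μ (by
      rw [Tot.comp_bs, Tot.comp_bs, FunOver.map_bs, FunOver.map_bs, hr, hn, e, Category.assoc])
        (by rw [Category.assoc, Category.assoc, h'])⟩

/-- The trivial torsor. -/
def of (J : GrothendieckTopology C) (g : FunOver X Z) (x : Tot X) : Tors J g (g.o x) where
  mem w m := Loc J w.base (fun V f ↦ ∃ (x₁ : Sec X V) (r : (⟨V, x₁⟩ : Tot X) ⟶ w)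
    (n : (⟨V, x₁⟩ : Tot X) ⟶ x), Tot.bs r = f ∧ g.map r ≫ m = g.map n)
  res w w' j m h := (h.pullback (Tot.bs j)).mono fun V f ⟨x₁, r, n, hr, e⟩ ↦ by
    obtain ⟨s, hs, hs'⟩ := Tot.exists_lift (Tot.cart w' f ≫ j) r (𝟙 V) (by
      rw [hr, Tot.comp_bs]; exact Category.id_comp _)
    exact ⟨_, Tot.cart w' f, s ≫ n, rfl, by
      rw [← FunOver.map_comp_assoc, ← hs', FunOver.map_comp_assoc, e, FunOver.map_comp]⟩
  loc w m h := h.bind fun V f ⟨x₁, r, hr, hm⟩ ↦ hm.mono fun W f' ⟨x₂, r', n, hr', e⟩ ↦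
    ⟨x₂, r' ≫ r, n, by rw [Tot.comp_bs, hr, hr'], by rw [FunOver.map_comp, Category.assoc, e]⟩
  ne := Loc.of_forall fun _ f ↦ ⟨_, g.map (Tot.cart x f), g.map_bs _, Loc.of_forall fun W f' ↦
    ⟨_, Tot.cart _ f', Tot.cart _ f' ≫ Tot.cart x f, rfl, (g.map_comp _ _).symm⟩⟩
  tors w w' m m' hm hm' h e := by
    refine (hm.and (hm'.pullback h)).mono ?_
    rintro V f ⟨⟨x₁, r, n, hr, hn⟩, x₁', r', n', hr', hn'⟩
    have hb := congrArg Tot.bs hn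
    have hb' := congrArg Tot.bs hn'
    rw [Tot.comp_bs, FunOver.map_bs, FunOver.map_bs, hr] at hb
    rw [Tot.comp_bs, FunOver.map_bs, FunOver.map_bs, hr', Category.assoc, ← e] at hb'
    obtain ⟨q, hq, hq'⟩ := Tot.exists_lift n n' (𝟙 V) (by
      rw [← hb, ← hb']; exact Category.id_comp _)
    refine ⟨x₁, r, q ≫ r', hr, ?_, ?_⟩
    · rw [Tot.comp_bs, hq, hr']
      exact Category.id_comp _
    · rw [hn, ← hq', FunOver.map_comp, ← hn', FunOver.map_comp, Category.assoc]

lemma of_map {x w : Tot X} (n : w ⟶ x) : (of J g x).mem (g.map n) :=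
  Loc.of_forall fun _ f ↦ ⟨_, Tot.cart w f, Tot.cart w f ≫ n, rfl, (g.map_comp _ _).symm⟩

/-- A member `m` trivializes the torsor: composition with it carries the trivial torsor of `x` into
`P`. -/
lemma mem_comp_of (P : Tors J g z) {x : Tot X} {m : g.o x ⟶ z} (hm : P.mem m) ⦃w : Tot X⦄
    {k : g.o w ⟶ g.o x} (hk : (of J g x).mem k) : P.mem (k ≫ m) :=
  P.loc (hk.mono fun V f ⟨x₁, r, n, hr, e⟩ ↦ ⟨x₁, r, hr, by
    rw [← Category.assoc, e]
    exact P.res n hm⟩)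

/-- The data for gluing torsors. -/
structure GlueData (J : GrothendieckTopology C) (g : FunOver X Z) (z : Tot Z) (S : Sieve z.base) where
  v ⦃V : C⦄ (f : V ⟶ z.base) : S f → Sec Z V
  κ ⦃V : C⦄ (f : V ⟶ z.base) (hf : S f) : (⟨V, v f hf⟩ : Tot Z) ⟶ z
  κ_bs ⦃V : C⦄ (f : V ⟶ z.base) (hf : S f) : Tot.bs (κ f hf) = f
  P ⦃V : C⦄ (f : V ⟶ z.base) (hf : S f) : Tors J g ⟨V, v f hf⟩
  mem ⦃W V : C⦄ (f' : W ⟶ z.base) (hf' : S f') (f : V ⟶ z.base) (hf : S f)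
    (t : (⟨W, v f' hf'⟩ : Tot Z) ⟶ ⟨V, v f hf⟩) (_ : t ≫ κ f hf = κ f' hf') ⦃x : Tot X⦄
    (m : g.o x ⟶ ⟨W, v f' hf'⟩) : (P f' hf').mem m → (P f hf).mem (m ≫ t)

namespace GlueData

variable {S : Sieve z.base} (D : GlueData J g z S)

/-- The arrows of the glued torsor. -/
def Mem ⦃x : Tot X⦄ (m : g.o x ⟶ z) : Prop := ∀ ⦃w : Tot X⦄ (j : w ⟶ x) ⦃V : C⦄ (f : V ⟶ z.base)
  (hf : S f) (m' : g.o w ⟶ ⟨V, D.v f hf⟩), m' ≫ D.κ f hf = g.map j ≫ m → (D.P f hf).mem m'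

/-- Both arrows factor through the object of the family over their common base `k`. Membership
passes forward by `D.mem`, and backward because an inclusion of torsors is an equality. -/
lemma mem_trans {x : Tot X} {V V' : C} {f : V ⟶ z.base} {hf : S f} {f' : V' ⟶ z.base} {hf' : S f'}
    {m : g.o x ⟶ ⟨V, D.v f hf⟩} {m' : g.o x ⟶ ⟨V', D.v f' hf'⟩}
    (e : m ≫ D.κ f hf = m' ≫ D.κ f' hf') (hm : (D.P f hf).mem m) : (D.P f' hf').mem m' := by
  have hb := congrArg Tot.bs e
  rw [Tot.comp_bs, Tot.comp_bs, D.κ_bs, D.κ_bs] at hb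
  obtain ⟨k, hk⟩ : ∃ k : x.base ⟶ z.base, k = Tot.bs m ≫ f := ⟨_, rfl⟩
  have hSk : S k := by
    rw [hk]
    exact S.downward_closed hf _
  obtain ⟨t, ht, ht'⟩ := Tot.exists_lift (D.κ k hSk) (D.κ f hf) (Tot.bs (a := g.o x) m)
    (by rw [D.κ_bs, D.κ_bs]; exact hk.symm)
  obtain ⟨t', hb', ht₁⟩ := Tot.exists_lift (D.κ k hSk) (D.κ f' hf') (Tot.bs (a := g.o x) m')
    (by rw [D.κ_bs, D.κ_bs]; exact hb.symm.trans hk.symm)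
  obtain ⟨m₀, hm₀, hm₀'⟩ := Tot.exists_lift m t (𝟙 _) (by rw [ht]; exact Category.id_comp _)
  have e' : m₀ ≫ t' = m' := by
    refine Tot.cancel (D.κ f' hf') ?_ ?_
    · rw [Tot.comp_bs, hm₀]
      exact (Category.id_comp _).trans hb'
    · rw [Category.assoc, ht₁, ← ht', ← Category.assoc, hm₀', e]
  rw [← e']
  refine D.mem _ _ _ _ t' ht₁ _ (mem_of_le (P := D.P k hSk) (Q := (D.P f hf).pull t)
    (fun _ m hm ↦ D.mem _ _ _ _ t ht' m hm) ?_)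
  change (D.P f hf).mem (m₀ ≫ t)
  rwa [hm₀']

lemma mem_iff {x : Tot X} {V : C} {f : V ⟶ z.base} {hf : S f} {m : g.o x ⟶ ⟨V, D.v f hf⟩} :
    D.Mem (m ≫ D.κ f hf) ↔ (D.P f hf).mem m := by
  constructor
  · intro h
    exact h (𝟙 x) f hf m (by rw [FunOver.map_id]; exact (Category.id_comp _).symm)
  · intro h w j V' f' hf' m' e
    refine D.mem_trans (e.trans (Category.assoc _ _ _).symm).symm ((D.P f hf).res j h)

/-- The glued torsor. -/
def glue (hS : S ∈ J z.base) : Tors J g z where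
  mem := D.Mem
  res x x' j m h w i V f hf m' e := h (i ≫ j) f hf m' (by rw [e, FunOver.map_comp, Category.assoc])
  loc x m h w j V f hf m' e := by
    refine (D.P f hf).loc ((h.pullback (Tot.bs j)).mono ?_)
    rintro W f' ⟨x₁, r, hr, hm⟩
    obtain ⟨s, hs, hs'⟩ := Tot.exists_lift (Tot.cart w f' ≫ j) r (𝟙 _) (by
      rw [hr, Tot.comp_bs]; exact Category.id_comp _)
    refine ⟨_, Tot.cart w f', rfl, hm s f hf _ ?_⟩
    rw [Category.assoc, e, ← FunOver.map_comp_assoc, ← hs', FunOver.map_comp_assoc]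
  ne := Loc.bind (Loc.of_sieve hS fun _ _ hf ↦ hf) fun _ f hf ↦ (D.P f hf).ne.mono fun W f' ⟨x, m, hb, hm⟩ ↦
    ⟨x, m ≫ D.κ f hf, by rw [Tot.comp_bs, hb, D.κ_bs], D.mem_iff.2 hm⟩
  tors x x' m m' hm hm' h e := by
    -- Where `m` lies over the sieve, both arrows factor through the same object of the family, and
    -- the torsor condition given there applies.
    refine Loc.bind (P := fun V f ↦ S (f ≫ Tot.bs m)) ⟨_, J.pullback_stable (Tot.bs m) hS, fun V f hf ↦ hf⟩ ?_
    intro V f hf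
    obtain ⟨k, hk⟩ : ∃ k : V ⟶ z.base, k = f ≫ Tot.bs m := ⟨_, rfl⟩
    rw [← hk] at hf
    obtain ⟨m₁, h₁, h₁'⟩ := Tot.exists_lift (g.map (Tot.cart x f) ≫ m) (D.κ k hf) (𝟙 V) (by
      rw [D.κ_bs, Tot.comp_bs, FunOver.map_bs, Tot.cart_bs, ← hk]; exact Category.id_comp _)
    obtain ⟨m₂, h₂, h₂'⟩ := Tot.exists_lift (g.map (Tot.cart x' (f ≫ h)) ≫ m') (D.κ k hf) (𝟙 V) (by
      rw [D.κ_bs, Tot.comp_bs, FunOver.map_bs, Tot.cart_bs]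
      exact (Category.id_comp _).trans (hk.trans ((congrArg (f ≫ ·) e).trans
        (Category.assoc _ _ _).symm)))
    refine ((D.P k hf).tors (hm _ k hf m₁ h₁') (hm' _ k hf m₂ h₂') (𝟙 V) (by
      rw [h₁, h₂]; exact (Category.id_comp _).symm)).mono ?_
    rintro W f' ⟨x₁, r, n, hr, hn, e'⟩
    refine ⟨x₁, r ≫ Tot.cart x f, n ≫ Tot.cart x' (f ≫ h), by rw [Tot.comp_bs, hr, Tot.cart_bs], ?_, ?_⟩
    · rw [Tot.comp_bs, hn, Tot.cart_bs]
      simp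
    · rw [FunOver.map_comp, FunOver.map_comp, Category.assoc, Category.assoc, ← h₁', ← h₂',
        ← Category.assoc, e', Category.assoc]

end GlueData

end Tors

end Torsors

/-! ### The presheaf of torsors is a stack whose objects glue strictly. -/

section TorsorStack

variable {C : Type u} [SmallCategory C] {J : GrothendieckTopology C} {X Z : Cᵒᵖ ⥤ Grpd.{u, u}}

namespace Tot

/-- The cartesian arrow `(V, x) ⟶ (U, y)` for a section `x` that is the restriction of `y`. -/
def strict {V U : C} (f : V ⟶ U) {x : Sec X V} {y : Sec X U} (e : (res X f).obj y = x) :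
    (⟨V, x⟩ : Tot X) ⟶ ⟨U, y⟩ :=
  vert (eqToHom e.symm) ≫ cart ⟨U, y⟩ f

lemma strict_bs {V U : C} (f : V ⟶ U) {x : Sec X V} {y : Sec X U} (e : (res X f).obj y = x) :
    bs (strict f e) = f := (comp_bs _ _).trans (Category.id_comp _)

lemma strict_rfl {V U : C} (f : V ⟶ U) (y : Sec X U) :
    strict f (rfl : (res X f).obj y = _) = cart ⟨U, y⟩ f :=
  (congrArg (· ≫ _) (vert_id _)).trans (Category.id_comp _)

lemma cart_vert_eqToHom {V U : C} (f : V ⟶ U) {x y : Sec X U} (h : x = y) :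
    cart ⟨U, x⟩ f ≫ vert (eqToHom h) =
      vert (eqToHom (congrArg (res X f).obj h)) ≫ cart ⟨U, y⟩ f := by
  subst h
  exact (cart_vert f _).trans (by rw [eqToHom_refl, eqToHom_refl, CategoryTheory.Functor.map_id])

lemma vert_eqToHom_strict {V U : C} (f : V ⟶ U) {x x' : Sec X V} {y : Sec X U}
    (e : (res X f).obj y = x) (h : x' = x) :
    vert (eqToHom h) ≫ strict f e = strict f (e.trans h.symm) := by
  subst h
  exact (congrArg (· ≫ _) (vert_id _)).trans (Category.id_comp _)

lemma strict_comp_strict {W V U : C} (g : W ⟶ V) (f : V ⟶ U) {w : Sec X W} {x : Sec X V}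
    {y : Sec X U} (e' : (res X g).obj x = w) (e : (res X f).obj y = x) :
    strict g e' ≫ strict f e =
      strict (g ≫ f) ((res_comp_obj X g f y).trans ((congrArg _ e).trans e')) := by
  subst e e'
  rw [strict_rfl, strict_rfl]
  exact cart_comp_cart ⟨U, y⟩ f g

end Tot

lemma FunOver.ofNat_strict (η : X ⟶ Z) {V U : C} (f : V ⟶ U) {x : Sec X V} {y : Sec X U}
    (e : (res X f).obj y = x) : (FunOver.ofNat η).map (Tot.strict f e) =
      Tot.strict f ((res_sec_obj η f y).symm.trans (congrArg (sec η V).obj e)) := by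
  subst e
  rw [Tot.strict_rfl]
  exact FunOver.ofNat_cart η ⟨U, y⟩ f

/-- An object of the groupoid of torsors over `U`: a section of `Z` over `U` and a torsor realized
in it. -/
structure TorsObj (J : GrothendieckTopology C) (g : FunOver X Z) (U : C) : Type u where
  pt : Sec Z U
  tors : Tors J g ⟨U, pt⟩

namespace TorsObj

variable {g : FunOver X Z} {U V : C}

/-- Arrows between torsors. -/
@[ext]
structure Hom (p q : TorsObj J g U) : Type u where
  hom : p.pt ⟶ q.pt
  mem ⦃x : Tot X⦄ (m : g.o x ⟶ ⟨U, p.pt⟩) : p.tors.mem m → q.tors.mem (m ≫ Tot.vert hom)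

lemma Hom.mem_iff {p q : TorsObj J g U} (h : Hom p q) ⦃x : Tot X⦄ (m : g.o x ⟶ ⟨U, p.pt⟩) :
    q.tors.mem (m ≫ Tot.vert h.hom) ↔ p.tors.mem m :=
  ⟨fun hm ↦ Tors.mem_of_le (P := p.tors) (Q := q.tors.pull (Tot.vert h.hom)) h.mem hm, h.mem m⟩

instance : Groupoid (TorsObj J g U) where
  Hom := Hom
  id p := ⟨𝟙 _, fun x m hm ↦ by rwa [Tot.vert_id, Category.comp_id]⟩
  comp h k := ⟨h.hom ≫ k.hom, fun x m hm ↦ by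
    rw [Tot.vert_comp, ← Category.assoc]
    exact k.mem _ (h.mem _ hm)⟩
  id_comp _ := Hom.ext (Category.id_comp _)
  comp_id _ := Hom.ext (Category.comp_id _)
  assoc _ _ _ := Hom.ext (Category.assoc _ _ _)
  inv h := ⟨Groupoid.inv h.hom, fun x m hm ↦ (h.mem_iff _).1 (by
    rwa [Category.assoc, ← Tot.vert_comp, Groupoid.inv_comp, Tot.vert_id, Category.comp_id])⟩
  inv_comp _ := Hom.ext (Groupoid.inv_comp _)
  comp_inv _ := Hom.ext (Groupoid.comp_inv _)

/-- The section of `Z` in which a torsor is realized. -/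
@[simps]
def forget (J : GrothendieckTopology C) (g : FunOver X Z) (U : C) : TorsObj J g U ⥤ Sec Z U where
  obj p := p.pt
  map h := Hom.hom h

instance : (forget J g U).Faithful := ⟨fun h ↦ Hom.ext h⟩

lemma ext' {p q : TorsObj J g U} (h : p.pt = q.pt) (hm : ∀ ⦃x : Tot X⦄ (m : g.o x ⟶ ⟨U, p.pt⟩),
    p.tors.mem m → q.tors.mem (m ≫ Tot.vert (eqToHom h))) : p = q := by
  obtain ⟨p, P⟩ := p
  obtain ⟨q, Q⟩ := q
  obtain rfl : p = q := h
  have hm' : ∀ ⦃x : Tot X⦄ (m : g.o x ⟶ ⟨U, p⟩), P.mem m → Q.mem m := fun x m h ↦ by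
    have := hm m h
    rwa [eqToHom_refl, Tot.vert_id, Category.comp_id] at this
  obtain rfl : P = Q := Tors.ext' fun x m ↦ ⟨hm' m, fun h ↦ Tors.mem_of_le hm' h⟩
  rfl

lemma mem_of_eq {p q : TorsObj J g U} (h : p = q) ⦃x : Tot X⦄ (m : g.o x ⟶ ⟨U, p.pt⟩)
    (hm : p.tors.mem m) : q.tors.mem (m ≫ Tot.vert (eqToHom (congrArg pt h))) := by
  subst h
  rwa [eqToHom_refl, Tot.vert_id, Category.comp_id]

lemma functor_ext {D : Type*} [Category* D] {F G : D ⥤ TorsObj J g U} (h : ∀ d, F.obj d = G.obj d)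
    (hm : F ⋙ forget J g U = G ⋙ forget J g U) : F = G := by
  refine CategoryTheory.Functor.ext h fun d e φ ↦ (forget J g U).map_injective ?_
  have := CategoryTheory.Functor.congr_hom hm φ
  rw [Functor.map_comp, Functor.map_comp, eqToHom_map, eqToHom_map]
  exact this

/-- The restriction of torsors. -/
def res (J : GrothendieckTopology C) (g : FunOver X Z) (f : V ⟶ U) :
    TorsObj J g U ⥤ TorsObj J g V where
  obj p := ⟨(_root_.res Z f).obj p.pt, p.tors.pull (Tot.cart ⟨U, p.pt⟩ f)⟩
  map {p q} h := ⟨(_root_.res Z f).map (Hom.hom h), fun x m hm ↦ by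
    have := Hom.mem h _ hm
    rw [Category.assoc, Tot.cart_vert, ← Category.assoc] at this
    exact this⟩
  map_id p := Hom.ext ((_root_.res Z f).map_id _)
  map_comp h k := Hom.ext ((_root_.res Z f).map_comp _ _)

lemma res_id (U : C) : res J g (𝟙 U) = 𝟭 _ :=
  functor_ext (fun p ↦ ext' (res_id_obj Z p.pt) fun _ m hm ↦
    p.tors.mem_congr (congrArg (m ≫ ·) (Tot.cart_id ⟨U, p.pt⟩)) hm) (congrArg (forget J g U ⋙ ·) (_root_.res_id Z U))

lemma res_comp {W : C} (f' : W ⟶ V) (f : V ⟶ U) : res J g (f' ≫ f) = res J g f ⋙ res J g f' :=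
  functor_ext (fun p ↦ (ext' (p := (res J g f').obj ((res J g f).obj p))
    (q := (res J g (f' ≫ f)).obj p) (res_comp_obj Z f' f p.pt).symm fun _ m hm ↦
      p.tors.mem_congr ((Category.assoc _ _ _).trans ((congrArg (m ≫ ·)
        (Tot.cart_comp_cart ⟨U, p.pt⟩ f f')).trans (Category.assoc _ _ _).symm)) hm).symm) (congrArg (forget J g U ⋙ ·) (_root_.res_comp Z f' f))

end TorsObj

/-- The presheaf of groupoids of torsors. -/
def torsPsh (J : GrothendieckTopology C) (g : FunOver X Z) : Cᵒᵖ ⥤ Grpd.{u, u} where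
  obj U := Grpd.of (TorsObj J g U.unop)
  map f := TorsObj.res J g f.unop
  map_id U := TorsObj.res_id U.unop
  map_comp f f' := TorsObj.res_comp f'.unop f.unop

/-- The morphism from torsors to `Z`. -/
def torsForget (J : GrothendieckTopology C) (g : FunOver X Z) : torsPsh J g ⟶ Z where
  app U := TorsObj.forget J g U.unop
  naturality _ _ _ := rfl

namespace torsPsh

variable {g : FunOver X Z} {U V : C}

/-- The section of `Z` underlying a section of `torsPsh J g`. -/
def pt (p : Sec (torsPsh J g) U) : Sec Z U := TorsObj.pt (J := J) (g := g) p

/-- The torsor underlying a section of `torsPsh J g`. -/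
def tors (p : Sec (torsPsh J g) U) : Tors J g ⟨U, pt p⟩ := TorsObj.tors (J := J) (g := g) p

lemma exists_sec (z : Sec Z U) (P : Tors J g ⟨U, z⟩) :
    ∃ (p : Sec (torsPsh J g) U) (h : pt p = z), ∀ ⦃x : Tot X⦄ (m : g.o x ⟶ ⟨U, pt p⟩),
      (tors p).mem m ↔ P.mem (m ≫ Tot.vert (eqToHom h)) :=
  ⟨(⟨z, P⟩ : TorsObj J g U), rfl, fun _ m ↦ iff_of_eq (congrArg (P.mem (x := _))
    ((congrArg (m ≫ ·) (Tot.vert_id z)).trans (Category.comp_id _)).symm)⟩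

lemma sec_ext {p q : Sec (torsPsh J g) U} (h : pt p = pt q)
    (hm : ∀ ⦃x : Tot X⦄ (m : g.o x ⟶ ⟨U, pt p⟩),
      (tors p).mem m → (tors q).mem (m ≫ Tot.vert (eqToHom h))) : p = q :=
  TorsObj.ext' (J := J) (g := g) h hm

lemma mem_of_eq {p q : Sec (torsPsh J g) U} (h : p = q) ⦃x : Tot X⦄ (m : g.o x ⟶ ⟨U, pt p⟩)
    (hm : (tors p).mem m) : (tors q).mem (m ≫ Tot.vert (eqToHom (congrArg pt h))) :=
  TorsObj.mem_of_eq (J := J) (g := g) h m hm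

/-- The functor over `C` from torsors to `Z`. -/
abbrev theta (J : GrothendieckTopology C) (g : FunOver X Z) : FunOver (torsPsh J g) Z where
  obj p := pt p
  map φ := (FunOver.ofNat (torsForget J g)).map φ
  map_bs φ := (FunOver.ofNat (torsForget J g)).map_bs φ
  map_id φ := (FunOver.ofNat (torsForget J g)).map_id φ
  map_comp φ ψ := (FunOver.ofNat (torsForget J g)).map_comp φ ψ

lemma theta_strict (f : V ⟶ U) {p : Sec (torsPsh J g) V} {q : Sec (torsPsh J g) U}
    (e : (res (torsPsh J g) f).obj q = p) : (theta J g).map (Tot.strict f e) =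
      Tot.strict (x := pt p) (y := pt q) f (congrArg pt e) :=
  FunOver.ofNat_strict (torsForget J g) f e

lemma theta_cart (p : Tot (torsPsh J g)) (f : V ⟶ p.base) :
    (theta J g).map (Tot.cart p f) = Tot.cart ⟨p.base, pt p.pt⟩ f :=
  (FunOver.ofNat_cart (torsForget J g) p f).trans
    ((congrArg (· ≫ Tot.cart ⟨p.base, pt p.pt⟩ f) (Tot.vert_id _)).trans (Category.id_comp _))

lemma theta_vert {p q : Sec (torsPsh J g) U} (h : p ⟶ q) :
    (theta J g).map (Tot.vert h) = Tot.vert (x := pt p) (y := pt q) (TorsObj.Hom.hom h) :=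
  FunOver.ofNat_vert (torsForget J g) h

lemma theta_map {a b : Tot (torsPsh J g)} (φ : a ⟶ b) {f : a.base ⟶ b.base} (hf : Tot.bs φ = f) :
    (theta J g).map φ = Tot.vert (x := pt a.pt) (y := (res Z f).obj (pt b.pt))
      (TorsObj.Hom.hom (Tot.vat φ f hf)) ≫ Tot.cart ⟨b.base, pt b.pt⟩ f :=
  (FunOver.ofNat_map (torsForget J g) φ hf).trans
    (congrArg (fun k ↦ Tot.vert (x := pt a.pt) (y := (res Z f).obj (pt b.pt)) k ≫
      Tot.cart ⟨b.base, pt b.pt⟩ f) (Category.comp_id _))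

lemma theta_mem {a b : Tot (torsPsh J g)} (φ : a ⟶ b) ⦃x : Tot X⦄ {m : g.o x ⟶ (theta J g).o a} :
    (tors b.pt).mem (m ≫ (theta J g).map φ) ↔ (tors a.pt).mem m := by
  refine (iff_of_eq (congrArg (fun k ↦ (tors b.pt).mem k) ((congrArg (m ≫ ·)
    (theta_map φ rfl)).trans (Category.assoc _ _ _).symm))).trans ?_
  exact TorsObj.Hom.mem_iff (Tot.vat φ _ rfl) m

lemma exists_theta_vert {p q : Sec (torsPsh J g) U} (k : pt p ⟶ pt q)
    (hk : ∀ ⦃x : Tot X⦄ (m : g.o x ⟶ ⟨U, pt p⟩), (tors p).mem m → (tors q).mem (m ≫ Tot.vert k)) :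
    ∃ h : p ⟶ q, (theta J g).map (Tot.vert h) = Tot.vert k :=
  ⟨(⟨k, hk⟩ : TorsObj.Hom (J := J) (g := g) p q), theta_vert _⟩

/-- `theta` is full on the arrows of `Z` that respect the torsors, and faithful by
`theta_injective`. Gluing problems for torsors are therefore solved in `Z`, and only membership has
to be checked. -/
lemma exists_theta {a b : Tot (torsPsh J g)} (ψ : (theta J g).o a ⟶ (theta J g).o b)
    (hψ : ∀ ⦃x : Tot X⦄ (m : g.o x ⟶ (theta J g).o a), (tors a.pt).mem m →
      (tors b.pt).mem (m ≫ ψ)) : ∃ φ : a ⟶ b, (theta J g).map φ = ψ := by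
  obtain ⟨f, hf⟩ : ∃ f : a.base ⟶ b.base, f = Tot.bs (b := (theta J g).o b) ψ := ⟨_, rfl⟩
  obtain ⟨h, hh⟩ := exists_theta_vert (p := a.pt) (q := (res (torsPsh J g) f).obj b.pt)
    (Tot.vat (b := (theta J g).o b) ψ f hf.symm) (fun x m hm ↦ (tors b.pt).mem_congr
      ((congrArg (m ≫ ·) (Tot.vert_cart (b := (theta J g).o b) ψ hf.symm).symm).trans
        (Category.assoc _ _ _).symm) (hψ m hm))
  refine ⟨Tot.vert h ≫ Tot.cart b f, ((theta J g).map_comp _ _).trans ?_⟩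
  rw [theta_cart]
  refine (congrArg (· ≫ _) hh).trans ?_
  exact Tot.vert_cart (b := (theta J g).o b) ψ hf.symm

lemma theta_injective {a b : Tot (torsPsh J g)} {φ φ' : a ⟶ b}
    (h : (theta J g).map φ = (theta J g).map φ') : φ = φ' := by
  obtain ⟨f, hf⟩ : ∃ f : a.base ⟶ b.base, Tot.bs φ' = f := ⟨_, rfl⟩
  have hb : Tot.bs φ = f := by rw [← FunOver.map_bs (theta J g), h, FunOver.map_bs, hf]
  refine Tot.hom_ext f hb hf (TorsObj.Hom.ext (Tot.vert_injective ?_))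
  refine Tot.cancel (a := ⟨a.base, pt a.pt⟩) (b := ⟨a.base, (res Z f).obj (pt b.pt)⟩)
    (Tot.cart ⟨b.base, pt b.pt⟩ f) rfl ?_
  exact (theta_map φ hb).symm.trans (h.trans (theta_map φ' hf))

end torsPsh

end TorsorStack

/-- After `s` is factored through a vertical `s₀`, the arrow `c'` is the lift of `c ≫ r` through
`r'`; uniqueness of lifts shows that `s'` has the same vertical part. -/
lemma FunOver.exists_factor₂ {C : Type u} [SmallCategory C] {X Z : Cᵒᵖ ⥤ Grpd.{u, u}}
    (F : FunOver X Z) {w : Tot Z} {v v' z : Tot X} {r : v ⟶ z} {r' : v' ⟶ z} {s : w ⟶ F.o v}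
    {s' : w ⟶ F.o v'} (e : s ≫ F.map r = s' ≫ F.map r') :
    ∃ (v₁ : Sec X w.base) (s₀ : w ⟶ F.o ⟨w.base, v₁⟩) (c : (⟨w.base, v₁⟩ : Tot X) ⟶ v)
      (c' : (⟨w.base, v₁⟩ : Tot X) ⟶ v'), s = s₀ ≫ F.map c ∧ s' = s₀ ≫ F.map c' ∧
        c ≫ r = c' ≫ r' := by
  obtain ⟨v₁, c, s₀, hs₀, hc, rfl⟩ := F.exists_factor s
  obtain ⟨c', hc', e'⟩ := Tot.exists_lift (c ≫ r) r' (Tot.bs (b := F.o v') s') (by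
    have := congrArg Tot.bs e
    rw [Tot.comp_bs, Tot.comp_bs, Tot.comp_bs, hs₀, FunOver.map_bs, FunOver.map_bs,
      FunOver.map_bs] at this
    refine this.symm.trans ?_
    rw [Tot.comp_bs]
    exact congrArg (· ≫ _) (Category.id_comp _))
  refine ⟨v₁, s₀, c, c', rfl, (Tot.cancel (F.map r') ?_ ?_).symm, e'.symm⟩
  · rw [Tot.comp_bs, hs₀, FunOver.map_bs]
    exact (Category.id_comp _).trans hc'
  · rw [← e, Category.assoc, Category.assoc, ← FunOver.map_comp, ← FunOver.map_comp, e']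

namespace torsPsh

variable {C : Type u} [SmallCategory C] {J : GrothendieckTopology C} {X Z : Cᵒᵖ ⥤ Grpd.{u, u}}
  {g : FunOver X Z} {U V : C}

lemma exists_factor_mem {a : Tot (torsPsh J g)} {x : Tot X} {m : g.o x ⟶ (theta J g).o a}
    (hm : (tors a.pt).mem m) {V : C} (f : V ⟶ x.base) {k : V ⟶ a.base}
    (hk : k = f ≫ Tot.bs (a := g.o x) (b := (theta J g).o a) m) :
    ∃ m₁ : g.o ⟨V, (res X f).obj x.pt⟩ ⟶ (theta J g).o ⟨V, (res (torsPsh J g) k).obj a.pt⟩,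
      m₁ ≫ (theta J g).map (Tot.cart a k) = g.map (Tot.cart x f) ≫ m ∧
        (tors ((res (torsPsh J g) k).obj a.pt)).mem m₁ := by
  obtain ⟨m₁, -, h⟩ := Tot.exists_lift (g.map (Tot.cart x f) ≫ m) ((theta J g).map (Tot.cart a k))
    (𝟙 V) (by rw [FunOver.map_bs, Tot.comp_bs, FunOver.map_bs]; exact (Category.id_comp _).trans hk)
  refine ⟨m₁, h, (theta_mem (Tot.cart a k)).1 ?_⟩
  exact (tors a.pt).mem_congr h.symm (Tors.res _ _ hm)

/-- Torsors form a stack. -/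
theorem totStack (hZ : TotStack J Z) : TotStack J (torsPsh J g) where
  sep z z' h h' hb loc := by
    refine theta_injective (hZ.sep _ _ _ _ (by rw [FunOver.map_bs, FunOver.map_bs, hb])
      (loc.mono fun V f e ↦ ?_))
    have := congrArg (theta J g).map e
    rw [FunOver.map_comp, FunOver.map_comp, theta_cart] at this
    exact this
  glue z z' b S hS β hβ compat := by
    have β_congr : ∀ {v : Tot (torsPsh J g)} {q q' : v ⟶ z} (_ : q = q') (hq : S (Tot.bs q))
        (hq' : S (Tot.bs q')), β v q hq = β v q' hq' := by
      rintro v q _ rfl _ _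
      rfl
    obtain ⟨h, hb, hh⟩ := hZ.glue_family (z := (theta J g).o z) (z' := (theta J g).o z') b
      (fun i : Σ v : Tot (torsPsh J g), {r : v ⟶ z // S (Tot.bs r)} ↦ (theta J g).o i.1)
      (fun i ↦ (theta J g).map i.2.1) (fun i ↦ (theta J g).map (β i.1 i.2.1 i.2.2))
      (fun i ↦ by rw [FunOver.map_bs, FunOver.map_bs, hβ])
      ⟨S, hS, fun V f hf ↦ ⟨⟨_, Tot.cart z f, hf⟩, 𝟙 V, by
        rw [FunOver.map_bs]; exact Category.id_comp _⟩⟩ (by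
      rintro ⟨v, r, hr⟩ ⟨v', r', hr'⟩ w s s' e
      obtain ⟨v₁, s₀, c, c', rfl, rfl, e'⟩ := (theta J g).exists_factor₂ (r := r) (r' := r') e
      refine (Category.assoc _ _ _).trans (Eq.trans (congrArg (s₀ ≫ ·) ?_)
        (Category.assoc _ _ _).symm)
      refine ((theta J g).map_comp _ _).symm.trans (Eq.trans ?_ ((theta J g).map_comp _ _))
      rw [← compat _ _ c r hr (by rw [Tot.comp_bs]; exact S.downward_closed hr _),
        ← compat _ _ c' r' hr' (by rw [Tot.comp_bs]; exact S.downward_closed hr' _), β_congr e'])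
    obtain ⟨k, hk⟩ := exists_theta h (fun x m hm ↦ by
      -- Membership is local on the source, and over the sieve `h` is given by arrows that already
      -- respect the torsors.
      refine (tors z'.pt).loc ⟨S.pullback (Tot.bs (a := g.o x) (b := (theta J g).o z) m),
        J.pullback_stable _ hS, fun V f hf ↦ ⟨_, Tot.cart x f, rfl, ?_⟩⟩
      obtain ⟨m₁, e, hm₁⟩ := exists_factor_mem hm f rfl
      refine (tors z'.pt).mem_congr ?_
        ((theta_mem (β _ (Tot.cart z (f ≫ Tot.bs (b := (theta J g).o z) m)) hf)).2 hm₁)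
      refine (congrArg (m₁ ≫ ·) (hh ⟨_, Tot.cart z _, hf⟩).symm).trans ?_
      exact (Category.assoc _ _ _).symm.trans ((congrArg (· ≫ h) e).trans (Category.assoc _ _ _)))
    refine ⟨k, by rw [← FunOver.map_bs (theta J g), hk, hb], fun v r hr ↦ theta_injective ?_⟩
    rw [FunOver.map_comp, hk]
    exact hh ⟨v, r, hr⟩
  desc U S hS z t ht comp := by
    obtain ⟨z₀, κ, hκ, hκt⟩ := hZ.desc U S hS (fun V f hf ↦ pt (z f hf))
      (fun W V f' hf' f hf h e ↦ (theta J g).map (t f' hf' f hf h e))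
      (fun W V f' hf' f hf h e ↦ by rw [FunOver.map_bs, ht])
      (fun W' W V f'' hf'' f' hf' f hf h' h e' e ↦ by rw [← FunOver.map_comp, comp])
    -- The vertex comes from descent in `Z`. The transition arrows carry the torsors of the members
    -- to one another, so these torsors glue on the vertex.
    let D : Tors.GlueData J g ⟨U, z₀⟩ S :=
      { v := fun V f hf ↦ pt (z f hf)
        κ := κ
        κ_bs := hκ
        P := fun V f hf ↦ tors (z f hf)
        mem := fun W V f' hf' f hf s hs x m hm ↦ by
          have e : Tot.bs s ≫ f = f' := (congrArg (Tot.bs s ≫ ·) (hκ f hf)).symm.trans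
            ((congrArg Tot.bs hs).trans (hκ f' hf'))
          have : s = (theta J g).map (t f' hf' f hf _ e) :=
            Tot.cancel (κ f hf) (by rw [FunOver.map_bs, ht]) (by rw [hs]; exact (hκt _ _ _ _ _ _).symm)
          rw [this]
          exact (theta_mem (t f' hf' f hf _ e)).2 hm }
    obtain ⟨p, h, hp⟩ := exists_sec z₀ (D.glue hS)
    subst h
    have hp' : ∀ ⦃x : Tot X⦄ (m : g.o x ⟶ ⟨U, pt p⟩), (tors p).mem m ↔ D.Mem m := fun x m ↦
      (hp m).trans (iff_of_eq (congrArg (fun k ↦ D.Mem k)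
        ((congrArg (m ≫ ·) (Tot.vert_id _)).trans (Category.comp_id _))))
    choose κ' hκ' using fun (V : C) (f : V ⟶ U) (hf : S f) ↦
      exists_theta (a := ⟨V, z f hf⟩) (b := ⟨U, p⟩) (κ f hf) (fun x m hm ↦ (hp' _).2 (D.mem_iff.2 hm))
    refine ⟨p, fun V f hf ↦ κ' V f hf, fun V f hf ↦ ?_, fun W V f' hf' f hf h e ↦
      theta_injective ?_⟩
    · rw [← FunOver.map_bs (theta J g), hκ', hκ]
    · rw [FunOver.map_comp, hκ', hκ']
      exact hκt _ _ _ _ _ _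

/-- When the underlying sections agree, equality amounts to one inclusion of torsors, and membership
may be tested over the sieve. -/
lemma sec_ext_of_sieve {S : Sieve U} (hS : S ∈ J U) {p q : Sec (torsPsh J g) U} (h : pt p = pt q)
    (hr : ∀ ⦃V : C⦄ (f : V ⟶ U), S f → (res (torsPsh J g) f).obj p = (res (torsPsh J g) f).obj q) :
    p = q := by
  refine sec_ext h fun x m hm ↦ ?_
  refine (tors q).loc ⟨S.pullback (Tot.bs (a := g.o x) (b := ⟨U, pt p⟩) m),
    J.pullback_stable _ hS, fun V f hf ↦ ⟨_, Tot.cart x f, rfl, ?_⟩⟩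
  obtain ⟨m₁, e, hm₁⟩ := exists_factor_mem (a := ⟨U, p⟩) hm f rfl
  have h' := mem_of_eq (hr _ hf) _ hm₁
  have h'' := (theta_mem (Tot.cart ⟨U, q⟩ _)).2 h'
  refine (tors q).mem_congr ?_ h''
  rw [theta_cart] at e ⊢
  refine Eq.trans ?_ ((congrArg (· ≫ Tot.vert (eqToHom h)) e).trans (Category.assoc _ _ _))
  refine (Category.assoc _ _ _).trans (Eq.trans ?_ (Category.assoc _ _ _).symm)
  refine congrArg (m₁ ≫ ·) ?_
  exact (Tot.cart_vert_eqToHom _ h).symm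

/-- Torsors glue strictly. -/
theorem gluesObjects (hob : GluesObjects J Z) : GluesObjects J (torsPsh J g) := by
  intro U S hS z hz
  obtain ⟨z₀, h, huniq⟩ := hob U S hS (fun V f hf ↦ pt (z f hf))
    (fun W V k f hf hk ↦ congrArg pt (hz k f hf hk))
  dsimp only at h huniq
  let D : Tors.GlueData J g ⟨U, z₀⟩ S :=
    { v := fun V f hf ↦ pt (z f hf)
      κ := fun V f hf ↦ Tot.strict f (h f hf)
      κ_bs := fun V f hf ↦ Tot.strict_bs _ _
      P := fun V f hf ↦ tors (z f hf)
      mem := fun W V f' hf' f hf s hs x m hm ↦ by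
        obtain ⟨k, hk⟩ : ∃ k : W ⟶ V, Tot.bs s = k := ⟨_, rfl⟩
        obtain rfl : k ≫ f = f' := (congrArg₂ (· ≫ ·) hk.symm (Tot.strict_bs f (h f hf)).symm).trans
            ((congrArg Tot.bs hs).trans (Tot.strict_bs f' (h f' hf')))
        have : s = (theta J g).map (Tot.strict k (hz k f hf hf')) :=
          Tot.cancel (Tot.strict f (h f hf)) (by rw [FunOver.map_bs, Tot.strict_bs, hk]) (by
            rw [hs, theta_strict]
            exact (Tot.strict_comp_strict _ _ _ _).symm)
        rw [this]
        exact (theta_mem (Tot.strict k (hz k f hf hf'))).2 hm }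
  obtain ⟨p, e, hp⟩ := exists_sec z₀ (D.glue hS)
  subst e
  have hr : ∀ ⦃V : C⦄ (f : V ⟶ U) (hf : S f), (res (torsPsh J g) f).obj p = z f hf := by
    intro V f hf
    refine sec_ext (h f hf) fun x m hm ↦ ?_
    have h₁ := (theta_mem (Tot.cart ⟨U, p⟩ f)).2 hm
    rw [theta_cart] at h₁
    have h₂ := (hp _).1 h₁
    refine D.mem_iff.1 ?_
    refine (D.glue hS).mem_congr ?_ h₂
    refine (congrArg (_ ≫ ·) (Tot.vert_id _)).trans ((Category.comp_id _).trans ?_)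
    refine Eq.trans ?_ (Category.assoc _ _ _).symm
    refine congrArg (m ≫ ·) ?_
    refine (Tot.strict_rfl f (pt p)).symm.trans ?_
    exact (Tot.vert_eqToHom_strict f (h f hf) _).symm
  refine ⟨p, hr, fun q hq ↦ ?_⟩
  exact sec_ext_of_sieve hS (huniq _ fun V f hf ↦ congrArg pt (hq f hf)) fun V f hf ↦
      (hq f hf).trans (hr f hf).symm

end torsPsh

/-! ### Trivial torsors: the unit is a local equivalence. -/

section Unit

variable {C : Type u} [SmallCategory C] {J : GrothendieckTopology C} {X Z : Cᵒᵖ ⥤ Grpd.{u, u}}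

lemma Tors.of_comp_map {g : FunOver X Z} {x x' : Tot X} (n : x ⟶ x') ⦃w : Tot X⦄
    {k : g.o w ⟶ g.o x} (hk : (Tors.of J g x).mem k) : (Tors.of J g x').mem (k ≫ g.map n) :=
  hk.mono fun _ _ ⟨x₁, r, q, hr, e⟩ ↦ ⟨x₁, r, q ≫ n, hr, by
    rw [← Category.assoc, e, FunOver.map_comp]⟩

variable (J) (γ : X ⟶ Z)

/-- The functor sending a section to the trivial torsor. -/
def trivialTors (U : C) : Sec X U ⥤ TorsObj J (FunOver.ofNat γ) U where
  obj x := ⟨(sec γ U).obj x, Tors.of J (FunOver.ofNat γ) ⟨U, x⟩⟩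
  map {_ x'} m := ⟨(sec γ U).map m, fun _ k hk ↦
    (Tors.of J (FunOver.ofNat γ) ⟨U, x'⟩).mem_congr
      (congrArg (k ≫ ·) (FunOver.ofNat_vert γ m)) (Tors.of_comp_map (Tot.vert m) hk)⟩
  map_id x := TorsObj.Hom.ext ((sec γ U).map_id x)
  map_comp m n := TorsObj.Hom.ext ((sec γ U).map_comp m n)

lemma res_trivialTors {V U : C} (f : V ⟶ U) :
    res X f ⋙ trivialTors J γ V = trivialTors J γ U ⋙ TorsObj.res J (FunOver.ofNat γ) f :=
  TorsObj.functor_ext (fun x ↦ TorsObj.ext' (p := (trivialTors J γ V).obj ((res X f).obj x))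
    (q := (TorsObj.res J (FunOver.ofNat γ) f).obj ((trivialTors J γ U).obj x))
    (res_sec_obj γ f x) fun _ k hk ↦
      (Tors.of J (FunOver.ofNat γ) ⟨U, x⟩).mem_congr
        ((congrArg (k ≫ ·) (FunOver.ofNat_cart γ ⟨U, x⟩ f)).trans (Category.assoc _ _ _).symm)
        (Tors.of_comp_map (Tot.cart ⟨U, x⟩ f) hk)) (res_sec γ f)

/-- The morphism from `X` to torsors. -/
def torsUnit : X ⟶ torsPsh J (FunOver.ofNat γ) where
  app U := trivialTors J γ U.unop
  naturality _ _ f := res_trivialTors J γ f.unop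

open torsPsh in
lemma theta_torsUnit {a b : Tot X} (φ : a ⟶ b) :
    (theta J (FunOver.ofNat γ)).map ((FunOver.ofNat (torsUnit J γ)).map φ) =
      (FunOver.ofNat γ).map φ := by
  have key : ∀ {V U : C} (f : V ⟶ U) {x x₁ : Sec X V} {y : Sec X U} (m : x₁ ⟶ x)
      (e : (res X f).obj y = x), (theta J (FunOver.ofNat γ)).map ((FunOver.ofNat
        (torsUnit J γ)).map (Tot.vert m ≫ Tot.strict f e)) =
          (FunOver.ofNat γ).map (Tot.vert m ≫ Tot.strict f e) := by
    intro V U f x x₁ y m e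
    refine (congrArg (theta J (FunOver.ofNat γ)).map ((FunOver.ofNat
      (torsUnit J γ)).map_comp _ _)).trans (((theta J (FunOver.ofNat γ)).map_comp _ _).trans ?_)
    refine Eq.trans ?_ ((FunOver.ofNat γ).map_comp (Tot.vert m) (Tot.strict f e)).symm
    refine congrArg₂ (· ≫ ·) ?_ ?_
    · refine (congrArg (theta J (FunOver.ofNat γ)).map (FunOver.ofNat_vert (torsUnit J γ) m)).trans ?_
      exact (theta_vert _).trans (FunOver.ofNat_vert γ m).symm
    · refine (congrArg (theta J (FunOver.ofNat γ)).map
        (FunOver.ofNat_strict (torsUnit J γ) f e)).trans ?_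
      exact (theta_strict _ _).trans (FunOver.ofNat_strict γ f e).symm
  have h := Tot.vert_cart φ rfl
  have h' := key (Tot.bs φ) (Tot.vat φ _ rfl) rfl
  rw [Tot.strict_rfl] at h'
  have h'' : (Tot.vert (Tot.vat φ _ rfl) : a ⟶ _) ≫ Tot.cart ⟨b.base, b.pt⟩ (Tot.bs φ) = φ := h
  rw [h''] at h'
  exact h'

open torsPsh in
/-- If `γ : X ⟶ Z` is locally faithful, then torsors under `X` are the stack completion of `X`. -/
theorem isLocEquiv_torsUnit (hγ : ∀ {x x' : Tot X} (n n' : x ⟶ x'),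
    (FunOver.ofNat γ).map n = (FunOver.ofNat γ).map n' →
      Loc J x.base (fun _ f ↦ Tot.cart x f ≫ n = Tot.cart x f ≫ n')) :
    (FunOver.ofNat (torsUnit J γ)).IsLocEquiv J where
  essSurj y := (tors y.pt).ne.mono fun V f ⟨x, m, hb, hm⟩ ↦ by
    -- A member `m` of the torsor is itself an arrow from a trivial torsor.
    obtain ⟨i, hi⟩ := exists_theta (a := (FunOver.ofNat (torsUnit J γ)).o ⟨V, x⟩) (b := y) m
      (fun w k hk ↦ (tors y.pt).mem_comp_of hm hk)
    refine ⟨x, i, ?_⟩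
    exact ((theta J (FunOver.ofNat γ)).map_bs i).symm.trans ((congrArg Tot.bs hi).trans hb)
  full {x x'} m := by
    have h₁ : (Tors.of J (FunOver.ofNat γ) x).mem (𝟙 _) :=
      (Tors.of J (FunOver.ofNat γ) x).mem_congr ((FunOver.ofNat γ).map_id x)
        (Tors.of_map (J := J) (𝟙 x))
    -- The identity belongs to the trivial torsor of `x`, so the image of `m` belongs to that of
    -- `x'`, which says exactly that it is locally the image of an arrow of `X`.
    have h₂ := (theta_mem m).2 h₁
    refine Loc.mono h₂ fun V f ⟨x₁, r, n, hr, e⟩ ↦ ⟨x₁, r, n, hr, theta_injective ?_⟩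
    refine (theta_torsUnit J γ n).trans (e.symm.trans ?_)
    refine Eq.trans ?_ ((theta J (FunOver.ofNat γ)).map_comp
      ((FunOver.ofNat (torsUnit J γ)).map r) m).symm
    exact congrArg₂ (· ≫ ·) (theta_torsUnit J γ r).symm (Category.id_comp _)
  faithful n n' h := hγ n n' (by
    rw [← theta_torsUnit J γ n, ← theta_torsUnit J γ n', h])

end Unit

/-! ### Products of skyscrapers at points are stacks. -/

section Godement

variable {C : Type u} [SmallCategory C] {J : GrothendieckTopology C}

section Point

variable (p : GrothendieckTopology.Point.{u} J)

lemma exists_refinement_over {U V V' : C} (f : V ⟶ U) (f' : V' ⟶ U) {v : p.fiber.obj V}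
    {v' : p.fiber.obj V'} (h : p.fiber.map f v = p.fiber.map f' v') :
    ∃ (W : C) (a : W ⟶ V) (b : W ⟶ V') (w : p.fiber.obj W), a ≫ f = b ≫ f' ∧
      p.fiber.map a w = v ∧ p.fiber.map b w = v' := by
  have := p.isCofiltered
  let e : p.fiber.Elements := ⟨U, p.fiber.map f v⟩
  let e₁ : p.fiber.Elements := ⟨V, v⟩
  let e₂ : p.fiber.Elements := ⟨V', v'⟩
  let g₁ : e₁ ⟶ e := ⟨f, rfl⟩
  let g₂ : e₂ ⟶ e := ⟨f', h.symm⟩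
  obtain ⟨⟨W, w⟩, a, b, e⟩ := IsCofiltered.cospan g₁ g₂
  exact ⟨W, a.1, b.1, w, congrArg Subtype.val e, a.2, b.2⟩

lemma exists_equalizer {U V : C} (f f' : V ⟶ U) {v : p.fiber.obj V}
    (h : p.fiber.map f v = p.fiber.map f' v) :
    ∃ (W : C) (a : W ⟶ V) (w : p.fiber.obj W), a ≫ f = a ≫ f' ∧ p.fiber.map a w = v := by
  have := p.isCofiltered
  let e : p.fiber.Elements := ⟨U, p.fiber.map f v⟩
  let e₁ : p.fiber.Elements := ⟨V, v⟩
  let f₁ : e₁ ⟶ e := ⟨f, rfl⟩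
  let f₂ : e₁ ⟶ e := ⟨f', h.symm⟩
  obtain ⟨⟨W, w⟩, a, e⟩ := IsCofilteredOrEmpty.cone_maps f₁ f₂
  exact ⟨W, a.1, w, congrArg Subtype.val e, a.2⟩

end Point

variable {T : Type u} (P : T → GrothendieckTopology.Point.{u} J) (G : T → Type u)
  [∀ t, Groupoid.{u} (G t)]

/-- Reindexing of families. -/
def reindex {T : Type u} (G : T → Type u) [∀ t, Groupoid.{u} (G t)] {A B : T → Type u}
    (r : ∀ t, B t → A t) : (∀ t, A t → G t) ⥤ (∀ t, B t → G t) where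
  obj z t y := z t (r t y)
  map m t y := m t (r t y)
  map_id _ := rfl
  map_comp _ _ := rfl

lemma reindex_id {A : T → Type u} {r : ∀ t, A t → A t} (h : ∀ t y, r t y = y) :
    reindex G r = 𝟭 _ := by
  obtain rfl : r = fun t y ↦ y := by
    funext t y
    exact h t y
  rfl

lemma reindex_comp {A B B' : T → Type u} {r : ∀ t, B t → A t} {s : ∀ t, B' t → B t}
    {q : ∀ t, B' t → A t} (h : ∀ t y, q t y = r t (s t y)) :
    reindex G q = reindex G r ⋙ reindex G s := by
  obtain rfl : q = fun t y ↦ r t (s t y) := by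
    funext t y
    exact h t y
  rfl

/-- The product of the skyscraper presheaves of groupoids at a family of points. -/
def skyscraper : Cᵒᵖ ⥤ Grpd.{u, u} where
  obj U := Grpd.of (∀ t, (P t).fiber.obj U.unop → G t)
  map f := reindex G fun t y ↦ (P t).fiber.map f.unop y
  map_id U := reindex_id G fun t y ↦ by simp
  map_comp f g := reindex_comp G fun t y ↦ by simp

namespace skyscraper

variable {P G} {U V : C}

/-- The value of a section at a point. -/
def ev (z : Sec (skyscraper P G) U) (t : T) (y : (P t).fiber.obj U) : G t :=
  (show ∀ t, (P t).fiber.obj U → G t from z) t y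

/-- The section with given values. -/
def mk (z : ∀ t, (P t).fiber.obj U → G t) : Sec (skyscraper P G) U := z

/-- The value of an arrow at a point. -/
def evMap {z z' : Sec (skyscraper P G) U} (m : z ⟶ z') (t : T) (y : (P t).fiber.obj U) :
    ev z t y ⟶ ev z' t y :=
  (show ∀ t (y : (P t).fiber.obj U), ev z t y ⟶ ev z' t y from m) t y

/-- The arrow with given values. -/
def mkMap {z z' : Sec (skyscraper P G) U} (m : ∀ t (y : (P t).fiber.obj U), ev z t y ⟶ ev z' t y) :
    z ⟶ z' := m

lemma evMap_ext {z z' : Sec (skyscraper P G) U} {m m' : z ⟶ z'}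
    (h : ∀ t y, evMap m t y = evMap m' t y) : m = m' := by
  funext t y
  exact h t y

lemma sec_ext {z z' : Sec (skyscraper P G) U} (h : ∀ t y, ev z t y = ev z' t y) : z = z' := by
  funext t y
  exact h t y

lemma evMap_comp {z z' z'' : Sec (skyscraper P G) U} (m : z ⟶ z') (m' : z' ⟶ z'') (t : T)
    (y : (P t).fiber.obj U) : evMap (m ≫ m') t y = evMap m t y ≫ evMap m' t y := rfl

lemma evMap_eqToHom {z z' : Sec (skyscraper P G) U} (h : z = z') (t : T)
    (y : (P t).fiber.obj U) : evMap (eqToHom h) t y = eqToHom (by rw [h]) := by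
  subst h
  rfl

lemma ev_res (f : V ⟶ U) (z : Sec (skyscraper P G) U) (t : T) (y : (P t).fiber.obj V) :
    ev ((res (skyscraper P G) f).obj z) t y = ev z t ((P t).fiber.map f y) := rfl

lemma evMap_res (f : V ⟶ U) {z z' : Sec (skyscraper P G) U} (m : z ⟶ z') (t : T)
    (y : (P t).fiber.obj V) :
    evMap ((res (skyscraper P G) f).map m) t y = evMap m t ((P t).fiber.map f y) := rfl

/-- The value at a point of an arrow of the total category. -/
def val {a b : Tot (skyscraper P G)} (m : a ⟶ b) {t : T} {y : (P t).fiber.obj a.base}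
    {y' : (P t).fiber.obj b.base} (h : (P t).fiber.map (Tot.bs m) y = y') :
    ev a.pt t y ⟶ ev b.pt t y' :=
  evMap (Tot.vat m _ rfl) t y ≫ eqToHom ((ev_res _ b.pt t y).trans (by rw [h]))

lemma val_eq {a b : Tot (skyscraper P G)} (m : a ⟶ b) {f : a.base ⟶ b.base} (hf : Tot.bs m = f)
    {t : T} {y : (P t).fiber.obj a.base}
    {y' : (P t).fiber.obj b.base} (h : (P t).fiber.map (Tot.bs m) y = y') :
    val m h = evMap (Tot.vat m f hf) t y ≫
      eqToHom ((ev_res f b.pt t y).trans (by rw [← hf, h])) := by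
  subst hf
  rfl

lemma val_comp {a b c : Tot (skyscraper P G)} (m : a ⟶ b) (n : b ⟶ c) {t : T}
    {y : (P t).fiber.obj a.base} {y' : (P t).fiber.obj b.base} {y'' : (P t).fiber.obj c.base}
    (h : (P t).fiber.map (Tot.bs m) y = y') (h' : (P t).fiber.map (Tot.bs n) y' = y'')
    (h'' : (P t).fiber.map (Tot.bs (m ≫ n)) y = y'') : val (m ≫ n) h'' = val m h ≫ val n h' := by
  subst h h'
  rw [val_eq (m ≫ n) (Tot.comp_bs _ _), val, val,
    Tot.comp_vat m n _ (Tot.comp_bs _ _) (rfl : Tot.bs m = _) (rfl : Tot.bs n = _), evMap_comp,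
    evMap_comp, evMap_eqToHom, evMap_res]
  simp only [Category.assoc]
  refine congrArg (_ ≫ ·) (Eq.trans ?_ (Category.id_comp _).symm)
  refine (Category.assoc _ _ _).trans (congrArg (_ ≫ ·) (eqToHom_trans _ _))

lemma hom_ext {a b : Tot (skyscraper P G)} {m n : a ⟶ b} (hb : Tot.bs m = Tot.bs n)
    (h : ∀ t (y : (P t).fiber.obj a.base), val m (y := y) rfl = val n (by rw [hb])) : m = n := by
  refine Tot.hom_ext _ rfl hb.symm (evMap_ext fun t y ↦ ?_)
  have := h t y
  rw [val_eq m rfl, val_eq n hb.symm] at this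
  exact (cancel_mono _).1 this

lemma exists_hom {a b : Tot (skyscraper P G)} (f : a.base ⟶ b.base)
    (k : ∀ t (y : (P t).fiber.obj a.base) (y' : (P t).fiber.obj b.base),
      (P t).fiber.map f y = y' → (ev a.pt t y ⟶ ev b.pt t y')) :
    ∃ m : a ⟶ b, Tot.bs m = f ∧ ∀ t (y : (P t).fiber.obj a.base) (y' : (P t).fiber.obj b.base)
      (h : (P t).fiber.map (Tot.bs m) y = y') (h' : (P t).fiber.map f y = y'),
        val m h = k t y y' h' := by
  refine ⟨Tot.mkHom f (mkMap fun t y ↦ k t y _ rfl), rfl, fun t y y' h h' ↦ ?_⟩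
  subst h'
  rw [val_eq _ (Tot.mkHom_bs _ _), Tot.mkHom_vat_self]
  exact Category.comp_id _

lemma val_congr {a b : Tot (skyscraper P G)} {m n : a ⟶ b} (e : m = n) {t : T}
    {y : (P t).fiber.obj a.base} {y' : (P t).fiber.obj b.base}
    (h : (P t).fiber.map (Tot.bs m) y = y') : val m h = val n (by rw [← e, h]) := by
  subst e
  rfl

lemma map_comp_apply {t : T} {W : C} {g : W ⟶ V} {f : V ⟶ U} {w : (P t).fiber.obj W}
    {v : (P t).fiber.obj V} {y : (P t).fiber.obj U} (h : (P t).fiber.map g w = v)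
    (h' : (P t).fiber.map f v = y) : (P t).fiber.map (g ≫ f) w = y := by
  rw [← h', ← h]
  simp

lemma val_cancel_of_val {a b c : Tot (skyscraper P G)} (s : a ⟶ b) {m n : b ⟶ c}
    {t : T} {y : (P t).fiber.obj a.base} {y' : (P t).fiber.obj b.base}
    {y'' : (P t).fiber.obj c.base} (h : (P t).fiber.map (Tot.bs s) y = y')
    (h' : (P t).fiber.map (Tot.bs m) y' = y'') (h'' : (P t).fiber.map (Tot.bs n) y' = y'')
    (h₁ : (P t).fiber.map (Tot.bs (s ≫ m)) y = y'') (h₂ : (P t).fiber.map (Tot.bs (s ≫ n)) y = y'')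
    (e : val (s ≫ m) h₁ = val (s ≫ n) h₂) : val m h' = val n h'' := by
  rw [← cancel_epi (val s h), ← val_comp s m h h' h₁, ← val_comp s n h h'' h₂, e]

lemma val_cancel {a b c : Tot (skyscraper P G)} (s : a ⟶ b) {m n : b ⟶ c} (e : s ≫ m = s ≫ n)
    {t : T} {y : (P t).fiber.obj a.base} {y' : (P t).fiber.obj b.base}
    {y'' : (P t).fiber.obj c.base} (h : (P t).fiber.map (Tot.bs s) y = y')
    (h' : (P t).fiber.map (Tot.bs m) y' = y'') (h'' : (P t).fiber.map (Tot.bs n) y' = y'') :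
    val m h' = val n h'' :=
  val_cancel_of_val s h h' h'' (map_comp_apply h h') (map_comp_apply h h'') (val_congr e _)

lemma exists_point_cov {z : Tot (skyscraper P G)} {S : Sieve z.base} (hS : S ∈ J z.base) (t : T)
    (y : (P t).fiber.obj z.base) : ∃ (v : Tot (skyscraper P G)) (r : v ⟶ z)
      (y₀ : (P t).fiber.obj v.base), S (Tot.bs r) ∧ (P t).fiber.map (Tot.bs r) y₀ = y := by
  obtain ⟨V, f, hf, v, rfl⟩ := (P t).jointly_surjective S hS y
  exact ⟨_, Tot.cart z f, v, hf, rfl⟩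

lemma exists_common {z v v' : Tot (skyscraper P G)} (r : v ⟶ z) (r' : v' ⟶ z) {t : T}
    {y : (P t).fiber.obj v.base} {y' : (P t).fiber.obj v'.base}
    (h : (P t).fiber.map (Tot.bs r) y = (P t).fiber.map (Tot.bs r') y') :
    ∃ (w : Tot (skyscraper P G)) (a : w ⟶ v) (b : w ⟶ v') (w₀ : (P t).fiber.obj w.base),
      a ≫ r = b ≫ r' ∧ (P t).fiber.map (Tot.bs a) w₀ = y ∧ (P t).fiber.map (Tot.bs b) w₀ = y' := by
  obtain ⟨W, a, b, w, e, ha, hb⟩ := exists_refinement_over (P t) _ _ h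
  obtain ⟨b', hb', e'⟩ := Tot.exists_lift (Tot.cart v a ≫ r) r' b e.symm
  exact ⟨_, Tot.cart v a, b', w, e'.symm, ha, by rw [hb', hb]⟩

variable (P G) in
lemma sep (z z' : Tot (skyscraper P G)) (h h' : z ⟶ z') (hb : Tot.bs h = Tot.bs h')
    (loc : Loc J z.base (fun _ f ↦ Tot.cart z f ≫ h = Tot.cart z f ≫ h')) : h = h' := by
  obtain ⟨S, hS, loc⟩ := loc
  refine hom_ext hb fun t y ↦ ?_
  obtain ⟨V, f, hf, v, hv⟩ := (P t).jointly_surjective S hS y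
  exact val_cancel (Tot.cart z f) (loc f hf) hv _ _

-- Arrows of skyscrapers are families of arrows indexed by points. Above each point of `z.base` some
-- member of the covering has a point, whose value is used; common refinements show that the choice
-- does not matter.
variable (P G) in
lemma glue (z z' : Tot (skyscraper P G)) (g : z.base ⟶ z'.base) (S : Sieve z.base)
    (hS : S ∈ J z.base) (β : ∀ (v : Tot (skyscraper P G)) (r : v ⟶ z), S (Tot.bs r) → (v ⟶ z'))
    (hβ : ∀ v r hr, Tot.bs (β v r hr) = Tot.bs r ≫ g)
    (compat : ∀ (w v : Tot (skyscraper P G)) (s : w ⟶ v) (r : v ⟶ z) (hr : S (Tot.bs r))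
      (hsr : S (Tot.bs (s ≫ r))), β w (s ≫ r) hsr = s ≫ β v r hr) :
    ∃ h : z ⟶ z', Tot.bs h = g ∧ ∀ v r hr, r ≫ h = β v r hr := by
  have hβ' : ∀ {v : Tot (skyscraper P G)} {q q' : v ⟶ z} (_ : q = q') (hq : S (Tot.bs q))
      (hq' : S (Tot.bs q')), β v q hq = β v q' hq' := by
    rintro v q _ rfl _ _
    rfl
  choose v r v₀ hr hv using fun t (y : (P t).fiber.obj z.base) ↦ exists_point_cov hS t y
  have hk : ∀ t y y', (P t).fiber.map g y = y' →
      (P t).fiber.map (Tot.bs (β _ (r t y) (hr t y))) (v₀ t y) = y' := fun t y y' e ↦ by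
    rw [hβ]
    exact map_comp_apply (hv t y) e
  obtain ⟨h, hb, hh⟩ := exists_hom (a := z) (b := z') g (fun t y y' e ↦
    inv (val (r t y) (hv t y)) ≫ val (β _ (r t y) (hr t y)) (hk t y y' e))
  refine ⟨h, hb, fun w q hq ↦ hom_ext (by rw [hβ, Tot.comp_bs, hb]) fun t y ↦ ?_⟩
  obtain ⟨y₁, hy₁⟩ : ∃ y₁, (P t).fiber.map (Tot.bs q) y = y₁ := ⟨_, rfl⟩
  obtain ⟨y₂, hy₂⟩ : ∃ y₂, (P t).fiber.map (Tot.bs (q ≫ h)) y = y₂ := ⟨_, rfl⟩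
  have hy₃ : (P t).fiber.map (Tot.bs h) y₁ = y₂ := by
    rw [← hy₂, ← hy₁]
    exact (map_comp_apply rfl rfl).symm
  obtain ⟨w', a, b, w₀, e, ha, hb'⟩ := exists_common q (r t y₁) (hy₁.trans (hv t y₁).symm)
  have e₁ : a ≫ β w q hq = b ≫ β _ (r t y₁) (hr t y₁) := by
    have h₁ : S (Tot.bs (a ≫ q)) := S.downward_closed hq _
    have h₂ : S (Tot.bs (b ≫ r t y₁)) := S.downward_closed (hr t y₁) _
    rw [← compat _ _ a q hq h₁, ← compat _ _ b _ _ h₂, hβ' e]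
  subst hy₂
  have hβy : (P t).fiber.map (Tot.bs (β w q hq)) y = (P t).fiber.map (Tot.bs (q ≫ h)) y := by
    rw [hβ, Tot.comp_bs, hb]
  have hr₃ : (P t).fiber.map (Tot.bs (r t y₁ ≫ h)) (v₀ t y₁) =
      (P t).fiber.map (Tot.bs (q ≫ h)) y := map_comp_apply (hv t y₁) hy₃
  have hβ₃ : (P t).fiber.map (Tot.bs (β _ (r t y₁) (hr t y₁))) (v₀ t y₁) =
      (P t).fiber.map (Tot.bs (q ≫ h)) y := hk _ _ _ (by rw [← hb, hy₃])
  have key : val (r t y₁ ≫ h) hr₃ = val (β _ (r t y₁) (hr t y₁)) hβ₃ := by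
    rw [val_comp _ _ (hv t y₁) hy₃, hh _ _ _ _ (by rw [← hb, hy₃]), IsIso.hom_inv_id_assoc]
  refine val_cancel_of_val a ha rfl hβy (map_comp_apply ha rfl) (map_comp_apply ha hβy) ?_
  have e₂ : a ≫ q ≫ h = b ≫ r t y₁ ≫ h := by rw [← Category.assoc, e, Category.assoc]
  refine (val_congr e₂ _).trans (Eq.trans ?_ (val_congr e₁.symm (map_comp_apply hb' hβ₃)))
  exact (val_comp b _ hb' hr₃ _).trans ((congrArg (_ ≫ ·) key).trans (val_comp b _ hb' hβ₃ _).symm)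

/-- A common refinement is first chosen compatible with `a` and `a'`, and then shrunk so as to
equalize the two composites to `V'`. -/
lemma exists_refinement₃ (p : GrothendieckTopology.Point.{u} J) {V V' W W' : C} (a : W ⟶ V)
    (b : W ⟶ V') (a' : W' ⟶ V) (b' : W' ⟶ V') {w : p.fiber.obj W} {w' : p.fiber.obj W'}
    (ha : p.fiber.map a w = p.fiber.map a' w') (hb : p.fiber.map b w = p.fiber.map b' w') :
    ∃ (O : C) (c : O ⟶ W) (c' : O ⟶ W') (o : p.fiber.obj O), c ≫ a = c' ≫ a' ∧ c ≫ b = c' ≫ b' ∧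
      p.fiber.map c o = w ∧ p.fiber.map c' o = w' := by
  obtain ⟨O, c, c', o, e, rfl, rfl⟩ := exists_refinement_over p a a' ha
  obtain ⟨O', d, o', e', rfl⟩ := exists_equalizer p (c ≫ b) (c' ≫ b') (v := o)
    (by simpa using hb)
  exact ⟨O', d ≫ c, d ≫ c', o', by rw [Category.assoc, e, Category.assoc], by simpa using e',
    by simp, by simp⟩

lemma comp_inv_comp_eq {D : Type*} [Groupoid D] {o w w' v z : D} {c' : o ⟶ w'} {c : o ⟶ w}
    {a' : w' ⟶ v} {a : w ⟶ v} {b' : w' ⟶ z} {b : w ⟶ z} (h : c' ≫ a' = c ≫ a)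
    (h' : c' ≫ b' = c ≫ b) : a' ≫ inv a ≫ b = b' := by
  rw [← cancel_epi c', h', reassoc_of% h, IsIso.hom_inv_id_assoc]

variable (P G) in
lemma desc (U : C) (S : Sieve U) (hS : S ∈ J U)
    (z : ∀ ⦃V : C⦄ (f : V ⟶ U), S f → Sec (skyscraper P G) V)
    (s : ∀ ⦃W V : C⦄ (f' : W ⟶ U) (hf' : S f') (f : V ⟶ U) (hf : S f) (h : W ⟶ V),
      h ≫ f = f' → ((⟨W, z f' hf'⟩ : Tot (skyscraper P G)) ⟶ ⟨V, z f hf⟩))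
    (hs : ∀ ⦃W V : C⦄ (f' : W ⟶ U) (hf' : S f') (f : V ⟶ U) (hf : S f) (h : W ⟶ V)
      (e : h ≫ f = f'), Tot.bs (s f' hf' f hf h e) = h)
    (comp : ∀ ⦃W' W V : C⦄ (f'' : W' ⟶ U) (hf'' : S f'') (f' : W ⟶ U) (hf' : S f') (f : V ⟶ U)
      (hf : S f) (h' : W' ⟶ W) (h : W ⟶ V) (e' : h' ≫ f' = f'') (e : h ≫ f = f'),
      s f'' hf'' f' hf' h' e' ≫ s f' hf' f hf h e =
        s f'' hf'' f hf (h' ≫ h) (by rw [Category.assoc, e, e'])) :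
    ∃ (z₀ : Sec (skyscraper P G) U) (κ : ∀ ⦃V : C⦄ (f : V ⟶ U) (hf : S f),
        (⟨V, z f hf⟩ : Tot (skyscraper P G)) ⟶ ⟨U, z₀⟩),
      (∀ ⦃V : C⦄ (f : V ⟶ U) (hf : S f), Tot.bs (κ f hf) = f) ∧
      ∀ ⦃W V : C⦄ (f' : W ⟶ U) (hf' : S f') (f : V ⟶ U) (hf : S f) (h : W ⟶ V) (e : h ≫ f = f'),
        s f' hf' f hf h e ≫ κ f hf = κ f' hf' := by
  choose V₀ f₀ hf₀ v₀ hv₀ using fun t (y : (P t).fiber.obj U) ↦ (P t).jointly_surjective S hS y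
  -- The value at a point of `U` is the value at a chosen point above it in some member of the
  -- covering.
  let z₀ : Sec (skyscraper P G) U := mk fun t y ↦ ev (z (f₀ t y) (hf₀ t y)) t (v₀ t y)
  have s_congr : ∀ ⦃W V : C⦄ (f' : W ⟶ U) (hf' : S f') (f : V ⟶ U) (hf : S f) (h h' : W ⟶ V)
      (e : h ≫ f = f') (_ : h = h') (e' : h' ≫ f = f'), s f' hf' f hf h e = s f' hf' f hf h' e' := by
    rintro W V f' hf' f hf h _ e rfl _
    rfl
  have fb : ∀ ⦃W V : C⦄ (f' : W ⟶ U) (hf' : S f') (f : V ⟶ U) (hf : S f) (h : W ⟶ V)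
      (e : h ≫ f = f') {t : T} {w : (P t).fiber.obj W} {v : (P t).fiber.obj V}
      (_ : (P t).fiber.map h w = v), (P t).fiber.map (Tot.bs (s f' hf' f hf h e)) w = v := by
    intro W V f' hf' f hf h e t w v hw
    rw [hs]
    exact hw
  -- The comparison with the value at the chosen point is computed on one common refinement. By
  -- `exists_refinement₃` any other refinement gives the same arrow.
  have key : ∀ ⦃V : C⦄ (f : V ⟶ U) (hf : S f) (t : T) (y : (P t).fiber.obj V)
      (y' : (P t).fiber.obj U), (P t).fiber.map f y = y' → ∃ k : ev (z f hf) t y ⟶ ev z₀ t y',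
        ∀ (W : C) (f' : W ⟶ U) (hf' : S f') (a : W ⟶ V) (b : W ⟶ V₀ t y') (e : a ≫ f = f')
          (e' : b ≫ f₀ t y' = f') (w : (P t).fiber.obj W) (ha : (P t).fiber.map a w = y)
          (hb : (P t).fiber.map b w = v₀ t y'), val (s f' hf' f hf a e) (fb _ _ _ _ _ _ ha) ≫ k =
            val (s f' hf' _ (hf₀ t y') b e') (fb _ _ _ _ _ _ hb) := by
    intro V f hf t y y' hy
    obtain ⟨W, a, b, w, e, ha, hb⟩ := exists_refinement_over (P t) f (f₀ t y')
      (hy.trans (hv₀ t y').symm)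
    have hf' : S (a ≫ f) := S.downward_closed hf a
    refine ⟨inv (val (s (a ≫ f) hf' f hf a rfl) (fb _ _ _ _ _ _ ha)) ≫
      val (s (a ≫ f) hf' _ (hf₀ t y') b e.symm) (fb _ _ _ _ _ _ hb), ?_⟩
    intro W' f' hf' a' b' e₁ e₂ w' ha' hb'
    obtain ⟨O, c, c', o, h₁, h₂, hc, hc'⟩ := exists_refinement₃ (P t) a b a' b'
      (ha.trans ha'.symm) (hb.trans hb'.symm)
    have hO : S (c' ≫ f') := S.downward_closed hf' c'
    have e₀ : c ≫ a ≫ f = c' ≫ f' := by rw [← Category.assoc, h₁, Category.assoc, e₁]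
    have E₁ : s _ hO _ hf' c' rfl ≫ s f' hf' f hf a' e₁ =
        s _ hO _ _ c e₀ ≫ s (a ≫ f) ‹_› f hf a rfl := by
      rw [comp, comp]
      exact s_congr _ _ _ _ _ _ _ h₁.symm _
    have E₂ : s _ hO _ hf' c' rfl ≫ s f' hf' _ (hf₀ t y') b' e₂ =
        s _ hO _ _ c e₀ ≫ s (a ≫ f) ‹_› _ (hf₀ t y') b e.symm := by
      rw [comp, comp]
      exact s_congr _ _ _ _ _ _ _ h₂.symm _
    have A₁ := (val_comp _ _ (fb _ hO _ hf' c' rfl hc') (fb _ _ _ hf _ e₁ ha')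
      (map_comp_apply (fb _ hO _ hf' c' rfl hc') (fb _ _ _ hf _ e₁ ha'))).symm.trans
      ((val_congr E₁ _).trans (val_comp _ _ (fb _ hO _ ‹_› c e₀ hc) (fb _ _ _ hf _ rfl ha) _))
    have A₂ := (val_comp _ _ (fb _ hO _ hf' c' rfl hc') (fb _ _ _ (hf₀ t y') _ e₂ hb')
      (map_comp_apply (fb _ hO _ hf' c' rfl hc') (fb _ _ _ (hf₀ t y') _ e₂ hb'))).symm.trans
      ((val_congr E₂ _).trans
        (val_comp _ _ (fb _ hO _ ‹_› c e₀ hc) (fb _ _ _ (hf₀ t y') _ e.symm hb) _))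
    exact comp_inv_comp_eq A₁ A₂
  choose k hk using key
  choose κ hκ hκk using fun (V : C) (f : V ⟶ U) (hf : S f) ↦
    exists_hom (a := ⟨V, z f hf⟩) (b := ⟨U, z₀⟩) f (k f hf)
  refine ⟨z₀, fun V f hf ↦ κ V f hf, fun V f hf ↦ hκ V f hf, fun W V f' hf' f hf h e ↦ ?_⟩
  have hb' : Tot.bs (s f' hf' f hf h e ≫ κ V f hf) = f' := by rw [Tot.comp_bs, hκ, hs, e]
  refine hom_ext (hb'.trans (hκ W f' hf').symm) fun t y ↦ ?_
  obtain ⟨y₁, hy₁⟩ : ∃ y₁, (P t).fiber.map h y = y₁ := ⟨_, rfl⟩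
  obtain ⟨y', hy'⟩ : ∃ y' : (P t).fiber.obj U, y' = (P t).fiber.map f' y := ⟨_, rfl⟩
  have hfy : (P t).fiber.map f y₁ = y' := by
    rw [hy', ← e]
    exact (map_comp_apply hy₁ rfl).symm
  obtain ⟨O, a, b, o, e', ha, hb⟩ := exists_refinement_over (P t) f' (f₀ t y')
    (hy'.symm.trans (hv₀ t y').symm)
  have hO : S (a ≫ f') := S.downward_closed hf' a
  have K₁ := hk f' hf' t y y' hy'.symm O (a ≫ f') hO a b rfl e'.symm o ha hb
  have K₂ := hk f hf t y₁ y' hfy O (a ≫ f') hO (a ≫ h) b (by rw [Category.assoc, e]) e'.symm o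
    (map_comp_apply ha hy₁) hb
  have K₃ : val (s _ hO f hf (a ≫ h) (by rw [Category.assoc, e]))
      (fb _ _ _ _ _ _ (map_comp_apply ha hy₁)) = val (s _ hO f' hf' a rfl) (fb _ _ _ _ _ _ ha) ≫
        val (s f' hf' f hf h e) (fb _ _ _ _ _ _ hy₁) :=
    (val_congr (comp _ hO _ hf' _ hf a h rfl e).symm _).trans (val_comp _ _ _ _ _)
  have K₄ : val (s f' hf' f hf h e) (fb _ _ _ _ _ _ hy₁) ≫ k f hf t y₁ y' hfy =
      k f' hf' t y y' hy'.symm := by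
    refine (cancel_epi (val (s _ hO f' hf' a rfl) (fb _ _ _ _ _ _ ha))).1 ?_
    exact (Category.assoc _ _ _).symm.trans ((congrArg (· ≫ _) K₃).symm.trans (K₂.trans K₁.symm))
  have hv : ∀ {m : (⟨W, z f' hf'⟩ : Tot (skyscraper P G)) ⟶ ⟨U, z₀⟩} (_ : Tot.bs m = f'),
      (P t).fiber.map (Tot.bs m) y = y' := by
    rintro m hm
    rw [hm, hy']
  have E : val (s f' hf' f hf h e ≫ κ V f hf) (hv hb') = val (κ W f' hf') (hv (hκ _ _ _)) := by
    refine (val_comp _ _ (fb _ _ _ _ _ _ hy₁) (by rw [hκ]; exact hfy) _).trans ?_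
    refine (congrArg (_ ≫ ·) (hκk V f hf t y₁ y' _ hfy)).trans (K₄.trans ?_)
    exact (hκk W f' hf' t y y' _ hy'.symm).symm
  obtain rfl := hv hb'
  exact E

variable (P G) in
/-- A product of skyscrapers is a stack. -/
theorem totStack : TotStack J (skyscraper P G) where
  sep := sep P G
  glue := glue P G
  desc := desc P G

variable (P G) in
/-- The sections of a product of skyscrapers form a sheaf. -/
theorem gluesObjects : GluesObjects J (skyscraper P G) := by
  intro U S hS z hz
  choose V₀ f₀ hf₀ v₀ hv₀ using fun t (y : (P t).fiber.obj U) ↦ (P t).jointly_surjective S hS y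
  have z_congr : ∀ {V : C} {f f' : V ⟶ U} (_ : f = f') (hf : S f) (hf' : S f'),
      z f hf = z f' hf' := by
    rintro V f _ rfl _ _
    rfl
  have ev_comp : ∀ {W V : C} (a : W ⟶ V) (f : V ⟶ U) (hf : S f) (t : T) (w : (P t).fiber.obj W)
      (y : (P t).fiber.obj V) (_ : (P t).fiber.map a w = y),
        ev (z f hf) t y = ev (z (a ≫ f) (S.downward_closed hf a)) t w := by
    rintro W V a f hf t w y rfl
    rw [← hz a f hf, ev_res]
  refine ⟨mk fun t y ↦ ev (z (f₀ t y) (hf₀ t y)) t (v₀ t y), fun V f hf ↦ sec_ext fun t y ↦ ?_,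
    fun z' hz' ↦ sec_ext fun t y ↦ ?_⟩
  · obtain ⟨W, a, b, w, e, ha, hb⟩ := exists_refinement_over (P t) f
      (f₀ t ((P t).fiber.map f y)) (hv₀ t ((P t).fiber.map f y)).symm
    rw [ev_comp a f hf t w y ha, z_congr e _ (S.downward_closed (hf₀ _ _) _)]
    exact ev_comp _ _ _ _ _ _ hb
  · refine Eq.trans ?_ (congrArg (fun z ↦ ev z t (v₀ t y)) (hz' (f₀ t y) (hf₀ t y)))
    rw [ev_res, hv₀]

end skyscraper

end Godement

lemma comp_eqToHom_injective {D : Type*} [Category* D] {a b c : D} (h : b = c) {m n : a ⟶ b}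
    (e : m ≫ eqToHom h = n ≫ eqToHom h) : m = n := (cancel_mono _).1 e

/-! ### The morphism to the skyscrapers of the stalks. -/

section Germs

variable {C : Type u} [SmallCategory C] {J : GrothendieckTopology C}
  {T : Type u} (P : T → GrothendieckTopology.Point.{u} J)

namespace skyscraper

variable {P} {G : T → Type u} [∀ t, Groupoid.{u} (G t)]

lemma functor_ext {D : Type*} [Category* D] {U : C} {F F' : D ⥤ Sec (skyscraper P G) U}
    (h : ∀ d t (y : (P t).fiber.obj U), ev (F.obj d) t y = ev (F'.obj d) t y)
    (hm : ∀ {d e} (m : d ⟶ e) t (y : (P t).fiber.obj U), evMap (F.map m) t y =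
      eqToHom (h d t y) ≫ evMap (F'.map m) t y ≫ eqToHom (h e t y).symm) : F = F' := by
  refine CategoryTheory.Functor.ext (fun d ↦ sec_ext (h d)) fun d e m ↦ evMap_ext fun t y ↦ ?_
  rw [hm, evMap_comp, evMap_comp, evMap_eqToHom, evMap_eqToHom]

end skyscraper

section

variable {G G' G'' : T → Type u} [∀ t, Groupoid.{u} (G t)] [∀ t, Groupoid.{u} (G' t)]
  [∀ t, Groupoid.{u} (G'' t)]

/-- The morphism of skyscrapers induced by a family of functors. -/
def skyscraperMap (H : ∀ t, G t ⥤ G' t) : skyscraper P G ⟶ skyscraper P G' where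
  app U :=
    { obj := fun z t y ↦ (H t).obj (skyscraper.ev (U := U.unop) z t y)
      map := fun m t y ↦ (H t).map (skyscraper.evMap (U := U.unop) m t y)
      map_id := fun _ ↦ by
        funext t y
        exact (H t).map_id _
      map_comp := fun _ _ ↦ by
        funext t y
        exact (H t).map_comp _ _ }
  naturality _ _ _ := rfl

lemma skyscraperMap_id {H : ∀ t, G t ⥤ G t} (h : ∀ t, H t = 𝟭 _) : skyscraperMap P H = 𝟙 _ := by
  obtain rfl : H = fun t ↦ 𝟭 (G t) := funext h
  rfl

lemma skyscraperMap_comp {H : ∀ t, G t ⥤ G' t} {H' : ∀ t, G' t ⥤ G'' t} {K : ∀ t, G t ⥤ G'' t}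
    (h : ∀ t, K t = H t ⋙ H' t) : skyscraperMap P K = skyscraperMap P H ≫ skyscraperMap P H' := by
  obtain rfl : K = fun t ↦ H t ⋙ H' t := funext h
  rfl

end

variable (X : Cᵒᵖ ⥤ Grpd.{u, u})

/-- The germs of a section at a family of points. -/
noncomputable def germFamily (U : C) :
    Sec X U ⥤ Sec (skyscraper P fun t ↦ Stalk (P t) X) U where
  obj x := skyscraper.mk fun t y ↦ (germ (P t) y).obj x
  map m := skyscraper.mkMap fun t y ↦ (germ (P t) y).map m
  map_id _ := skyscraper.evMap_ext fun t y ↦ (germ (P t) y).map_id _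
  map_comp _ _ := skyscraper.evMap_ext fun t y ↦ (germ (P t) y).map_comp _ _

lemma res_germFamily {V U : C} (f : V ⟶ U) : res X f ⋙ germFamily P X V =
    germFamily P X U ⋙ res (skyscraper P fun t ↦ Stalk (P t) X) f :=
  skyscraper.functor_ext (fun x t y ↦ res_germ_obj (P t) f y x)
    (fun m t y ↦ res_germ_map (P t) f y m)

/-- The morphism to the product of the skyscrapers of the stalks. -/
noncomputable def germs : X ⟶ skyscraper P fun t ↦ Stalk (P t) X where
  app U := germFamily P X U.unop
  naturality _ _ f := res_germFamily P X f.unop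

variable {X} {Y : Cᵒᵖ ⥤ Grpd.{u, u}}

lemma germFamily_naturality (φ : X ⟶ Y) (U : C) :
    germFamily P X U ⋙ sec (skyscraperMap P fun t ↦ stalkMap (P t) φ) U =
      sec φ U ⋙ germFamily P Y U :=
  skyscraper.functor_ext (fun x t y ↦ Functor.congr_obj (germ_stalkMap (P t) φ y) x)
    (fun m t y ↦ Functor.congr_hom (germ_stalkMap (P t) φ y) m)

lemma germs_naturality (φ : X ⟶ Y) :
    germs P X ≫ skyscraperMap P (fun t ↦ stalkMap (P t) φ) = φ ≫ germs P Y := by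
  ext U
  exact germFamily_naturality P φ U.unop

/-- The morphism to the product of the skyscrapers of the stalks is locally faithful, if there are
enough points. -/
lemma germs_faithful (hP : ∀ (U : C) (S : Sieve U), (∀ t (y : (P t).fiber.obj U),
      ∃ (V : C) (f : V ⟶ U) (_ : S f) (v : (P t).fiber.obj V), (P t).fiber.map f v = y) → S ∈ J U)
    {x x' : Tot X} (n n' : x ⟶ x')
    (h : (FunOver.ofNat (germs P X)).map n = (FunOver.ofNat (germs P X)).map n') :
    Loc J x.base (fun _ f ↦ Tot.cart x f ≫ n = Tot.cart x f ≫ n') := by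
  obtain ⟨f, hf⟩ : ∃ f, Tot.bs n' = f := ⟨_, rfl⟩
  have hf' : Tot.bs n = f := by
    rw [← FunOver.map_bs (FunOver.ofNat (germs P X)), h, FunOver.map_bs, hf]
  have e : (germFamily P X x.base).map (Tot.vat n f hf') =
      (germFamily P X x.base).map (Tot.vat n' f hf) := by
    have h' := (FunOver.ofNat_map (germs P X) n hf').symm.trans
      (h.trans (FunOver.ofNat_map (germs P X) n' hf))
    have h'' : (sec (germs P X) x.base).map (Tot.vat n f hf') ≫
        eqToHom (res_sec_obj (germs P X) f x'.pt) = (sec (germs P X) x.base).map (Tot.vat n' f hf) ≫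
          eqToHom (res_sec_obj (germs P X) f x'.pt) := Tot.vert_injective (Tot.cancel
      (Tot.cart ⟨x'.base, (sec (germs P X) x'.base).obj x'.pt⟩ f) rfl h')
    exact comp_eqToHom_injective (res_sec_obj (germs P X) f x'.pt) h''
  -- The sieve on which `n` and `n'` agree. Equality of germs says that above every point it
  -- contains a neighbourhood, so it is covering by `hP`.
  let S : Sieve x.base :=
    { arrows := fun _ k ↦ Tot.cart x k ≫ n = Tot.cart x k ≫ n'
      downward_closed := by
        intro V W k hk k'
        have := congrArg (fun m ↦ Tot.cart ⟨V, (res X k).obj x.pt⟩ k' ≫ m) hk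
        simp only [← Category.assoc] at this
        rw [Tot.cart_comp_cart, Category.assoc, Category.assoc] at this
        have : IsIso (Tot.vert (eqToHom (res_comp_obj X k' k x.pt).symm)) := by
          rw [Tot.vert_eqToHom]
          infer_instance
        exact (cancel_epi (Tot.vert (eqToHom (res_comp_obj X k' k x.pt).symm))).1 ‹_› }
  refine ⟨S, hP _ S fun t y ↦ ?_, fun _ _ h ↦ h⟩
  obtain ⟨V, k, v, hv, hk⟩ := germ_map_eq (P t) (y := y) (congrArg (fun m ↦
    skyscraper.evMap m t y) e)
  refine ⟨V, k, ?_, v, hv⟩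
  change Tot.cart x k ≫ n = Tot.cart x k ≫ n'
  rw [← Tot.vert_cart n hf', ← Tot.vert_cart n' hf]
  have key := fun m : x.pt ⟶ (res X f).obj x'.pt ↦ Tot.cart_vert_assoc k m (Tot.cart x' f)
  exact (key _).trans ((congrArg (fun m ↦ Tot.vert m ≫ _) hk).trans (key _).symm)

end Germs

/-! ### Push-forward of torsors along a square. -/

section Push

variable {C : Type u} [SmallCategory C] {J : GrothendieckTopology C}
  {X X' X'' Z Z' Z'' : Cᵒᵖ ⥤ Grpd.{u, u}}

lemma map_comp_eqToHom {D D' : Type*} [Category* D] [Category* D'] (F : D ⥤ D') {a b b' : D}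
    {c : D'} (m : a ⟶ b) (h : b = b') (h' : F.obj b' = c) (h'' : F.obj b = c) :
    F.map m ≫ eqToHom h'' = F.map (m ≫ eqToHom h) ≫ eqToHom h' := by
  subst h
  simp

lemma FunOver.ofNat_comp_map (φ : X ⟶ X') (ψ : X' ⟶ X'') {a b : Tot X} (n : a ⟶ b) :
    (FunOver.ofNat (φ ≫ ψ)).map n = (FunOver.ofNat ψ).map ((FunOver.ofNat φ).map n) := by
  obtain ⟨f, hf⟩ : ∃ f, Tot.bs n = f := ⟨_, rfl⟩
  refine (FunOver.ofNat_map (φ ≫ ψ) n hf).trans (Eq.trans ?_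
    (congrArg (FunOver.ofNat ψ).map (FunOver.ofNat_map φ n hf)).symm)
  refine Eq.trans ?_ (FunOver.ofNat_vert_cart ψ f (x' := (sec φ b.base).obj b.pt) _).symm
  refine congrArg (fun k : (sec ψ a.base).obj ((sec φ a.base).obj a.pt) ⟶
    (res X'' f).obj ((sec ψ b.base).obj ((sec φ b.base).obj b.pt)) ↦ Tot.vert k ≫ Tot.cart
      ⟨b.base, (sec ψ b.base).obj ((sec φ b.base).obj b.pt)⟩ f) ?_
  exact map_comp_eqToHom (sec ψ a.base) ((sec φ a.base).map (Tot.vat n f hf)) _ _ _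

lemma FunOver.ofNat_id_map {a b : Tot X} (n : a ⟶ b) : (FunOver.ofNat (𝟙 X)).map n = n := by
  refine (FunOver.ofNat_map (𝟙 X) n rfl).trans (Eq.trans ?_ (Tot.vert_cart n rfl))
  exact congrArg (fun k ↦ Tot.vert k ≫ Tot.cart b (Tot.bs n)) (Category.comp_id _)

lemma FunOver.ofNat_congr_map {α β : X ⟶ Z} (h : α = β) {a b : Tot X} (n : a ⟶ b) :
    (FunOver.ofNat α).map n ≫ Tot.vert (x := (sec α b.base).obj b.pt)
        (y := (sec β b.base).obj b.pt) (eqToHom (by rw [h])) =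
      Tot.vert (x := (sec α a.base).obj a.pt) (y := (sec β a.base).obj a.pt)
        (eqToHom (by rw [h])) ≫ (FunOver.ofNat β).map n := by
  subst h
  exact (congrArg (_ ≫ ·) (Tot.vert_id _)).trans ((Category.comp_id _).trans
    ((congrArg (· ≫ _) (Tot.vert_id _)).trans (Category.id_comp _)).symm)

/-- A square of functors over `C` that commutes up to isomorphism. -/
structure Sq (g : FunOver X Z) (g' : FunOver X' Z') (p : FunOver X X') (q : FunOver Z Z') where
  arrow (x : Tot X) : g'.o (p.o x) ⟶ q.o (g.o x)
  arrow_bs (x : Tot X) : Tot.bs (arrow x) = 𝟙 _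
  arrow_naturality {x y : Tot X} (n : x ⟶ y) :
    g'.map (p.map n) ≫ arrow y = arrow x ≫ q.map (g.map n)

lemma Sq.arrow_naturality_assoc {g : FunOver X Z} {g' : FunOver X' Z'} {p : FunOver X X'}
    {q : FunOver Z Z'} (s : Sq g g' p q) {x y : Tot X} (n : x ⟶ y) {a : Tot Z'}
    (h : q.o (g.o y) ⟶ a) :
    g'.map (p.map n) ≫ s.arrow y ≫ h = s.arrow x ≫ q.map (g.map n) ≫ h := by
  rw [← Category.assoc, s.arrow_naturality, Category.assoc]

section

variable {g : FunOver X Z} {g' : FunOver X' Z'} {p : FunOver X X'} {q : FunOver Z Z'}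

/-- The push-forward of a torsor. -/
def Tors.push (h : Sq g g' p q) {z : Tot Z} (P : Tors J g z) :
    Tors J g' (q.o z) where
  mem x' m' := Loc J x'.base (fun V f ↦ ∃ (x : Sec X V) (r : p.o ⟨V, x⟩ ⟶ x')
    (m : g.o ⟨V, x⟩ ⟶ z), Tot.bs r = f ∧ P.mem m ∧
      g'.map r ≫ m' = h.arrow ⟨V, x⟩ ≫ q.map m)
  res x' x'' j m' hm := (hm.pullback (Tot.bs j)).mono fun V f ⟨x, r, m, hr, hm, e⟩ ↦ by
    obtain ⟨r', hr', rfl⟩ := Tot.exists_lift r j f hr.symm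
    exact ⟨x, r', m, hr', hm, by rw [← FunOver.map_comp_assoc, e]⟩
  loc x' m' hm := hm.bind fun V f ⟨x₁, r₁, hr₁, hm⟩ ↦ hm.mono fun W f' ⟨x, r, m, hr, hm, e⟩ ↦
    ⟨x, r ≫ r₁, m, by rw [Tot.comp_bs, hr, hr₁], hm, by rw [FunOver.map_comp_assoc, e]⟩
  ne := P.ne.mono fun V f ⟨x, m, hb, hm⟩ ↦ ⟨p.obj x,
    h.arrow ⟨V, x⟩ ≫ q.map m, by
      rw [Tot.comp_bs, h.arrow_bs, FunOver.map_bs, hb]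
      exact Category.id_comp _, Loc.of_forall fun W f' ↦ ⟨_,
        p.map (Tot.cart ⟨V, x⟩ f'), g.map (Tot.cart ⟨V, x⟩ f') ≫ m,
        FunOver.map_bs _ _, P.res _ hm, by
          rw [h.arrow_naturality_assoc, FunOver.map_comp]⟩⟩
  tors x' x'' m' m'' hm hm' k e := by
    refine (hm.and (hm'.pullback k)).bind ?_
    rintro V f ⟨⟨x₁, r₁, m₁, hr₁, hm₁, e₁⟩, x₂, r₂, m₂, hr₂, hm₂, e₂⟩
    have b₁ := congrArg Tot.bs e₁
    have b₂ := congrArg Tot.bs e₂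
    rw [Tot.comp_bs, Tot.comp_bs, FunOver.map_bs, FunOver.map_bs, h.arrow_bs, hr₁] at b₁
    rw [Tot.comp_bs, Tot.comp_bs, FunOver.map_bs, FunOver.map_bs, h.arrow_bs, hr₂, Category.assoc,
      ← e, b₁] at b₂
    have b₃ : Tot.bs m₁ = Tot.bs m₂ :=
      (Category.id_comp _).symm.trans (b₂.trans (Category.id_comp _))
    refine (P.tors hm₁ hm₂ (𝟙 V) (b₃.trans (Category.id_comp _).symm)).mono ?_
    rintro W f' ⟨x₃, s, n, hs, hn, e₃⟩
    refine ⟨_, p.map s ≫ r₁, p.map n ≫ r₂, ?_, ?_, ?_⟩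
    · rw [Tot.comp_bs, FunOver.map_bs, hs, hr₁]
    · rw [Tot.comp_bs, FunOver.map_bs, hn, hr₂]
      simp
    · rw [FunOver.map_comp_assoc, FunOver.map_comp_assoc, e₁, e₂, h.arrow_naturality_assoc,
        h.arrow_naturality_assoc, ← FunOver.map_comp, ← FunOver.map_comp, e₃]

lemma Tors.push_of_mem (h : Sq g g' p q) {z : Tot Z} {P : Tors J g z}
    {x : Tot X} {m : g.o x ⟶ z} (hm : P.mem m) :
    (P.push h).mem (h.arrow x ≫ q.map m) := Loc.of_forall fun W f' ↦ ⟨_,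
        p.map (Tot.cart x f'), g.map (Tot.cart x f') ≫ m,
        FunOver.map_bs _ _, P.res _ hm, by
          rw [h.arrow_naturality_assoc, FunOver.map_comp]⟩

lemma Tors.push_comp_map (h : Sq g g' p q) {z z₁ : Tot Z} {P : Tors J g z}
    {Q : Tors J g z₁} (n : z ⟶ z₁)
    (hn : ∀ ⦃x : Tot X⦄ (m : g.o x ⟶ z), P.mem m → Q.mem (m ≫ n)) {x' : Tot X'}
    {m' : g'.o x' ⟶ q.o z} (hm : (P.push h).mem m') :
    (Q.push h).mem (m' ≫ q.map n) :=
  hm.mono fun _ _ ⟨x, r, m, hr, hm, e⟩ ↦ ⟨x, r, m ≫ n, hr, hn _ hm, by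
    rw [← Category.assoc, e, Category.assoc, FunOver.map_comp]⟩

end

variable {γ : X ⟶ Z} {γ' : X' ⟶ Z'} {φ : X ⟶ X'} {Φ : Z ⟶ Z'}

/-- The square of functors over `C` of a commutative square of presheaves of groupoids. -/
def Sq.ofNat (h : γ ≫ Φ = φ ≫ γ') :
    Sq (FunOver.ofNat γ) (FunOver.ofNat γ') (FunOver.ofNat φ) (FunOver.ofNat Φ) where
  arrow x := Tot.vert (x := (sec γ' x.base).obj ((sec φ x.base).obj x.pt))
    (y := (sec Φ x.base).obj ((sec γ x.base).obj x.pt))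
    (eqToHom (congrArg (fun k ↦ (sec k x.base).obj x.pt) h.symm))
  arrow_bs _ := rfl
  arrow_naturality {x y} n :=
    (congrArg (· ≫ Tot.vert (x := (sec γ' y.base).obj ((sec φ y.base).obj y.pt))
      (y := (sec Φ y.base).obj ((sec γ y.base).obj y.pt)) (eqToHom _))
      (FunOver.ofNat_comp_map φ γ' n).symm).trans ((FunOver.ofNat_congr_map h.symm n).trans
        (congrArg (Tot.vert (x := (sec γ' x.base).obj ((sec φ x.base).obj x.pt))
    (y := (sec Φ x.base).obj ((sec γ x.base).obj x.pt)) (eqToHom _) ≫ ·)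
          (FunOver.ofNat_comp_map γ Φ n)))

end Push

/-! ### Strict functoriality of the presheaf of torsors. -/

section PushFunctor

variable {C : Type u} [SmallCategory C] {J : GrothendieckTopology C}
  {X X' X'' Z Z' Z'' : Cᵒᵖ ⥤ Grpd.{u, u}} {γ : X ⟶ Z} {γ' : X' ⟶ Z'} {γ'' : X'' ⟶ Z''}
  {φ : X ⟶ X'} {Φ : Z ⟶ Z'} {φ' : X' ⟶ X''} {Φ' : Z' ⟶ Z''} {φ'' : X ⟶ X''} {Φ'' : Z ⟶ Z''}

lemma eqToHom_comp_map_eqToHom {A B : Type u} [Category.{u} A] [Category.{u} B] (F : A ⥤ B)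
    {b b' : A} {a : B} (h : a = F.obj b) (h' : b = b') (h'' : a = F.obj b') :
    eqToHom h'' = eqToHom h ≫ F.map (eqToHom h') := by
  subst h h'
  simp

lemma Sq.ofNat_arrow_comp (h : γ ≫ Φ = φ ≫ γ') (h' : γ' ≫ Φ' = φ' ≫ γ'')
    (h'' : γ ≫ Φ ≫ Φ' = (φ ≫ φ') ≫ γ'') (x : Tot X) :
    (Sq.ofNat h'').arrow x = (Sq.ofNat h').arrow ((FunOver.ofNat φ).o x) ≫
      (FunOver.ofNat Φ').map ((Sq.ofNat h).arrow x) := by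
  refine Eq.trans ?_ (congrArg ((Sq.ofNat h').arrow ((FunOver.ofNat φ).o x) ≫ ·)
    (FunOver.ofNat_vert Φ' (x := (sec γ' x.base).obj ((sec φ x.base).obj x.pt))
      (y := (sec Φ x.base).obj ((sec γ x.base).obj x.pt)) _)).symm
  refine Eq.trans ?_ (Tot.vert_comp (x := (sec γ'' x.base).obj ((sec φ' x.base).obj
    ((sec φ x.base).obj x.pt))) (y := (sec Φ' x.base).obj ((sec γ' x.base).obj
    ((sec φ x.base).obj x.pt))) (z := (sec Φ' x.base).obj ((sec Φ x.base).obj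
    ((sec γ x.base).obj x.pt))) _ _)
  refine congrArg (Tot.vert (x := (sec γ'' x.base).obj ((sec φ' x.base).obj
    ((sec φ x.base).obj x.pt))) (y := (sec Φ' x.base).obj ((sec Φ x.base).obj
    ((sec γ x.base).obj x.pt)))) ?_
  exact eqToHom_comp_map_eqToHom (sec Φ' x.base) _ _ _

namespace TorsObj

variable (J) in
/-- The push-forward of torsors. -/
def push (h : γ ≫ Φ = φ ≫ γ') (U : C) :
    TorsObj J (FunOver.ofNat γ) U ⥤ TorsObj J (FunOver.ofNat γ') U where
  obj p := ⟨(sec Φ U).obj p.pt, p.tors.push (Sq.ofNat h)⟩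
  map {_ q} k := ⟨(sec Φ U).map (Hom.hom k), fun _ m hm ↦
    (q.tors.push (Sq.ofNat h)).mem_congr (congrArg (m ≫ ·) (FunOver.ofNat_vert Φ (Hom.hom k)))
      (Tors.push_comp_map (Sq.ofNat h) (Tot.vert (Hom.hom k)) (Hom.mem k) hm)⟩
  map_id p := Hom.ext ((sec Φ U).map_id p.pt)
  map_comp k l := Hom.ext ((sec Φ U).map_comp (Hom.hom k) (Hom.hom l))

lemma res_push (h : γ ≫ Φ = φ ≫ γ') {V U : C} (f : V ⟶ U) :
    res J (FunOver.ofNat γ) f ⋙ push J h V = push J h U ⋙ res J (FunOver.ofNat γ') f :=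
  functor_ext (fun p ↦ ext' (p := (push J h V).obj ((res J (FunOver.ofNat γ) f).obj p))
    (q := (res J (FunOver.ofNat γ') f).obj ((push J h U).obj p)) (res_sec_obj Φ f p.pt)
    fun _ m hm ↦ (p.tors.push (Sq.ofNat h)).mem_congr
      ((congrArg (m ≫ ·) (FunOver.ofNat_cart Φ ⟨U, p.pt⟩ f)).trans (Category.assoc _ _ _).symm)
      (Tors.push_comp_map (P := p.tors.pull (Tot.cart ⟨U, p.pt⟩ f)) (Sq.ofNat h)
        (Tot.cart ⟨U, p.pt⟩ f) (fun _ _ h ↦ h) hm))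
    (congrArg (forget J (FunOver.ofNat γ) U ⋙ ·) (res_sec Φ f))

/-- A member of the push-forward along the identity is locally a member, hence a member; the reverse
inclusion is automatic for torsors. -/
lemma push_id {φ : X ⟶ X} {Φ : Z ⟶ Z} (h : γ ≫ Φ = φ ≫ γ) (hφ : φ = 𝟙 X) (hΦ : Φ = 𝟙 Z) (U : C) :
    push J h U = 𝟭 _ := by
  subst hφ hΦ
  refine functor_ext (fun p ↦ ext' (p := (push J h U).obj p) (q := p) rfl fun x m hm ↦ ?_) rfl
  refine p.tors.mem_congr ((congrArg (m ≫ ·) (Tot.vert_id p.pt)).trans (Category.comp_id _)).symm ?_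
  refine p.tors.loc (hm.mono fun V f ⟨x₁, r, k, hr, hk, e⟩ ↦ ⟨x₁, r, hr, ?_⟩)
  refine p.tors.mem_congr (Eq.trans ?_ e.symm) hk
  refine Eq.trans (FunOver.ofNat_id_map k).symm ((Category.id_comp _).symm.trans ?_)
  exact congrArg (· ≫ (FunOver.ofNat (𝟙 Z)).map k) (Tot.vert_id ((sec γ V).obj x₁)).symm

lemma push_comp (h : γ ≫ Φ = φ ≫ γ') (h' : γ' ≫ Φ' = φ' ≫ γ'') (h'' : γ ≫ Φ'' = φ'' ≫ γ'')
    (hφ : φ'' = φ ≫ φ') (hΦ : Φ'' = Φ ≫ Φ') (U : C) :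
    push J h'' U = push J h U ⋙ push J h' U := by
  subst hφ hΦ
  refine functor_ext (fun p ↦ ext' (p := (push J h'' U).obj p)
    (q := (push J h' U).obj ((push J h U).obj p)) rfl fun x m hm ↦ ?_) rfl
  refine ((p.tors.push (Sq.ofNat h)).push (Sq.ofNat h')).mem_congr
    ((congrArg (m ≫ ·) (Tot.vert_id ((sec Φ' U).obj ((sec Φ U).obj p.pt)))).trans
      (Category.comp_id _)).symm ?_
  refine hm.mono fun V f ⟨x₁, r, k, hr, hk, e⟩ ↦ ⟨(sec φ V).obj x₁, r,
    (Sq.ofNat h).arrow ⟨V, x₁⟩ ≫ (FunOver.ofNat Φ).map k, hr, Tors.push_of_mem _ hk, e.trans ?_⟩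
  refine (congrArg₂ (· ≫ ·) (Sq.ofNat_arrow_comp h h' h'' ⟨V, x₁⟩)
    (FunOver.ofNat_comp_map Φ Φ' k)).trans ?_
  refine (Category.assoc _ _ _).trans (congrArg (_ ≫ ·) ?_)
  exact ((FunOver.ofNat Φ').map_comp ((Sq.ofNat h).arrow ⟨V, x₁⟩) ((FunOver.ofNat Φ).map k)).symm

/-- The push-forward of the trivial torsor contains the image of the identity, hence the whole
trivial torsor of the image, and an inclusion of torsors is an equality. -/
lemma trivialTors_push (h : γ ≫ Φ = φ ≫ γ') (U : C) :
    sec φ U ⋙ trivialTors J γ' U = trivialTors J γ U ⋙ push J h U := by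
  have e : sec φ U ⋙ sec γ' U = sec γ U ⋙ sec Φ U := congrArg (fun k ↦ sec k U) h.symm
  refine functor_ext (fun x ↦ ext' (p := (trivialTors J γ' U).obj ((sec φ U).obj x))
    (q := (push J h U).obj ((trivialTors J γ U).obj x)) (Functor.congr_obj e x) fun w m hm ↦ ?_) e
  have h₁ : (Tors.of J (FunOver.ofNat γ) ⟨U, x⟩).mem (𝟙 _) :=
    (Tors.of J (FunOver.ofNat γ) ⟨U, x⟩).mem_congr ((FunOver.ofNat γ).map_id ⟨U, x⟩)
      (Tors.of_map (J := J) (𝟙 (⟨U, x⟩ : Tot X)))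
  have h₂ := Tors.push_of_mem (Sq.ofNat h) h₁
  have h₃ : ((Tors.of J (FunOver.ofNat γ) ⟨U, x⟩).push (Sq.ofNat h)).mem
      ((Sq.ofNat h).arrow ⟨U, x⟩) :=
    Tors.mem_congr _ ((congrArg (_ ≫ ·) ((FunOver.ofNat Φ).map_id _)).trans (Category.comp_id _)) h₂
  exact Tors.mem_comp_of _ h₃ hm

end TorsObj

variable (J) in
/-- The morphism of presheaves of torsors induced by a commutative square. -/
def torsMap (h : γ ≫ Φ = φ ≫ γ') :
    torsPsh J (FunOver.ofNat γ) ⟶ torsPsh J (FunOver.ofNat γ') where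
  app U := TorsObj.push J h U.unop
  naturality _ _ f := TorsObj.res_push h f.unop

lemma torsUnit_torsMap (h : γ ≫ Φ = φ ≫ γ') :
    φ ≫ torsUnit J γ' = torsUnit J γ ≫ torsMap J h := by
  ext U
  exact TorsObj.trivialTors_push h U.unop

variable (J) {T : Type u} (P : T → GrothendieckTopology.Point.{u} J)

/-- The functor sending a presheaf of groupoids to the presheaf of torsors. -/
noncomputable def torsFunctor : (Cᵒᵖ ⥤ Grpd.{u, u}) ⥤ (Cᵒᵖ ⥤ Grpd.{u, u}) where
  obj X := torsPsh J (FunOver.ofNat (germs P X))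
  map φ := torsMap J (germs_naturality P φ)
  map_id X := by
    ext U
    exact TorsObj.push_id _ rfl (skyscraperMap_id P fun t ↦ stalkMap_id (P t)) U.unop
  map_comp φ ψ := by
    ext U
    exact TorsObj.push_comp _ _ _ rfl
      (skyscraperMap_comp P fun t ↦ stalkMap_comp (P t) φ ψ) U.unop

/-- The natural transformation to the presheaf of torsors. -/
noncomputable def torsFunctorUnit : 𝟭 _ ⟶ torsFunctor J P where
  app X := torsUnit J (germs P X)
  naturality _ _ φ := torsUnit_torsMap (germs_naturality P φ)

end PushFunctor

/-! ### Transport of the group action along a functor. -/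

section Action

variable {C : Type u} [SmallCategory C]

/-- The action of an element of the group on a presheaf of groupoids with action. -/
def PreGrpdAct.act (X : PreGrpdAct C) (g : Gam) : X.toPreGrpd ⟶ X.toPreGrpd where
  app U := (X.obj U).ρ g
  naturality _ _ f := ((X.map f).comm g).symm

lemma PreGrpdAct.act_one (X : PreGrpdAct C) : X.act 1 = 𝟙 _ := by
  ext U
  exact (X.obj U).ρ.map_one

lemma PreGrpdAct.act_mul (X : PreGrpdAct C) (g h : Gam) : X.act (g * h) = X.act h ≫ X.act g := by
  ext U
  exact (X.obj U).ρ.map_mul g h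

/-- The image of a presheaf of groupoids with action under a functor. -/
def PreGrpdAct.mapFunctor (S : (Cᵒᵖ ⥤ Grpd.{u, u}) ⥤ (Cᵒᵖ ⥤ Grpd.{u, u})) (X : PreGrpdAct C) :
    PreGrpdAct C where
  obj U :=
    { V := (S.obj X.toPreGrpd).obj U
      ρ :=
        { toFun := fun g ↦ (S.map (X.act g)).app U
          map_one' := by
            rw [PreGrpdAct.act_one, S.map_id]
            rfl
          map_mul' := fun g h ↦ by
            rw [PreGrpdAct.act_mul, S.map_comp]
            rfl } }
  map f := ⟨(S.obj X.toPreGrpd).map f, fun g ↦ ((S.map (X.act g)).naturality f).symm⟩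
  map_id U := Action.Hom.ext ((S.obj X.toPreGrpd).map_id U)
  map_comp f g := Action.Hom.ext ((S.obj X.toPreGrpd).map_comp f g)

/-- The equivariant morphism induced by a natural transformation. -/
def PreGrpdAct.mapUnit {S : (Cᵒᵖ ⥤ Grpd.{u, u}) ⥤ (Cᵒᵖ ⥤ Grpd.{u, u})} (η : 𝟭 _ ⟶ S)
    (X : PreGrpdAct C) : X ⟶ X.mapFunctor S where
  app U := ⟨(η.app X.toPreGrpd).app U, fun g ↦
    congrArg (fun k ↦ NatTrans.app k U) (η.naturality (X.act g))⟩
  naturality _ _ f := Action.Hom.ext ((η.app X.toPreGrpd).naturality f)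

end Action

/-! ### Stack completions are local equivalences; the theorem. -/

section Completion

variable {C : Type u} [SmallCategory C] {J : GrothendieckTopology C} {X Y Z : Cᵒᵖ ⥤ Grpd.{u, u}}

-- The points are indexed by a type in the universe `u`, so that the product of the skyscrapers at
-- all of them remains small.
variable (J) in
lemma exists_points [GrothendieckTopology.HasEnoughPoints.{u} J] :
    ∃ (T : Type u) (P : T → GrothendieckTopology.Point.{u} J),
      ∀ (U : C) (S : Sieve U), (∀ t (y : (P t).fiber.obj U),
        ∃ (V : C) (f : V ⟶ U) (_ : S f) (v : (P t).fiber.obj V), (P t).fiber.map f v = y) →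
          S ∈ J U := by
  obtain ⟨Q, hQ, hQ'⟩ := GrothendieckTopology.HasEnoughPoints.exists_objectProperty.{u} J
  have : Small.{u} (Subtype Q) := hQ
  refine ⟨Shrink.{u} (Subtype Q), fun t ↦ ((equivShrink _).symm t).1, fun U S hS ↦ ?_⟩
  let ι := { p : Σ V : C, (V ⟶ U) // S p.2 }
  have h : Sieve.ofArrows (fun i : ι ↦ i.1.1) (fun i : ι ↦ i.1.2) ∈ J U := by
    refine (hQ'.jointly_reflect_ofArrows_mem_of_small _).2 fun Φ y ↦ ?_
    obtain ⟨t, ht⟩ : ∃ t : Shrink.{u} (Subtype Q), ((equivShrink _).symm t).1 = Φ.obj :=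
      ⟨equivShrink _ ⟨Φ.obj, Φ.property⟩, by simp⟩
    obtain ⟨Φ, hΦ⟩ := Φ
    obtain rfl := ht
    obtain ⟨V, f, hf, v, hv⟩ := hS t y
    exact ⟨⟨⟨V, f⟩, hf⟩, v, hv⟩
  refine J.superset_covering ?_ h
  rw [Sieve.generate_le_iff, Presieve.ofArrows_le_iff]
  exact fun i ↦ i.2

/-- A local equivalence to a sheaf which is a stack is a stack completion. -/
theorem FunOver.IsLocEquiv.isStackCompletion {η : X ⟶ Y} (h : (FunOver.ofNat η).IsLocEquiv J)
    (hY : IsStackGrpd J Y) : IsStackCompletion J η where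
  isStack := hY
  isEquivalence Z hZ := (isEquivalence_precomp_iff η Z).2
    (FunOver.isEquivalence_precomp h (isStack_iff_totStack.1 hZ.isStack))

namespace FunOver

/-- A functor over `C` with the universal property of a local equivalence is itself a local
equivalence. -/
theorem IsLocEquiv.of_isEquivalence_precomp {W : Cᵒᵖ ⥤ Grpd.{u, u}} {η : FunOver X Y}
    {θ : FunOver X W} (hθ : θ.IsLocEquiv J) (h₁ : (η.precomp W).IsEquivalence)
    (h₂ : (η.precomp Y).IsEquivalence) (h₃ : (θ.precomp Y).IsEquivalence) : η.IsLocEquiv J := by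
  obtain ⟨F, ⟨α⟩⟩ := h₁.essSurj.mem_essImage θ
  obtain ⟨G, ⟨β⟩⟩ := h₃.essSurj.mem_essImage η
  obtain ⟨a, ha, hn⟩ : ∃ a : ∀ x : Tot X, F.o (η.o x) ⟶ θ.o x, (∀ x, Tot.bs (a x) = 𝟙 _) ∧
      ∀ {x x' : Tot X} (n : x ⟶ x'), F.map (η.map n) ≫ a x' = a x ≫ θ.map n :=
    ⟨fun x ↦ tapp α.hom x, fun x ↦ rfl, fun n ↦ tapp_naturality α.hom n⟩
  obtain ⟨b, hb, hm⟩ : ∃ b : ∀ x : Tot X, G.o (θ.o x) ⟶ η.o x, (∀ x, Tot.bs (b x) = 𝟙 _) ∧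
      ∀ {x x' : Tot X} (n : x ⟶ x'), G.map (θ.map n) ≫ b x' = b x ≫ η.map n :=
    ⟨fun x ↦ tapp β.hom x, fun x ↦ rfl, fun n ↦ tapp_naturality β.hom n⟩
  have isoa (x : Tot X) : IsIso (a x) :=
    have : IsIso (Tot.bs (a x)) := by rw [ha]; infer_instance
    Tot.isIso_of_isIso_bs _
  have isob (x : Tot X) : IsIso (b x) :=
    have : IsIso (Tot.bs (b x)) := by rw [hb]; infer_instance
    Tot.isIso_of_isIso_bs _
  obtain ⟨γ, -⟩ : ∃ γ : (η.precomp Y).obj (F.comp G) ⟶ (η.precomp Y).obj (FunOver.id Y),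
      ∀ x, tapp γ x = G.map (a x) ≫ b x := by
    refine exists_hom _ (fun x ↦ ?_) fun {x x'} n ↦ ?_
    · exact (Tot.comp_bs _ _).trans ((congrArg₂ (· ≫ ·) ((G.map_bs (a x)).trans (ha x))
        (hb x)).trans (Category.comp_id _))
    · refine (Category.assoc _ _ _).symm.trans ?_
      refine (congrArg (· ≫ b x') ((G.map_comp (F.map (η.map n)) (a x')).symm.trans
        ((congrArg G.map (hn n)).trans (G.map_comp _ _)))).trans ?_
      refine (Category.assoc _ _ _).trans ?_
      exact (congrArg (G.map (a x) ≫ ·) (hm n)).trans (Category.assoc _ _ _).symm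
  -- `γ` compares `F` followed by `G` with the identity only on the image of `η`. Fullness of
  -- restriction along `η` extends the comparison to all of `Y`.
  obtain ⟨δ, -⟩ := h₂.full.map_surjective γ
  obtain ⟨d, hd, hl⟩ : ∃ d : ∀ y : Tot Y, G.o (F.o y) ⟶ y, (∀ y, Tot.bs (d y) = 𝟙 _) ∧
      ∀ {y y' : Tot Y} (n : y ⟶ y'), G.map (F.map n) ≫ d y' = d y ≫ n :=
    ⟨fun y ↦ tapp δ y, fun y ↦ rfl, fun n ↦ tapp_naturality δ n⟩
  have isod (y : Tot Y) : IsIso (d y) :=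
    have : IsIso (Tot.bs (d y)) := by rw [hd]; infer_instance
    Tot.isIso_of_isIso_bs _
  -- Essential surjectivity is transported from `θ` by `G`, using `b` and `d`. For fullness, an
  -- arrow is moved to `W` by `F` and lifted there; `F` is faithful because `d` is invertible. Local
  -- faithfulness follows from that of `θ`, since `F` after `η` is isomorphic to `θ`.
  refine ⟨fun y ↦ ?_, fun {x x'} m ↦ ?_, fun {x x'} n n' h ↦ ?_⟩
  · refine (hθ.essSurj (F.o y)).mono fun V f ⟨x, i, hi⟩ ↦
      ⟨x, inv (b ⟨V, x⟩) ≫ G.map i ≫ d y, ?_⟩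
    have e : b ⟨V, x⟩ ≫ inv (b ⟨V, x⟩) ≫ G.map i ≫ d y = G.map i ≫ d y := by simp
    have e' := congrArg Tot.bs e
    rw [Tot.comp_bs, hb] at e'
    exact (Category.id_comp _).symm.trans (e'.trans ((Tot.comp_bs _ _).trans
      ((congrArg₂ (· ≫ ·) ((G.map_bs i).trans hi) (hd y)).trans (Category.comp_id _))))
  · refine (hθ.full (inv (a x) ≫ F.map m ≫ a x')).mono fun V f ⟨x₁, r, n, hr, e⟩ ↦
      ⟨x₁, r, n, hr, ?_⟩
    have e₁ : F.map (η.map n) = F.map (η.map r ≫ m) := by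
      rw [← cancel_mono (a x'), hn, e, F.map_comp, Category.assoc, ← Category.assoc (a _), ← hn]
      simp
    rw [← cancel_epi (d _), ← hl, ← hl, e₁]
  · refine hθ.faithful n n' ?_
    rw [← cancel_epi (a x), ← hn, ← hn, h]

end FunOver

variable (J) {T : Type u} (P : T → GrothendieckTopology.Point.{u} J)

theorem isStackGrpd_torsPsh :
    IsStackGrpd J (torsPsh J (FunOver.ofNat (germs P X))) where
  isSheaf := TotStack.isSheaf (torsPsh.totStack (skyscraper.totStack _ _))
    (torsPsh.gluesObjects (skyscraper.gluesObjects _ _))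
  isStack := isStack_iff_totStack.2 (torsPsh.totStack (skyscraper.totStack _ _))

/-- A stack completion is a local equivalence. -/
theorem IsStackCompletion.isLocEquiv [GrothendieckTopology.HasEnoughPoints.{u} J] {η : X ⟶ Y}
    (h : IsStackCompletion J η) : IsLocEquiv J η := by
  obtain ⟨T, P, hP⟩ := exists_points J
  have hθ := isLocEquiv_torsUnit J (germs P X) (germs_faithful P hP)
  exact (FunOver.IsLocEquiv.of_isEquivalence_precomp hθ
    ((isEquivalence_precomp_iff η _).1 (h.isEquivalence _ (isStackGrpd_torsPsh J P)))
    ((isEquivalence_precomp_iff η _).1 (h.isEquivalence _ h.isStack))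
    (FunOver.isEquivalence_precomp hθ (isStack_iff_totStack.1 h.isStack.isStack))).isLocEquiv

end Completion

theorem mainTheorem2 {C : Type u} [SmallCategory C] (J : GrothendieckTopology C)
    [GrothendieckTopology.HasEnoughPoints.{u} J] (X : PreGrpdAct C) :
    (∃ (Y : PreGrpdAct C) (η : X ⟶ Y), IsStackCompletion J (PreGrpdAct.forgetMap η)) ∧
    ∀ (Y : PreGrpdAct C) (η : X ⟶ Y), IsStackCompletion J (PreGrpdAct.forgetMap η) →
      IsLocalWeakEquiv J (PreGrpdAct.hFixedMap η) := by
  refine ⟨?_, fun Y η h ↦ (IsLocEquiv.hFixedMap (h.isLocEquiv J)).isLocalWeakEquiv⟩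
  obtain ⟨T, P, hP⟩ := exists_points J
  have hθ := isLocEquiv_torsUnit J (germs P X.toPreGrpd) (germs_faithful P hP)
  have h := hθ.isStackCompletion (isStackGrpd_torsPsh J P)
  -- Functoriality transports the action, and the morphism underlying the equivariant unit is
  -- definitionally the torsor unit, so `h` applies as it stands.
  exact ⟨X.mapFunctor (torsFunctor J P), X.mapUnit (torsFunctorUnit J P), h⟩
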